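/- Let $(M,[g])$ be a smooth manifold of dimension $n\ge 3$ with a conformal structure of arbitrary signature, and let $\mathcal E[w]$ be its density bundle of weight $w\in\mathbb R$: a section is a smooth function in each metric $g$ of the class, multiplied by $e^{w\Upsilon}$ when $g$ is replaced by $\hat g=e^{2\Upsilon}g$. Let $\boldsymbol g$ be the conformal metric, of weight $2$. Let $\mathcal E_A$ be the standard tractor bundle, identified with its dual by the tractor metric $h_{AB}$. In a metric $g$ of the class (a scale) its sections are $V_A=\alpha Y_A+\mu_aZ_A{}^a+\tau X_A$ with $(\alpha,\mu_a,\tau)\in\mathcal E[1]\oplus\mathcal E_a[1]\oplus\mathcal E[-1]$; these change by $$(\hat\alpha,\hat\mu_a,\hat\tau)=(\alpha,\ \mu_a+\Upsilon_a\alpha,\ \tau-\Upsilon^b\mu_b-\tfrac12\Upsilon_c\Upsilon^c\alpha),\qquad \Upsilon_a=\nabla_a\Upsilon .$$ Here $h(Y,X)=1$, $h(Z^a,Z^b)=\boldsymbol g^{ab}$, and the other pairings vanish. The tractor connection is $$\nabla_a(\alpha,\mu_b,\tau)=(\nabla_a\alpha-\mu_a,\ \nabla_a\mu_b+\boldsymbol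 g_{ab}\tau+P_{ab}\alpha,\ \nabla_a\tau-P_{ab}\mu^b),$$ with $P_{ab}$ the Schouten tensor; put $J=P^a{}_a$. Let $\mathcal E_{B\cdots E}[w]$ be the sections of a tensor power of $\mathcal E_A$ tensored with $\mathcal E[w]$. In a scale, with $\Delta=\boldsymbol g^{ab}\nabla_a\nabla_b$ for the coupled connection, the tractor-$D$ operator on $V\in\mathcal E_{B\cdots E}[w]$ is $$D_AV=(n+2w-2)wY_AV+(n+2w-2)Z_A{}^a\nabla_aV-X_A(\Delta+wJ)V .$$ Define the modified operator $\mathbb D_A=D_A-\frac1{n-4}X_AW\sharp\sharp$ if $n\ne4$, and $\mathbb D_A=D_A$ if $n=4$. Here $\sharp$ is the natural tensorial action of $\operatorname{End}(\mathcal E^A)$, and $$W_{ABCE}=(n-4)\bigl(Z_A{}^aZ_B{}^bZ_C{}^cZ_E{}^eC_{abce}-2Z_A{}^aZ_B{}^bX_{[C}Z_{E]}{}^eA_{eab}-2X_{[A}Z_{B]}{}^bZ_C{}^cZ_E{}^eA_{bce}\bigr)+4X_{[A}Z_{B]}{}^bX_{[C}Z_{E]}{}^eB_{eb},$$ where $C$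 is the Weyl tensor, $A_{abc}=2\nabla_{[b}P_{c]a}$ is the Cotton tensor and $B_{ab}=\nabla^cA_{acb}+P^{dc}C_{dacb}$ is the Bach tensor; $W$ is viewed as a section of $\operatorname{End}\otimes\operatorname{End}$ through its two index pairs. An Einstein scale is a nowhere vanishing $\sigma\in\mathcal E[1]$ such that $\sigma^{-2}\boldsymbol g$ is an Einstein metric. For such $\sigma$ put $I_A=\frac1nD_A\sigma$ and consider $I^A\mathbb D_A:\mathcal E_{B\cdots E}[w]\to\mathcal E_{B\cdots E}[w-1]$, which is defined for every $w$. **Theorem.** Let $\sigma,\bar\sigma$ be two Einstein scales in the conformal class, with $I_A=\frac1nD_A\sigma$ and $\bar I_A=\frac1nD_A\bar\sigma$, let $p\in\mathbb Z_{\ge0}$ and $w=p-\frac n2$. Then, on $\mathcal E_{B\cdots E}[w]$ of any tractor rank, $$\frac1{\sigma^{p}}\,(I^A\mathbb D_A)^p=\frac1{\bar\sigma^{p}}\,(\bar I^A\mathbb D_A)^p .$$ That is, the operator $\sigma^{-p}(I^A\mathbb D_A)^p:\mathcal E_{B\cdots E}[w]\to\mathcal E_{B\cdots E}[w-2p]$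 does not depend on the choice of the Einstein scale $\sigma$. -/

import Mathlib

open scoped Manifold ContDiff

noncomputable section

namespace Tractor

/-! ### Pseudo-Riemannian geometry in a coordinate chart

A metric is given in a chart by its matrix of coefficients `G : Coord n → Matrix (Fin n) (Fin n) ℝ`.
All tensors are given by their coordinate components. -/

/-- The coordinate space `ℝⁿ`. -/
abbrev Coord (n : ℕ) : Type := EuclideanSpace ℝ (Fin n)

/-- Coefficients `g_{ij}` of a metric in a chart. -/
abbrev MetricCoeff (n : ℕ) : Type := Coord n → Matrix (Fin n) (Fin n) ℝ

/-- The partial derivative `∂ᵢ f`. -/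
def pd {n : ℕ} (i : Fin n) (f : Coord n → ℝ) (x : Coord n) : ℝ :=
  fderiv ℝ f x (EuclideanSpace.single i 1)

section Local

variable {n : ℕ} (G : MetricCoeff n)

/-- The inverse metric `g^{ij}`. -/
def ginv (i j : Fin n) (x : Coord n) : ℝ := (G x)⁻¹ i j

/-- The Christoffel symbols `Γ^k_{ij}` of the Levi-Civita connection. -/
def christoffel (k i j : Fin n) (x : Coord n) : ℝ :=
  (1 / 2) * ∑ l, ginv G k l x *
    (pd i (fun y => G y j l) x + pd j (fun y => G y i l) x - pd l (fun y => G y i j) x)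

/-- The Riemannian curvature `R_{ij}{}^k{}_l`, where `[∇_i, ∇_j] v^k = R_{ij}{}^k{}_l v^l`. -/
def riemann (i j k l : Fin n) (x : Coord n) : ℝ :=
  pd i (christoffel G k j l) x - pd j (christoffel G k i l) x
    + ∑ m, (christoffel G k i m x * christoffel G m j l x
        - christoffel G k j m x * christoffel G m i l x)

/-- `R_{ijkl}`, the third index being lowered. -/
def riemannLow (i j k l : Fin n) (x : Coord n) : ℝ := ∑ m, G x k m * riemann G i j m l x

/-- The Ricci tensor `R_{jl} = R_{kj}{}^k{}_l`. -/
def ricci (j l : Fin n) (x : Coord n) : ℝ := ∑ k, riemann G k j k l x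

/-- The scalar curvature. -/
def scalarCurv (x : Coord n) : ℝ := ∑ i, ∑ j, ginv G i j x * ricci G i j x

/-- The Schouten tensor `P_{ij}`. -/
def schouten (i j : Fin n) (x : Coord n) : ℝ :=
  (ricci G i j x - scalarCurv G x / (2 * ((n : ℝ) - 1)) * G x i j) / ((n : ℝ) - 2)

/-- `J`, the trace of the Schouten tensor. -/
def schoutenTrace (x : Coord n) : ℝ := ∑ i, ∑ j, ginv G i j x * schouten G i j x

/-- The Weyl tensor: `R_{abcd} = C_{abcd} + 2 g_{c[a} P_{b]d} + 2 g_{d[b} P_{a]c}`. -/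
def weyl (a b c d : Fin n) (x : Coord n) : ℝ :=
  riemannLow G a b c d x
    - (G x c a * schouten G b d x - G x c b * schouten G a d x)
    - (G x d b * schouten G a c x - G x d a * schouten G b c x)

/-- `∇_a P_{bc}`. -/
def covSchouten (a b c : Fin n) (x : Coord n) : ℝ :=
  pd a (schouten G b c) x
    - ∑ m, (christoffel G m a b x * schouten G m c x + christoffel G m a c x * schouten G b m x)

/-- The Cotton tensor `A_{abc} = 2 ∇_{[b} P_{c]a}`. -/
def cotton (a b c : Fin n) (x : Coord n) : ℝ := covSchouten G b c a x - covSchouten G c b a x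

/-- `∇_d A_{abc}`. -/
def covCotton (d a b c : Fin n) (x : Coord n) : ℝ :=
  pd d (cotton G a b c) x
    - ∑ m, (christoffel G m d a x * cotton G m b c x + christoffel G m d b x * cotton G a m c x
        + christoffel G m d c x * cotton G a b m x)

/-- `P^{ab}`. -/
def schoutenUp (a b : Fin n) (x : Coord n) : ℝ :=
  ∑ c, ∑ d, ginv G a c x * ginv G b d x * schouten G c d x

/-- The Bach tensor `B_{ab} = ∇^c A_{acb} + P^{dc} C_{dacb}`. -/
def bach (a b : Fin n) (x : Coord n) : ℝ :=
  ∑ c, ∑ d, (ginv G c d x * covCotton G d a c b x + schoutenUp G d c x * weyl G d a c b x)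

end Local

/-! ### Tractor calculus in a scale and a chart

In a scale `g` (which trivialises the density bundles) and a chart, a covariant tractor is written
`V_A = α Y_A + μ_a Z_A^a + τ X_A`. -/

/-- Indices for the components with respect to the frame `Y_A`, `Z_A^a`, `X_A`:
`.inl ()` is the slot of `Y` (the top slot `α`), `.inr (.inl a)` is the slot of `Z^a`
(the middle slot `μ_a`) and `.inr (.inr ())` is the slot of `X` (the bottom slot `τ`). -/
abbrev TIdx (n : ℕ) : Type := Unit ⊕ (Fin n ⊕ Unit)

/-- The component at an index in the `Y`-direction. -/
def yC {n : ℕ} : TIdx n → ℝ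
  | .inl _ => 1
  | .inr (.inl _) => 0
  | .inr (.inr _) => 0

/-- The components of `Z_A^a`. -/
def zC {n : ℕ} (a : Fin n) : TIdx n → ℝ
  | .inl _ => 0
  | .inr (.inl b) => if b = a then 1 else 0
  | .inr (.inr _) => 0

/-- The components of `X_A`. -/
def xC {n : ℕ} : TIdx n → ℝ
  | .inl _ => 0
  | .inr (.inl _) => 0
  | .inr (.inr _) => 1

/-- Components, on a chart, of a covariant tractor tensor `V_{B⋯E}` of rank `r`. -/
abbrev LocalTractor (n r : ℕ) : Type := Coord n → (Fin r → TIdx n) → ℝ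

section LocalTractors

variable {n : ℕ} (G : MetricCoeff n)

/-- The inverse tractor metric `h^{AB}`: `h(Y, X) = 1`, `h(Z^a, Z^b) = g^{ab}`. -/
def hInv : TIdx n → TIdx n → Coord n → ℝ
  | .inl _, .inr (.inr _), _ => 1
  | .inr (.inr _), .inl _, _ => 1
  | .inr (.inl a), .inr (.inl b), x => ginv G a b x
  | _, _, _ => 0

/-- The coefficients of the tractor connection: on standard tractors
`(∇_a V)_I = ∂_a V_I + ∑_K tractorConn G a I K · V_K`, that is
`∇_a (α, μ_b, τ) = (∇_a α - μ_a, ∇_a μ_b + g_{ab} τ + P_{ab} α, ∇_a τ - P_{ab} μ^b)`. -/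
def tractorConn (a : Fin n) : TIdx n → TIdx n → Coord n → ℝ
  | .inl _, .inr (.inl b), _ => if b = a then -1 else 0
  | .inr (.inl b), .inl _, x => schouten G a b x
  | .inr (.inl b), .inr (.inl c), x => -christoffel G c a b x
  | .inr (.inl b), .inr (.inr _), x => G x a b
  | .inr (.inr _), .inr (.inl c), x => -∑ b, schouten G a b x * ginv G b c x
  | _, _, _ => 0

/-- The tractor connection `∇_a` on tractor tensors of rank `r`. -/
def tractorNabla {r : ℕ} (a : Fin n) (V : LocalTractor n r) : LocalTractor n r := fun x I =>
  pd a (fun y => V y I) x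
    + ∑ k, ∑ K, tractorConn G a (I k) K x * V x (Function.update I k K)

/-- The Laplacian `Δ = g^{ab} ∇_a ∇_b` of the (coupled) tractor and Levi-Civita connection. -/
def tractorLaplacian {r : ℕ} (V : LocalTractor n r) : LocalTractor n r := fun x I =>
  ∑ a, ∑ b, ginv G a b x * (tractorNabla G a (tractorNabla G b V) x I
    - ∑ c, christoffel G c a b x * tractorNabla G c V x I)

/-- The tractor-`D` operator on tractor tensors of weight `w`,
`D_A V = (n+2w-2) w Y_A V + (n+2w-2) Z_A^a ∇_a V - X_A (Δ V + w J V)`;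
the new index is the first one. -/
def tractorD {r : ℕ} (w : ℝ) (V : LocalTractor n r) : LocalTractor n (r + 1) := fun x I =>
  (n + 2 * w - 2) * w * yC (I 0) * V x (Fin.tail I)
    + (n + 2 * w - 2) * ∑ a, zC a (I 0) * tractorNabla G a V x (Fin.tail I)
    - xC (I 0) * (tractorLaplacian G V x (Fin.tail I) + w * schoutenTrace G x * V x (Fin.tail I))

/-- The components of `2 X_{[A} Z_{B]}^b`. -/
def xzWedge (b : Fin n) (A B : TIdx n) : ℝ := xC A * zC b B - xC B * zC b A

/-- The `W`-tractor `W_{ABCE}`: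
`(n-4) (Z_A^a Z_B^b Z_C^c Z_E^e C_{abce} - 2 Z_A^a Z_B^b X_{[C} Z_{E]}^e A_{eab}
  - 2 X_{[A} Z_{B]}^b Z_C^c Z_E^e A_{bce}) + 4 X_{[A} Z_{B]}^b X_{[C} Z_{E]}^e B_{eb}`. -/
def wTractor (A B C E : TIdx n) (x : Coord n) : ℝ :=
  ((n : ℝ) - 4) *
      ((∑ a, ∑ b, ∑ c, ∑ e, zC a A * zC b B * zC c C * zC e E * weyl G a b c e x)
        - (∑ a, ∑ b, ∑ e, zC a A * zC b B * xzWedge e C E * cotton G e a b x)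
        - (∑ b, ∑ c, ∑ e, xzWedge b A B * zC c C * zC e E * cotton G b c e x))
    + ∑ b, ∑ e, xzWedge b A B * xzWedge e C E * bach G e b x

/-- `W^A{}_B{}^C{}_E`, that is the `W`-tractor as a section of `End ⊗ End`. -/
def wEnd (A B C E : TIdx n) (x : Coord n) : ℝ :=
  ∑ A', ∑ C', hInv G A A' x * hInv G C C' x * wTractor G A' B C' E x

/-- `W♯♯ V`, where `♯` is the natural tensorial action of endomorphisms: an endomorphism `T^A{}_B`
acts on covariant tractor tensors by `(T♯V)_{I₁⋯I_r} = -∑_k T^K{}_{I_k} V_{I₁⋯K⋯I_r}`, and the two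
endomorphism factors of `W^A{}_B{}^C{}_E` act one after the other (so that the signs cancel). -/
def wSharpSharp {r : ℕ} (V : LocalTractor n r) : LocalTractor n r := fun x I =>
  ∑ k, ∑ K, ∑ l, ∑ L,
    wEnd G K (I k) L (Function.update I k K l) x
      * V x (Function.update (Function.update I k K) l L)

/-- The modified tractor-`D` operator: `D_A - (n-4)⁻¹ X_A W♯♯` if `n ≠ 4`, and `D_A` if `n = 4`. -/
def modD {r : ℕ} (w : ℝ) (V : LocalTractor n r) : LocalTractor n (r + 1) := fun x I =>
  if n = 4 then tractorD G w V x I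
  else tractorD G w V x I - 1 / ((n : ℝ) - 4) * xC (I 0) * wSharpSharp G V x (Fin.tail I)

/-- `I_A = (1/n) D_A σ` for a density `σ` of weight `1`, given in the scale by the function `s`. -/
def scaleTractor (s : Coord n → ℝ) (A : TIdx n) (x : Coord n) : ℝ :=
  1 / (n : ℝ) * tractorD (r := 0) G 1 (fun y _ => s y) x (fun _ => A)

/-- The operator `I^A 𝔻_A` on tractor tensors of weight `w`, where `I_A = (1/n) D_A σ`. -/
def localModBox {r : ℕ} (s : Coord n → ℝ) (w : ℝ) (V : LocalTractor n r) : LocalTractor n r :=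
  fun x I => ∑ A, ∑ B, hInv G A B x * scaleTractor G s B x
    * modD G w V x (Fin.cons (α := fun _ => TIdx n) A I)

end LocalTractors

/-! ### Conformal manifolds, densities, weighted tractor fields -/

section Global

variable (n : ℕ) (M : Type*) [TopologicalSpace M] [ChartedSpace (Coord n) M]

/-- The smooth charts of `M` (members of the maximal smooth atlas). -/
abbrev Chart : Type _ :=
  {φ : OpenPartialHomeomorph M (Coord n) // φ ∈ IsManifold.maximalAtlas (𝓡 n) ∞ M}

variable {n M}

/-- The coordinate vector field `∂ᵢ` of a chart, at the point with coordinates `y`. -/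
def coordVec (φ : Chart n M) (i : Fin n) (y : Coord n) : TangentSpace (𝓡 n) (φ.1.symm y) :=
  mfderiv (𝓡 n) (𝓡 n) φ.1.symm y (EuclideanSpace.single i (1 : ℝ) : Coord n)

variable (n M)

/-- A smooth pseudo-Riemannian metric on `M`. -/
structure PseudoMetric where
  /-- The inner product on the tangent space at `x`. -/
  val : ∀ x : M, LinearMap.BilinForm ℝ (TangentSpace (𝓡 n) x)
  symm : ∀ x u v, val x u v = val x v u
  nondegenerate : ∀ x u, (∀ v, val x u v = 0) → u = 0
  smooth : ∀ (φ : Chart n M) (i j : Fin n),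
    ContDiffOn ℝ ∞ (fun y => val (φ.1.symm y) (coordVec φ i y) (coordVec φ j y)) φ.1.target

variable {n M}

/-- The coefficients of a metric in a chart. -/
def PseudoMetric.coeff (g : PseudoMetric n M) (φ : Chart n M) : MetricCoeff n := fun y =>
  Matrix.of fun i j => g.val (φ.1.symm y) (coordVec φ i y) (coordVec φ j y)

/-- `ĝ = e^{2Υ} g` with `Υ` smooth. -/
def IsRescaling (Υ : M → ℝ) (g ĝ : PseudoMetric n M) : Prop :=
  ContMDiff (𝓡 n) 𝓘(ℝ, ℝ) ∞ Υ ∧ ∀ x u v, ĝ.val x u v = Real.exp (2 * Υ x) * g.val x u v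

variable (n M)

/-- A conformal structure on `M`: a class of metrics that are the smooth rescalings of one another. -/
structure ConformalStructure where
  /-- The metrics in the conformal class. -/
  metrics : Set (PseudoMetric n M)
  nonempty : metrics.Nonempty
  mem_iff : ∀ g ∈ metrics, ∀ ĝ, ĝ ∈ metrics ↔ ∃ Υ, IsRescaling Υ g ĝ

variable {n M}

/-- The metric is Einstein: `Ric = (Sc / n) g`. -/
def PseudoMetric.IsEinstein (g : PseudoMetric n M) : Prop :=
  ∀ (φ : Chart n M), ∀ y ∈ φ.1.target, ∀ i j,
    ricci (g.coeff φ) i j y = scalarCurv (g.coeff φ) y / n * g.coeff φ y i j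

variable (c : ConformalStructure n M)

/-- A smooth section of the density bundle `E[w]` of `(M, c)`: by the trivialisations, a function
for each metric in the class, with `f_ĝ = e^{wΥ} f_g` for `ĝ = e^{2Υ} g`. -/
structure Density (w : ℝ) where
  /-- The function that represents the density in the scale `g`. -/
  val : c.metrics → M → ℝ
  smooth : ∀ g, ContMDiff (𝓡 n) 𝓘(ℝ, ℝ) ∞ (val g)
  rescale : ∀ (g ĝ : c.metrics) (Υ : M → ℝ), IsRescaling Υ g.1 ĝ.1 →
    ∀ x, val ĝ x = Real.exp (w * Υ x) * val g x

variable {c}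

/-- `σ ∈ E[1]` is an Einstein scale: it does not vanish, and `σ⁻² 𝐠` (with `𝐠` the conformal
metric) is an Einstein metric in the conformal class. -/
def IsEinsteinScale (σ : Density c 1) : Prop :=
  (∀ h x, σ.val h x ≠ 0) ∧
    ∃ g ∈ c.metrics, g.IsEinstein ∧
      ∀ (h : c.metrics) (x : M) (u v : TangentSpace (𝓡 n) x),
        g.val x u v = ((σ.val h x) ^ 2)⁻¹ * h.1.val x u v

variable (c)

/-- Families of components, for each scale and each chart. -/
abbrev TractorFamily (r : ℕ) : Type _ := c.metrics → Chart n M → LocalTractor n r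

variable {c}

/-- The transformation of covariant tractors of weight `0` from the scale with metric coefficients
`G` to the scale `e^{2Υ} G`, in a fixed chart:
`(α, μ_a, τ) ↦ (α, μ_a + Υ_a α, τ - Υ^b μ_b - ½ Υ_c Υ^c α)`, with `α, μ_a, τ` of respective weights
`1, 1, -1`. -/
def scaleTransition (G : MetricCoeff n) (Υ : Coord n → ℝ) (y : Coord n) : TIdx n → TIdx n → ℝ
  | .inl _, .inl _ => Real.exp (Υ y)
  | .inr (.inl a), .inl _ => Real.exp (Υ y) * pd a Υ y
  | .inr (.inl a), .inr (.inl b) => if a = b then Real.exp (Υ y) else 0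
  | .inr (.inr _), .inl _ =>
      -(1 / 2) * Real.exp (-Υ y) * ∑ a, ∑ b, ginv G a b y * pd a Υ y * pd b Υ y
  | .inr (.inr _), .inr (.inl b) => -Real.exp (-Υ y) * ∑ a, ginv G a b y * pd a Υ y
  | .inr (.inr _), .inr (.inr _) => Real.exp (-Υ y)
  | _, _ => 0

/-- The transformation of tractor components under a change of coordinates from `φ` to `ψ`, at the
point with `ψ`-coordinates `y`: the middle slot is a covector. -/
def chartTransition (φ ψ : Chart n M) (y : Coord n) : TIdx n → TIdx n → ℝ
  | .inl _, .inl _ => 1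
  | .inr (.inl a), .inr (.inl b) => pd a (fun z => φ.1 (ψ.1.symm z) b) y
  | .inr (.inr _), .inr (.inr _) => 1
  | _, _ => 0

/-- The family is a smooth section of the weighted tractor bundle `E_{B⋯E}[w]` of rank `r`. -/
structure IsTractorField {r : ℕ} (w : ℝ) (V : TractorFamily c r) : Prop where
  smooth : ∀ g φ I, ContDiffOn ℝ ∞ (fun y => V g φ y I) φ.1.target
  rescale : ∀ (g ĝ : c.metrics) (Υ : M → ℝ), IsRescaling Υ g.1 ĝ.1 →
    ∀ (φ : Chart n M), ∀ y ∈ φ.1.target, ∀ I,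
      V ĝ φ y I = Real.exp (w * Υ (φ.1.symm y)) *
        ∑ K : Fin r → TIdx n,
          (∏ k, scaleTransition (g.1.coeff φ) (fun z => Υ (φ.1.symm z)) y (I k) (K k)) * V g φ y K
  chart : ∀ (g : c.metrics) (φ ψ : Chart n M), ∀ x ∈ φ.1.source, x ∈ ψ.1.source → ∀ I,
    V g ψ (ψ.1 x) I =
      ∑ K : Fin r → TIdx n, (∏ k, chartTransition φ ψ (ψ.1 x) (I k) (K k)) * V g φ (φ.1 x) K

/-- The operator `I^A 𝔻_A` of the scale `σ` on tractors of weight `w`, in every scale and chart. -/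
def modBox {r : ℕ} (σ : Density c 1) (w : ℝ) (V : TractorFamily c r) : TractorFamily c r :=
  fun g φ => localModBox (g.1.coeff φ) (fun y => σ.val g (φ.1.symm y)) w (V g φ)

/-- The power `(I^A 𝔻_A)^p` on tractors of weight `w`; each factor lowers the weight by `1`. -/
def modBoxPow {r : ℕ} (σ : Density c 1) : ℕ → ℝ → TractorFamily c r → TractorFamily c r
  | 0, _, V => V
  | p + 1, w, V => modBoxPow σ p (w - 1) (modBox σ w V)

/-- The operator `σ^{-p} (I^A 𝔻_A)^p` on tractors of weight `w`. -/
def scaledPower {r : ℕ} (σ : Density c 1) (p : ℕ) (w : ℝ) (V : TractorFamily c r) :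
    TractorFamily c r :=
  fun g φ y I => ((σ.val g (φ.1.symm y)) ^ p)⁻¹ * modBoxPow σ p w V g φ y I

end Global

end Tractor

/-! Write `s`, `t` for two Einstein scales, `I`, `I'` for their tractors, and `op_s`, `op_t` for the
operators `I^A 𝔻_A`, `I'^A 𝔻_A` (`AlgMetric.op`). Two facts give the theorem.

(1) `t • op_s - s • op_t = (n + 2w - 2) • kop` (`op_sub_op`), where `kop = ∇_k - wν` is a first
order operator built from `k = t∇s - s∇t` and `ν = sτ_t - tτ_s`. Hence `t • op_s = s • op_t` at the
weight `1 - n/2`.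

(2) The operators commute: `op_s op_t = op_t op_s` (`op_comm`).

For `w = p - n/2` the last of the `p` factors acts at weight `1 - n/2`. Commutation lets any factor
be moved to that place, where (1) trades `op_s` for `op_t`; induction gives `t^p op_s^p = s^p
op_t^p` (`AlgMetric.pow_smul_opPow`).

For (2), the tractors are parallel, so the tractor curvature `Ω` kills them: the Cotton tensor times
a scale is the Weyl tensor contracted with the gradient of that scale. Comparing both scales gives
`k^a Ω_ab = 0` (`sum_kf_tcurv`). Moreover `k` is a conformal Killing field with factor `ν`
(`covV_kf`). So `∇_k` commutes with the Laplacian up to the terms expected of a conformal symmetry,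
and `[op_s, kop] = h(I,I') op_s - h(I,I) op_t` (`op_kop`). With the rules for `op_s (s • m)` and
`op_s (t • m)`, this forces `s • [op_s, op_t] = 0`.

The curvature term must also be compatible with `k`. With `u = s⁻¹∇s` an Einstein scale satisfies `A
= u·C` and `B = (n-4) u·A` for the Cotton and Bach tensors (`cot_mul_self`, `bach_mul`). Hence `W`
is `n - 4` times `(Z - uX)(Z - uX)Ω` (`wT_eq`). Along `k` the Lie derivative of `Ω` vanishes by the
Bianchi identity, and the extra terms from `Z - uX` contain `k` contracted into `Ω`
(`curvTerm_nab`).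

All identities are algebraic. They are proved over a commutative `ℝ`-algebra with commuting
derivations and then applied to functions smooth on a chart domain. -/

set_option linter.unusedSectionVars false

/-! ### Pseudo-Riemannian geometry over a differential algebra: symmetries of the curvature. -/

namespace Tractor

/-- A pseudo-Riemannian metric over a commutative `ℝ`-algebra with commuting derivations. -/
structure AlgMetric (n : ℕ) (R : Type*) [CommRing R] [Algebra ℝ R] where
  /-- The partial derivatives. -/
  d : Fin n → Derivation ℝ R R
  d_comm : ∀ i j f, d i (d j f) = d j (d i f)
  /-- The metric. -/
  g : Matrix (Fin n) (Fin n) R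
  /-- The inverse metric. -/
  gi : Matrix (Fin n) (Fin n) R
  g_symm : g.transpose = g
  gi_mul_g : gi * g = 1

section MatrixCalculus

variable {n : ℕ} {R : Type*} [CommRing R] [Algebra ℝ R] {κ : Type*} [Fintype κ] [DecidableEq κ]

/-- Entrywise application of a derivation to a matrix. -/
def matD (D : Derivation ℝ R R) (A : Matrix κ κ R) : Matrix κ κ R := A.map D

@[simp] lemma matD_apply (D : Derivation ℝ R R) (A : Matrix κ κ R) (i j : κ) :
    matD D A i j = D (A i j) := rfl

lemma matD_mul (D : Derivation ℝ R R) (A B : Matrix κ κ R) :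
    matD D (A * B) = matD D A * B + A * matD D B := by
  ext i j
  simp only [matD_apply, Matrix.mul_apply, Matrix.add_apply, map_sum, Derivation.leibniz,
    smul_eq_mul, Finset.sum_add_distrib]
  rw [add_comm]
  congr 1
  exact Finset.sum_congr rfl fun _ _ => mul_comm _ _

lemma matD_add (D : Derivation ℝ R R) (A B : Matrix κ κ R) :
    matD D (A + B) = matD D A + matD D B := by
  ext i j; simp

lemma matD_sub (D : Derivation ℝ R R) (A B : Matrix κ κ R) :
    matD D (A - B) = matD D A - matD D B := by
  ext i j; simp

lemma matD_neg (D : Derivation ℝ R R) (A : Matrix κ κ R) : matD D (-A) = -matD D A := by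
  ext i j; simp

lemma matD_one (D : Derivation ℝ R R) : matD D (1 : Matrix κ κ R) = 0 := by
  ext i j
  by_cases h : i = j <;> simp [h]

lemma matD_transpose (D : Derivation ℝ R R) (A : Matrix κ κ R) :
    matD D A.transpose = (matD D A).transpose := rfl

/-- The curvature of the connection with connection matrices `A i`. -/
def curv (d : Fin n → Derivation ℝ R R) (A : Fin n → Matrix κ κ R) (i j : Fin n) :
    Matrix κ κ R :=
  matD (d i) (A j) - matD (d j) (A i) + (A i * A j - A j * A i)

/-- The derivative of an endomorphism with respect to a connection. -/
def endD (d : Fin n → Derivation ℝ R R) (A : Fin n → Matrix κ κ R) (i : Fin n)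
    (S : Matrix κ κ R) : Matrix κ κ R :=
  matD (d i) S + (A i * S - S * A i)

lemma curv_swap (d : Fin n → Derivation ℝ R R) (A : Fin n → Matrix κ κ R) (i j : Fin n) :
    curv d A j i = -curv d A i j := by
  unfold curv; abel

/-- The second Bianchi identity. -/
lemma bianchi (d : Fin n → Derivation ℝ R R) (hd : ∀ i j f, d i (d j f) = d j (d i f))
    (A : Fin n → Matrix κ κ R) (i j k : Fin n) :
    endD d A k (curv d A i j) + endD d A i (curv d A j k) + endD d A j (curv d A k i) = 0 := by
  have h : ∀ i j l, matD (d i) (matD (d j) (A l)) = matD (d j) (matD (d i) (A l)) := by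
    intro i j l; ext a b; simp [hd i j]
  simp only [endD, curv, matD_add, matD_sub, matD_mul]
  -- After the mixed second derivatives are matched, a polynomial identity in non-commuting matrices
  -- remains.
  rw [h i k j, h j k i, h i j k]
  noncomm_ring

end MatrixCalculus

namespace AlgMetric

variable {n : ℕ} {R : Type*} [CommRing R] [Algebra ℝ R] (Q : AlgMetric n R)

lemma g_comm (i j : Fin n) : Q.g i j = Q.g j i := by
  conv_lhs => rw [← Q.g_symm]
  rfl

lemma g_mul_gi : Q.g * Q.gi = 1 := mul_eq_one_comm.mp Q.gi_mul_g

lemma gi_symm : Q.gi.transpose = Q.gi := by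
  have h : Q.gi.transpose * Q.g = 1 := by
    have := congrArg Matrix.transpose Q.g_mul_gi
    rwa [Matrix.transpose_mul, Q.g_symm, Matrix.transpose_one] at this
  calc Q.gi.transpose = Q.gi.transpose * (Q.g * Q.gi) := by rw [Q.g_mul_gi, mul_one]
    _ = Q.gi := by rw [← mul_assoc, h, one_mul]

lemma gi_comm (i j : Fin n) : Q.gi i j = Q.gi j i := by
  conv_lhs => rw [← Q.gi_symm]
  rfl

lemma sum_gi_g (a c : Fin n) : ∑ b, Q.gi a b * Q.g b c = if a = c then 1 else 0 := by
  rw [← Matrix.mul_apply, Q.gi_mul_g, Matrix.one_apply]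

lemma sum_g_gi (a c : Fin n) : ∑ b, Q.g a b * Q.gi b c = if a = c then 1 else 0 := by
  rw [← Matrix.mul_apply, Q.g_mul_gi, Matrix.one_apply]

/-- The Christoffel symbols `Γ^k_{ij}`. -/
def Γ (k i j : Fin n) : R :=
  algebraMap ℝ R (1 / 2) * ∑ l, Q.gi k l *
    (Q.d i (Q.g j l) + Q.d j (Q.g i l) - Q.d l (Q.g i j))

/-- The Riemannian curvature `R_{ij}{}^k{}_l`. -/
def riem (i j k l : Fin n) : R :=
  Q.d i (Q.Γ k j l) - Q.d j (Q.Γ k i l) + ∑ m, (Q.Γ k i m * Q.Γ m j l - Q.Γ k j m * Q.Γ m i l)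

/-- The Ricci tensor. -/
def ric (j l : Fin n) : R := ∑ k, Q.riem k j k l

/-- The scalar curvature. -/
def scal : R := ∑ i, ∑ j, Q.gi i j * Q.ric i j

/-- The Schouten tensor. -/
def P (i j : Fin n) : R :=
  algebraMap ℝ R (((n : ℝ) - 2)⁻¹) *
    (Q.ric i j - algebraMap ℝ R ((2 * ((n : ℝ) - 1))⁻¹) * Q.scal * Q.g i j)

/-- The trace of the Schouten tensor. -/
def J : R := ∑ i, ∑ j, Q.gi i j * Q.P i j

/-- The Weyl tensor `C_{abcd}`. -/
def weylLow (a b c d : Fin n) : R :=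
  (∑ m, Q.g c m * Q.riem a b m d)
    - (Q.g c a * Q.P b d - Q.g c b * Q.P a d)
    - (Q.g d b * Q.P a c - Q.g d a * Q.P b c)

/-- `∇_a T_{bc}`. -/
def cov2 (T : Fin n → Fin n → R) (a b c : Fin n) : R :=
  Q.d a (T b c) - ∑ m, (Q.Γ m a b * T m c + Q.Γ m a c * T b m)

/-- The Cotton tensor. -/
def cot (a b c : Fin n) : R := Q.cov2 Q.P b c a - Q.cov2 Q.P c b a

/-- `∇_d A_{abc}`. -/
def covCot (e a b c : Fin n) : R :=
  Q.d e (Q.cot a b c) - ∑ m, (Q.Γ m e a * Q.cot m b c + Q.Γ m e b * Q.cot a m c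
    + Q.Γ m e c * Q.cot a b m)

/-- `P^{ab}`. -/
def PUp (a b : Fin n) : R := ∑ c, ∑ d, Q.gi a c * Q.gi b d * Q.P c d

/-- The Bach tensor. -/
def bachT (a b : Fin n) : R :=
  ∑ c, ∑ d, (Q.gi c d * Q.covCot d a c b + Q.PUp d c * Q.weylLow d a c b)

/-- `R` is only an `ℝ`-algebra, so divisions by two go through the scalars and are cleared with this
relation. -/
lemma half : (2 : R) * algebraMap ℝ R (1 / 2) = 1 := by
  rw [← map_ofNat (algebraMap ℝ R) 2, ← map_mul]; norm_num

lemma Γ_symm (k i j : Fin n) : Q.Γ k i j = Q.Γ k j i := by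
  unfold Γ
  congr 1
  refine Finset.sum_congr rfl fun l _ => ?_
  rw [Q.g_comm i j]; ring

lemma g_Γ (k i j : Fin n) : ∑ m, Q.g k m * Q.Γ m i j =
    algebraMap ℝ R (1 / 2) * (Q.d i (Q.g j k) + Q.d j (Q.g i k) - Q.d k (Q.g i j)) := by
  have : ∀ m, Q.g k m * Q.Γ m i j = algebraMap ℝ R (1 / 2) * ∑ l, (Q.g k m * Q.gi m l) *
      (Q.d i (Q.g j l) + Q.d j (Q.g i l) - Q.d l (Q.g i j)) := by
    intro m
    simp only [Γ, Finset.mul_sum]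
    exact Finset.sum_congr rfl fun l _ => by ring
  simp only [this]
  rw [← Finset.mul_sum, Finset.sum_comm]
  congr 1
  simp only [← Finset.sum_mul, sum_g_gi]
  simp

/-- The metric is parallel. -/
lemma d_g (i j k : Fin n) :
    Q.d i (Q.g j k) = ∑ m, (Q.Γ m i j * Q.g m k + Q.Γ m i k * Q.g j m) := by
  have e : ∑ m, (Q.Γ m i j * Q.g m k + Q.Γ m i k * Q.g j m)
      = ∑ m, Q.g k m * Q.Γ m i j + ∑ m, Q.g j m * Q.Γ m i k := by
    rw [← Finset.sum_add_distrib]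
    refine Finset.sum_congr rfl fun m _ => ?_
    rw [Q.g_comm m k]; ring
  rw [e, g_Γ, g_Γ, Q.g_comm k j]
  linear_combination (-Q.d i (Q.g j k)) * half (R := R)

/-- The connection matrices of the Levi-Civita connection on vector fields. -/
def Γm (i : Fin n) : Matrix (Fin n) (Fin n) R := Matrix.of fun k j => Q.Γ k i j

@[simp] lemma Γm_apply (i j k : Fin n) : Q.Γm i k j = Q.Γ k i j := rfl

lemma matD_g (i : Fin n) : matD (Q.d i) Q.g = (Q.Γm i).transpose * Q.g + Q.g * Q.Γm i := by
  ext j k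
  simp only [matD_apply, d_g, Matrix.add_apply, Matrix.mul_apply, Matrix.transpose_apply, Γm_apply,
    Finset.sum_add_distrib]
  congr 1
  exact Finset.sum_congr rfl fun m _ => mul_comm _ _

/-- Differentiate `g * gi = 1`, insert `matD_g`, and multiply by `gi` on the left. -/
lemma matD_gi (i : Fin n) :
    matD (Q.d i) Q.gi = -(Q.gi * (Q.Γm i).transpose + Q.Γm i * Q.gi) := by
  have h := matD_mul (Q.d i) Q.g Q.gi
  rw [g_mul_gi, matD_one, matD_g] at h
  calc matD (Q.d i) Q.gi = Q.gi * (((Q.Γm i).transpose * Q.g + Q.g * Q.Γm i) * Q.gi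
        + Q.g * matD (Q.d i) Q.gi) - Q.gi * (Q.Γm i).transpose * (Q.g * Q.gi)
        - (Q.gi * Q.g) * Q.Γm i * Q.gi + (1 - Q.gi * Q.g) * matD (Q.d i) Q.gi := by noncomm_ring
    _ = _ := by rw [← h, g_mul_gi, gi_mul_g]; noncomm_ring

lemma d_gi (i j k : Fin n) :
    Q.d i (Q.gi j k) = -∑ m, (Q.Γ j i m * Q.gi m k + Q.Γ k i m * Q.gi j m) := by
  have h := congrFun (congrFun (Q.matD_gi i) j) k
  simp only [matD_apply, Matrix.neg_apply, Matrix.add_apply, Matrix.mul_apply,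
    Matrix.transpose_apply, Γm_apply] at h
  rw [h, Finset.sum_add_distrib, add_comm]
  congr 2
  exact Finset.sum_congr rfl fun m _ => mul_comm _ _

/-- The Riemannian curvature as a matrix. -/
def Rm (i j : Fin n) : Matrix (Fin n) (Fin n) R := curv Q.d Q.Γm i j

lemma Rm_apply (i j k l : Fin n) : Q.Rm i j k l = Q.riem i j k l := by
  simp only [Rm, curv, riem, Matrix.add_apply, Matrix.sub_apply, matD_apply, Γm_apply,
    Matrix.mul_apply, Finset.sum_sub_distrib]

lemma riem_swap (i j k l : Fin n) : Q.riem j i k l = -Q.riem i j k l := by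
  rw [← Rm_apply, ← Rm_apply, Rm, curv_swap]; rfl

/-- `R_{ijkl}`. -/
def riemLow (i j k l : Fin n) : R := ∑ m, Q.g k m * Q.riem i j m l

lemma riemLow_swap (i j k l : Fin n) : Q.riemLow j i k l = -Q.riemLow i j k l := by
  simp only [riemLow, riem_swap Q i j, mul_neg, Finset.sum_neg_distrib]

lemma gRm_apply (i j k l : Fin n) : (Q.g * Q.Rm i j) k l = Q.riemLow i j k l := by
  simp only [Matrix.mul_apply, Rm_apply, riemLow]

/-- Mixed second derivatives of the metric commute. Expanding both orders through `matD_g` leaves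
`Rᵀ g + g R = 0`. -/
lemma riemLow_swap' (i j k l : Fin n) : Q.riemLow i j l k = -Q.riemLow i j k l := by
  have key : (Q.Rm i j).transpose * Q.g + Q.g * Q.Rm i j = 0 := by
    have h1 : matD (Q.d i) (matD (Q.d j) Q.g) = matD (Q.d j) (matD (Q.d i) Q.g) := by
      ext a b; exact Q.d_comm _ _ _
    rw [matD_g, matD_g] at h1
    simp only [matD_add, matD_mul, matD_transpose, matD_g] at h1
    simp only [Rm, curv, Matrix.transpose_add, Matrix.transpose_sub, Matrix.transpose_mul]
    rw [← sub_eq_zero] at h1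
    rw [← h1]
    noncomm_ring
  have h2 : ((Q.g * Q.Rm i j).transpose) k l + (Q.g * Q.Rm i j) k l = 0 := by
    rw [Matrix.transpose_mul, Q.g_symm]
    exact congrFun (congrFun key k) l
  rw [Matrix.transpose_apply, gRm_apply, gRm_apply] at h2
  exact eq_neg_of_add_eq_zero_left h2

/-- The first Bianchi identity. -/
lemma riem_cyclic (i j k l : Fin n) :
    Q.riem i j k l + Q.riem j l k i + Q.riem l i k j = 0 := by
  simp only [riem, Finset.sum_sub_distrib]
  rw [Q.Γ_symm k j i, Q.Γ_symm k l i, Q.Γ_symm k l j]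
  have e : ∀ a b c, ∑ m, Q.Γ k a m * Q.Γ m b c = ∑ m, Q.Γ k a m * Q.Γ m c b := fun a b c =>
    Finset.sum_congr rfl fun m _ => by rw [Q.Γ_symm m b c]
  rw [e i l j, e j l i, e l i j]
  ring

lemma riemLow_cyclic (i j k l : Fin n) :
    Q.riemLow i j k l + Q.riemLow j l k i + Q.riemLow l i k j = 0 := by
  simp only [riemLow, ← Finset.sum_add_distrib, ← mul_add, riem_cyclic, mul_zero,
    Finset.sum_const_zero]

/-- The classical octahedron argument: a signed sum of four first Bianchi identities, with both
antisymmetries, gives twice the claim. -/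
lemma riemLow_pair (i j k l : Fin n) : Q.riemLow i j k l = Q.riemLow k l i j := by
  have h1 := Q.riemLow_cyclic i j k l
  have h2 := Q.riemLow_cyclic i j l k
  have h3 := Q.riemLow_cyclic k l i j
  have h4 := Q.riemLow_cyclic k l j i
  have s := Q.riemLow_swap
  have t := Q.riemLow_swap'
  rw [t j l i k, s i l k j, t i l j k] at h1
  rw [t i j k l, t j k i l, s i k l j, t i k j l] at h2
  rw [s j l i k] at h3
  rw [t k l i j, s i l j k] at h4
  have : (2 : R) * Q.riemLow i j k l = 2 * Q.riemLow k l i j := by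
    linear_combination h1 - h2 - h3 + h4
  linear_combination algebraMap ℝ R (1 / 2) * this
    + (Q.riemLow k l i j - Q.riemLow i j k l) * half (R := R)

end AlgMetric

end Tractor

/-! ### Schouten, Weyl and Cotton tensors: traces and contracted Bianchi identities. -/

namespace Tractor
namespace AlgMetric

variable {n : ℕ} {R : Type*} [CommRing R] [Algebra ℝ R] (Q : AlgMetric n R)

lemma sum_gi_riemLow (i j k l : Fin n) : ∑ m, Q.gi k m * Q.riemLow i j m l = Q.riem i j k l := by
  simp only [riemLow, Finset.mul_sum, ← mul_assoc]
  rw [Finset.sum_comm]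
  simp only [← Finset.sum_mul, sum_gi_g]
  simp

lemma ric_symm (j l : Fin n) : Q.ric j l = Q.ric l j := by
  have h : ∀ j l, Q.ric j l = ∑ k, ∑ m, Q.gi k m * Q.riemLow k j m l := fun j l => by
    simp only [ric, ← sum_gi_riemLow]
  rw [h, h, Finset.sum_comm]
  refine Finset.sum_congr rfl fun k _ => Finset.sum_congr rfl fun m _ => ?_
  rw [Q.gi_comm, Q.riemLow_pair]

lemma P_symm (i j : Fin n) : Q.P i j = Q.P j i := by
  rw [P, P, Q.ric_symm, Q.g_comm]

lemma sum_gi_g_trace : ∑ i, ∑ j, Q.gi i j * Q.g i j = (n : R) := by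
  have : ∀ i, ∑ j, Q.gi i j * Q.g i j = 1 := fun i => by
    have := Q.sum_gi_g i i
    simp only [if_true] at this
    rw [← this]
    exact Finset.sum_congr rfl fun j _ => by rw [Q.g_comm]
  simp [this]

lemma cast_sub_two_inv (hn : 3 ≤ n) : algebraMap ℝ R (((n : ℝ) - 2)⁻¹) * ((n : R) - 2) = 1 := by
  have h : (n : ℝ) - 2 ≠ 0 := by
    have : (3 : ℝ) ≤ n := by exact_mod_cast hn
    linarith
  have : (n : R) - 2 = algebraMap ℝ R ((n : ℝ) - 2) := by
    rw [map_sub, map_natCast, map_ofNat]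
  rw [this, ← map_mul, inv_mul_cancel₀ h, map_one]

lemma cast_sub_one_inv (hn : 3 ≤ n) :
    algebraMap ℝ R ((2 * ((n : ℝ) - 1))⁻¹) * (2 * ((n : R) - 1)) = 1 := by
  have h : 2 * ((n : ℝ) - 1) ≠ 0 := by
    have : (3 : ℝ) ≤ n := by exact_mod_cast hn
    intro h; linarith
  have : 2 * ((n : R) - 1) = algebraMap ℝ R (2 * ((n : ℝ) - 1)) := by
    rw [map_mul, map_sub, map_natCast, map_ofNat, map_one]
  rw [this, ← map_mul, inv_mul_cancel₀ h, map_one]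

lemma J_eq (hn : 3 ≤ n) : Q.J = algebraMap ℝ R ((2 * ((n : ℝ) - 1))⁻¹) * Q.scal := by
  have h : Q.J = algebraMap ℝ R (((n : ℝ) - 2)⁻¹) *
      (Q.scal - algebraMap ℝ R ((2 * ((n : ℝ) - 1))⁻¹) * Q.scal * n) := by
    rw [← Q.sum_gi_g_trace]
    simp only [J, P, mul_sub, Finset.sum_sub_distrib]
    congr 1
    · simp only [scal, Finset.mul_sum]
      exact Finset.sum_congr rfl fun i _ => Finset.sum_congr rfl fun j _ => by ring
    · simp only [Finset.mul_sum]
      exact Finset.sum_congr rfl fun i _ => Finset.sum_congr rfl fun j _ => by ring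
  rw [h]
  linear_combination algebraMap ℝ R ((2 * ((n : ℝ) - 1))⁻¹) * Q.scal * cast_sub_two_inv (R := R) hn
    - algebraMap ℝ R (((n : ℝ) - 2)⁻¹) * Q.scal * cast_sub_one_inv (R := R) hn

lemma ric_eq (hn : 3 ≤ n) (i j : Fin n) : Q.ric i j = ((n : R) - 2) * Q.P i j + Q.J * Q.g i j := by
  rw [P, J_eq Q hn]
  linear_combination (-Q.ric i j + algebraMap ℝ R ((2 * ((n : ℝ) - 1))⁻¹) * Q.scal * Q.g i j) *
    cast_sub_two_inv (R := R) hn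

/-- `P_a{}^c`. -/
def Pm (a c : Fin n) : R := ∑ b, Q.P a b * Q.gi b c

lemma sum_Pm_g (a c : Fin n) : ∑ m, Q.Pm a m * Q.g m c = Q.P a c := by
  simp only [Pm, Finset.sum_mul, mul_assoc]
  rw [Finset.sum_comm]
  simp only [← Finset.mul_sum, sum_gi_g]
  simp

lemma sum_g_Pm (a c : Fin n) : ∑ m, Q.g c m * Q.Pm a m = Q.P a c := by
  rw [← sum_Pm_g]
  exact Finset.sum_congr rfl fun m _ => by rw [Q.g_comm, mul_comm]

lemma sum_Pm : ∑ c, Q.Pm c c = Q.J := by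
  simp only [Pm, J]
  refine Finset.sum_congr rfl fun i _ => Finset.sum_congr rfl fun j _ => ?_
  rw [Q.gi_comm, mul_comm]

/-- The Weyl tensor `C_{ab}{}^c{}_d`. -/
def weyl (a b c d : Fin n) : R :=
  Q.riem a b c d - (if c = a then 1 else 0) * Q.P b d + (if c = b then 1 else 0) * Q.P a d
    - Q.g d b * Q.Pm a c + Q.g d a * Q.Pm b c

lemma sum_g_weyl (a b c d : Fin n) : ∑ m, Q.g c m * Q.weyl a b m d = Q.weylLow a b c d := by
  simp only [weyl, weylLow, mul_add, mul_sub, Finset.sum_add_distrib, Finset.sum_sub_distrib]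
  have e : ∀ x y, ∑ m, Q.g c m * (x * Q.Pm y m) = x * Q.P y c := fun x y => by
    rw [← sum_g_Pm, Finset.mul_sum]
    exact Finset.sum_congr rfl fun m _ => by ring
  rw [e, e]
  simp
  ring

lemma sum_gi_weylLow (a b c d : Fin n) : ∑ m, Q.gi c m * Q.weylLow a b m d = Q.weyl a b c d := by
  simp only [← sum_g_weyl, Finset.mul_sum, ← mul_assoc]
  rw [Finset.sum_comm]
  simp only [← Finset.sum_mul, sum_gi_g]
  simp

lemma weylLow_swap (a b c d : Fin n) : Q.weylLow b a c d = -Q.weylLow a b c d := by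
  have := Q.riemLow_swap a b c d
  simp only [riemLow] at this
  rw [weylLow, weylLow, this]; ring

lemma weylLow_swap' (a b c d : Fin n) : Q.weylLow a b d c = -Q.weylLow a b c d := by
  have := Q.riemLow_swap' a b c d
  simp only [riemLow] at this
  rw [weylLow, weylLow, this]; ring

lemma weylLow_pair (a b c d : Fin n) : Q.weylLow a b c d = Q.weylLow c d a b := by
  have := Q.riemLow_pair a b c d
  simp only [riemLow] at this
  rw [weylLow, weylLow, this, Q.g_comm c a, Q.g_comm c b, Q.g_comm d b, Q.g_comm d a,
    Q.P_symm b d, Q.P_symm a d, Q.P_symm a c, Q.P_symm b c]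
  ring

/-- The normalisation of the Schouten tensor enters here: the Schouten part has trace `(n - 2) P + J
g`, which is the Ricci tensor by `ric_eq`. -/
lemma weyl_trace (hn : 3 ≤ n) (b d : Fin n) : ∑ c, Q.weyl c b c d = 0 := by
  have e1 : ∑ c, Q.g d b * Q.Pm c c = Q.g b d * Q.J := by
    rw [← Finset.mul_sum, sum_Pm, Q.g_comm]
  simp only [weyl, Finset.sum_add_distrib, Finset.sum_sub_distrib, e1, sum_g_Pm]
  simp only [if_true, ite_mul, zero_mul, one_mul, Finset.sum_ite_eq', Finset.sum_const,
    Finset.card_univ, Fintype.card_fin, Finset.mem_univ, nsmul_eq_mul]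
  have := Q.ric_eq hn b d
  rw [ric] at this
  rw [this]; ring

lemma weyl_trace_gi (hn : 3 ≤ n) (a c : Fin n) : ∑ b, ∑ d, Q.gi b d * Q.weyl a b c d = 0 := by
  have h : ∀ a c, ∑ b, ∑ d, Q.gi b d * Q.weylLow a b c d = 0 := fun a c => by
    rw [← Q.weyl_trace hn a c]
    refine Finset.sum_congr rfl fun b _ => ?_
    rw [← sum_gi_weylLow]
    refine Finset.sum_congr rfl fun d _ => ?_
    rw [Q.weylLow_swap b a, Q.weylLow_swap' b a d c]; ring
  simp only [← sum_gi_weylLow, Finset.mul_sum]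
  have : ∀ b, ∑ d, ∑ m, Q.gi b d * (Q.gi c m * Q.weylLow a b m d)
      = ∑ m, Q.gi c m * ∑ d, Q.gi b d * Q.weylLow a b m d := fun b => by
    rw [Finset.sum_comm]
    refine Finset.sum_congr rfl fun m _ => ?_
    rw [Finset.mul_sum]
    exact Finset.sum_congr rfl fun d _ => by ring
  simp only [this]
  rw [Finset.sum_comm]
  simp only [← Finset.mul_sum, h, mul_zero, Finset.sum_const_zero]

/-- `∇_c T_{ab}{}^c{}_d`. -/
def div4 (T : Fin n → Fin n → Fin n → Fin n → R) (a b e : Fin n) : R :=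
  ∑ c, (Q.d c (T a b c e) + ∑ m, (Q.Γ c c m * T a b m e - Q.Γ m c e * T a b c m
    - Q.Γ m c a * T m b c e - Q.Γ m c b * T a m c e))

/-- The second Bianchi identity, contracted once over its derivative index and the upper curvature
index. -/
lemma div_riem (a b e : Fin n) :
    Q.div4 Q.riem a b e = Q.cov2 Q.ric a b e - Q.cov2 Q.ric b a e := by
  have h : ∀ k, (endD Q.d Q.Γm k (Q.Rm a b) + endD Q.d Q.Γm a (Q.Rm b k)
      + endD Q.d Q.Γm b (Q.Rm k a)) k e = 0 := fun k => by
    rw [Rm, Rm, Rm, bianchi Q.d Q.d_comm]; rfl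
  have h' := Finset.sum_congr (rfl : (Finset.univ : Finset (Fin n)) = _) fun k _ => h k
  simp only [endD, Matrix.add_apply, Matrix.sub_apply, matD_apply, Matrix.mul_apply, Γm_apply,
    Rm_apply, Finset.sum_add_distrib, Finset.sum_sub_distrib, Finset.sum_const_zero] at h'
  have r1 : ∀ x y, ∑ k, Q.d x (Q.riem y k k e) = -Q.d x (Q.ric y e) := fun x y => by
    simp only [ric, map_sum, ← Finset.sum_neg_distrib]
    exact Finset.sum_congr rfl fun k _ => by rw [Q.riem_swap k y, map_neg]
  have r1' : ∀ x y, ∑ k, Q.d x (Q.riem k y k e) = Q.d x (Q.ric y e) := fun x y => by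
    simp only [ric, map_sum]
  have r2 : ∀ x y, ∑ k, ∑ m, Q.riem y k k m * Q.Γ m x e = -∑ m, Q.Γ m x e * Q.ric y m :=
    fun x y => by
    rw [Finset.sum_comm]
    simp only [ric, Finset.mul_sum, ← Finset.sum_neg_distrib]
    exact Finset.sum_congr rfl fun k _ => Finset.sum_congr rfl fun m _ => by
      rw [Q.riem_swap m y]; ring
  have r2' : ∀ x y, ∑ k, ∑ m, Q.riem k y k m * Q.Γ m x e = ∑ m, Q.Γ m x e * Q.ric y m :=
    fun x y => by
    rw [Finset.sum_comm]
    simp only [ric, Finset.mul_sum]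
    exact Finset.sum_congr rfl fun k _ => Finset.sum_congr rfl fun m _ => by ring
  rw [r1, r1', r2, r2'] at h'
  simp only [div4, cov2, Finset.sum_add_distrib, Finset.sum_sub_distrib]
  -- `endD` differentiates only the endomorphism indices. By symmetry of `Γ`, the Christoffel terms
  -- of the form indices in `div4` are the connection terms of the other two Bianchi summands.
  have r3 : ∑ c, ∑ m, Q.Γ m c a * Q.riem m b c e = -∑ c, ∑ m, Q.Γ c a m * Q.riem b c m e := by
    rw [Finset.sum_comm]
    simp only [← Finset.sum_neg_distrib]
    exact Finset.sum_congr rfl fun k _ => Finset.sum_congr rfl fun m _ => by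
      rw [Q.riem_swap b k, Q.Γ_symm]; ring
  have r4 : ∑ c, ∑ m, Q.Γ m c b * Q.riem a m c e = -∑ c, ∑ m, Q.Γ c b m * Q.riem c a m e := by
    rw [Finset.sum_comm]
    simp only [← Finset.sum_neg_distrib]
    exact Finset.sum_congr rfl fun k _ => Finset.sum_congr rfl fun m _ => by
      rw [Q.riem_swap k a, Q.Γ_symm]; ring
  have r5 : ∑ c, ∑ m, Q.Γ m c e * Q.riem a b c m = ∑ c, ∑ m, Q.riem a b c m * Q.Γ m c e :=
    Finset.sum_congr rfl fun k _ => Finset.sum_congr rfl fun m _ => mul_comm _ _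
  have r6 : ∑ m, Q.Γ m a b * Q.ric m e = ∑ m, Q.Γ m b a * Q.ric m e :=
    Finset.sum_congr rfl fun m _ => by rw [Q.Γ_symm]
  rw [r3, r4, r5, r6]
  linear_combination h'

/-- `∇_c P_a{}^c`. -/
def divP (a : Fin n) : R :=
  ∑ c, (Q.d c (Q.Pm a c) + ∑ m, (Q.Γ c c m * Q.Pm a m - Q.Γ m c a * Q.Pm m c))

lemma div4_add (S T : Fin n → Fin n → Fin n → Fin n → R) (a b e : Fin n) :
    Q.div4 (fun a b c e => S a b c e + T a b c e) a b e = Q.div4 S a b e + Q.div4 T a b e := by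
  simp only [div4, ← Finset.sum_add_distrib, map_add]
  refine Finset.sum_congr rfl fun c _ => ?_
  rw [add_add_add_comm, ← Finset.sum_add_distrib]
  congr 1
  exact Finset.sum_congr rfl fun m _ => by ring

lemma div4_neg (T : Fin n → Fin n → Fin n → Fin n → R) (a b e : Fin n) :
    Q.div4 (fun a b c e => -T a b c e) a b e = -Q.div4 T a b e := by
  simp only [div4, ← Finset.sum_neg_distrib, map_neg, neg_add]
  refine Finset.sum_congr rfl fun c _ => ?_
  congr 1
  exact Finset.sum_congr rfl fun m _ => by ring

lemma div4_swap (T : Fin n → Fin n → Fin n → Fin n → R) (a b e : Fin n) :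
    Q.div4 (fun a b c e => T b a c e) a b e = Q.div4 T b a e := by
  simp only [div4]
  refine Finset.sum_congr rfl fun c _ => ?_
  congr 1
  exact Finset.sum_congr rfl fun m _ => by ring

lemma div4_delta (T : Fin n → Fin n → R) (a b e : Fin n) :
    Q.div4 (fun a b c e => (if c = a then 1 else 0) * T b e) a b e = Q.cov2 T a b e := by
  simp only [div4, cov2, ite_mul, one_mul, zero_mul, mul_ite, mul_zero, Finset.sum_add_distrib,
    Finset.sum_sub_distrib, Finset.sum_ite_eq, Finset.sum_ite_eq', Finset.mem_univ, if_true,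
    apply_ite (Q.d _), map_zero, Finset.sum_ite_irrel, Finset.sum_const_zero]
  ring

lemma div4_g (S : Fin n → Fin n → R) (a b e : Fin n) :
    Q.div4 (fun a b c e => Q.g e b * S a c) a b e = Q.g e b *
      ∑ c, (Q.d c (S a c) + ∑ m, (Q.Γ c c m * S a m - Q.Γ m c a * S m c)) := by
  simp only [div4, Finset.mul_sum]
  refine Finset.sum_congr rfl fun c _ => ?_
  rw [Derivation.leibniz, d_g]
  simp only [smul_eq_mul, mul_add, Finset.mul_sum]
  rw [add_assoc, ← Finset.sum_add_distrib]
  congr 1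
  refine Finset.sum_congr rfl fun m _ => ?_
  ring

lemma cov2_add (S T : Fin n → Fin n → R) (a b c : Fin n) :
    Q.cov2 (fun b c => S b c + T b c) a b c = Q.cov2 S a b c + Q.cov2 T a b c := by
  simp only [cov2, map_add, mul_add, Finset.sum_add_distrib]
  ring

lemma cov2_mul_g (f : R) (a b c : Fin n) :
    Q.cov2 (fun b c => f * Q.g b c) a b c = Q.d a f * Q.g b c := by
  rw [cov2, Derivation.leibniz, d_g]
  simp only [smul_eq_mul, Finset.sum_add_distrib, mul_add, Finset.mul_sum]
  have e1 : ∀ i, Q.Γ i a b * (f * Q.g i c) = f * (Q.Γ i a b * Q.g i c) := fun i => by ring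
  have e2 : ∀ i, Q.Γ i a c * (f * Q.g b i) = f * (Q.Γ i a c * Q.g b i) := fun i => by ring
  simp only [e1, e2]
  ring

lemma cov2_const_mul (r : R) (hr : ∀ a, Q.d a r = 0) (T : Fin n → Fin n → R) (a b c : Fin n) :
    Q.cov2 (fun b c => r * T b c) a b c = r * Q.cov2 T a b c := by
  simp only [cov2, Derivation.leibniz, hr, smul_eq_mul, mul_sub, Finset.mul_sum]
  rw [mul_zero, add_zero]
  congr 1
  exact Finset.sum_congr rfl fun m _ => by ring

lemma d_natCast_sub (a : Fin n) (k : ℕ) : Q.d a ((n : R) - k) = 0 := by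
  simp

lemma cov2_ric (hn : 3 ≤ n) (a b c : Fin n) :
    Q.cov2 Q.ric a b c = ((n : R) - 2) * Q.cov2 Q.P a b c + Q.d a Q.J * Q.g b c := by
  have : Q.ric = fun b c => ((n : R) - 2) * Q.P b c + Q.J * Q.g b c := by
    funext b c; exact Q.ric_eq hn b c
  rw [this, cov2_add, cov2_mul_g, cov2_const_mul]
  intro a
  exact_mod_cast Q.d_natCast_sub a 2

/-- The error `dJ - divP` is kept here, because its vanishing (`divP_eq`) is deduced from the trace
of this very formula. -/
lemma div_weyl (hn : 3 ≤ n) (a b e : Fin n) :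
    Q.div4 Q.weyl a b e = ((n : R) - 3) * Q.cot e a b + Q.g b e * (Q.d a Q.J - Q.divP a)
      - Q.g a e * (Q.d b Q.J - Q.divP b) := by
  have h : Q.weyl = fun a b c e => (((Q.riem a b c e
      + -((if c = a then 1 else 0) * Q.P b e)) + (if c = b then 1 else 0) * Q.P a e)
      + -(Q.g e b * Q.Pm a c)) + Q.g e a * Q.Pm b c := by
    funext a b c e; rw [weyl]; ring
  rw [h]
  rw [div4_add, div4_add, div4_add, div4_add, div4_neg, div4_neg,
    Q.div4_swap (fun a b c e => (if c = a then 1 else 0) * Q.P b e),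
    Q.div4_swap (fun a b c e => Q.g e b * Q.Pm a c), div4_g, div4_g, div4_delta, div4_delta]
  rw [div_riem, cov2_ric Q hn,
    cov2_ric Q hn, ← divP, ← divP, cot, Q.g_comm e b, Q.g_comm e a]
  ring

/-- The metric is parallel, so contraction commutes with the divergence, and the Weyl tensor is
trace-free. -/
lemma sum_gi_div_weyl (hn : 3 ≤ n) (a : Fin n) :
    ∑ b, ∑ e, Q.gi b e * Q.div4 Q.weyl a b e = 0 := by
  have h : ∀ a c, ∑ b, ∑ e, Q.gi b e * Q.weyl a b c e = 0 := Q.weyl_trace_gi hn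
  have hd : ∀ c, ∑ b, ∑ e, (Q.gi b e * Q.d c (Q.weyl a b c e)
      - Q.weyl a b c e * ∑ m, (Q.Γ b c m * Q.gi m e + Q.Γ e c m * Q.gi b m)) = 0 := fun c => by
    have := congrArg (Q.d c) (h a c)
    simp only [map_sum, Derivation.leibniz, d_gi, smul_eq_mul, map_zero, mul_neg,
      ← sub_eq_add_neg] at this
    exact this
  have e1 : ∀ c, ∑ b, ∑ e, Q.weyl a b c e * ∑ m, (Q.Γ b c m * Q.gi m e + Q.Γ e c m * Q.gi b m)
      = ∑ b, ∑ e, Q.gi b e * ∑ m, (Q.Γ m c e * Q.weyl a b c m + Q.Γ m c b * Q.weyl a m c e) := by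
    intro c
    simp only [Finset.mul_sum, mul_add, Finset.sum_add_distrib]
    rw [add_comm]
    congr 1
    · refine Finset.sum_congr rfl fun b _ => ?_
      rw [Finset.sum_comm]
      exact Finset.sum_congr rfl fun _ _ => Finset.sum_congr rfl fun _ _ => by ring
    · rw [Finset.sum_comm]
      conv_rhs => rw [Finset.sum_comm]
      refine Finset.sum_congr rfl fun b _ => ?_
      rw [Finset.sum_comm]
      exact Finset.sum_congr rfl fun _ _ => Finset.sum_congr rfl fun _ _ => by ring
  have e2 : ∀ c, ∑ b, ∑ e, Q.gi b e * (Q.d c (Q.weyl a b c e)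
      + ∑ m, (Q.Γ c c m * Q.weyl a b m e - Q.Γ m c e * Q.weyl a b c m
        - Q.Γ m c a * Q.weyl m b c e - Q.Γ m c b * Q.weyl a m c e))
      = ∑ b, ∑ e, (Q.gi b e * Q.d c (Q.weyl a b c e)
          - Q.weyl a b c e * ∑ m, (Q.Γ b c m * Q.gi m e + Q.Γ e c m * Q.gi b m))
        + ∑ m, (Q.Γ c c m * (∑ b, ∑ e, Q.gi b e * Q.weyl a b m e)
          - Q.Γ m c a * ∑ b, ∑ e, Q.gi b e * Q.weyl m b c e) := fun c => by
    simp only [Finset.sum_sub_distrib, e1]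
    simp only [Finset.mul_sum, mul_add, mul_sub, Finset.sum_add_distrib, Finset.sum_sub_distrib]
    have s1 : ∀ f : Fin n → Fin n → Fin n → R,
        ∑ m, ∑ b, ∑ e, f m b e = ∑ b, ∑ e, ∑ m, f m b e := fun f => by
      rw [Finset.sum_comm]
      exact Finset.sum_congr rfl fun b _ => Finset.sum_comm
    rw [s1 (fun m b e => Q.Γ c c m * (Q.gi b e * Q.weyl a b m e)),
      s1 (fun m b e => Q.Γ m c a * (Q.gi b e * Q.weyl m b c e))]
    have c1 : ∀ b e m, Q.Γ c c m * (Q.gi b e * Q.weyl a b m e)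
        = Q.gi b e * (Q.Γ c c m * Q.weyl a b m e) := fun b e m => by ring
    have c2 : ∀ b e m, Q.Γ m c a * (Q.gi b e * Q.weyl m b c e)
        = Q.gi b e * (Q.Γ m c a * Q.weyl m b c e) := fun b e m => by ring
    simp only [c1, c2]
    ring
  simp only [div4, Finset.mul_sum (Finset.univ : Finset (Fin n)) _ (Q.gi _ _)]
  have s1 : ∀ f : Fin n → Fin n → Fin n → R,
      ∑ b, ∑ e, ∑ c, f b e c = ∑ c, ∑ b, ∑ e, f b e c := fun f => by
    symm
    rw [Finset.sum_comm]
    exact Finset.sum_congr rfl fun b _ => Finset.sum_comm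
  rw [s1]
  refine Finset.sum_eq_zero fun c _ => ?_
  rw [e2 c, hd c]
  simp [h]

lemma sum_gi_cov2 (T : Fin n → Fin n → R) (a : Fin n) :
    ∑ b, ∑ e, Q.gi b e * Q.cov2 T a b e = Q.d a (∑ b, ∑ e, Q.gi b e * T b e) := by
  simp only [map_sum, Derivation.leibniz, d_gi, smul_eq_mul, cov2, mul_sub, mul_neg,
    Finset.sum_add_distrib, Finset.sum_sub_distrib, mul_add, ← sub_eq_add_neg, Finset.mul_sum]
  congr 1
  congr 1
  · rw [Finset.sum_comm]
    conv_rhs => rw [Finset.sum_comm]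
    refine Finset.sum_congr rfl fun b _ => ?_
    rw [Finset.sum_comm]
    exact Finset.sum_congr rfl fun _ _ => Finset.sum_congr rfl fun _ _ => by ring
  · refine Finset.sum_congr rfl fun b _ => ?_
    rw [Finset.sum_comm]
    exact Finset.sum_congr rfl fun _ _ => Finset.sum_congr rfl fun _ _ => by ring

lemma sum_gi_cov2_P (a : Fin n) : ∑ b, ∑ e, Q.gi b e * Q.cov2 Q.P b a e = Q.divP a := by
  simp only [divP, Pm, map_sum, Derivation.leibniz, d_gi, smul_eq_mul, cov2, mul_sub, mul_neg,
    Finset.sum_add_distrib, Finset.sum_sub_distrib, Finset.sum_neg_distrib, mul_add,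
    Finset.mul_sum]
  have e1 : ∑ x, ∑ y, ∑ i, Q.P a y * (Q.Γ y x i * Q.gi i x)
      = ∑ x, ∑ y, ∑ i, Q.gi x y * (Q.Γ i x y * Q.P a i) :=
    Finset.sum_congr rfl fun x _ => by
      rw [Finset.sum_comm]
      exact Finset.sum_congr rfl fun y _ => Finset.sum_congr rfl fun i _ => by
        rw [Q.gi_comm x y]; ring
  have e2 : ∑ x, ∑ y, ∑ i, Q.P a y * (Q.Γ x x i * Q.gi y i)
      = ∑ x, ∑ y, ∑ i, Q.Γ x x y * (Q.P a i * Q.gi i y) :=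
    Finset.sum_congr rfl fun x _ => by
      rw [Finset.sum_comm]
      exact Finset.sum_congr rfl fun y _ => Finset.sum_congr rfl fun i _ => by ring
  have e3 : ∑ x, ∑ y, ∑ i, Q.gi x y * (Q.Γ i x a * Q.P i y)
      = ∑ x, ∑ y, ∑ i, Q.Γ y x a * (Q.P y i * Q.gi i x) :=
    Finset.sum_congr rfl fun x _ => by
      rw [Finset.sum_comm]
      exact Finset.sum_congr rfl fun y _ => Finset.sum_congr rfl fun i _ => by
        rw [Q.gi_comm x i]; ring
  have e4 : ∑ x, ∑ y, Q.gi x y * Q.d x (Q.P a y) = ∑ x, ∑ y, Q.gi y x * Q.d x (Q.P a y) :=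
    Finset.sum_congr rfl fun x _ => Finset.sum_congr rfl fun y _ => by rw [Q.gi_comm]
  rw [e1, e2, e3, e4]
  ring

lemma sum_gi_cot (a : Fin n) : ∑ b, ∑ e, Q.gi b e * Q.cot e a b = Q.d a Q.J - Q.divP a := by
  simp only [cot, mul_sub, Finset.sum_sub_distrib]
  rw [sum_gi_cov2, sum_gi_cov2_P, J]

lemma divP_eq (hn : 3 ≤ n) (a : Fin n) : Q.divP a = Q.d a Q.J := by
  have h := Q.sum_gi_div_weyl hn a
  simp only [Q.div_weyl hn, mul_sub, mul_add, Finset.sum_sub_distrib, Finset.sum_add_distrib] at h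
  have e1 : ∑ b, ∑ e, Q.gi b e * (((n : R) - 3) * Q.cot e a b)
      = ((n : R) - 3) * (Q.d a Q.J - Q.divP a) := by
    rw [← sum_gi_cot]
    simp only [Finset.mul_sum]
    exact Finset.sum_congr rfl fun x _ => Finset.sum_congr rfl fun y _ => by ring
  have e2 : ∀ f : R, ∑ b, ∑ e, Q.gi b e * (Q.g b e * f) = n * f := fun f => by
    rw [← Q.sum_gi_g_trace]
    simp only [Finset.sum_mul, mul_assoc]
  have e3 : ∀ f : Fin n → R, ∑ b, ∑ e, Q.gi b e * (Q.g a e * f b) = f a := fun f => by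
    have : ∀ b, ∑ e, Q.gi b e * (Q.g a e * f b) = (if b = a then 1 else 0) * f b := fun b => by
      rw [← sum_gi_g, Finset.sum_mul]
      exact Finset.sum_congr rfl fun e _ => by rw [Q.g_comm]; ring
    simp [this]
  rw [e1, e2, e2, e3, e3] at h
  -- The trace now reads `2 (n - 2) (dJ - divP) = 0`, and `n - 2` is invertible as `n ≥ 3`.
  have c := cast_sub_two_inv (R := R) hn
  linear_combination -algebraMap ℝ R (1 / 2) * algebraMap ℝ R (((n : ℝ) - 2)⁻¹) * h +
    (Q.d a Q.J - Q.divP a) * (half (R := R) * ((n : R) - 2) * algebraMap ℝ R (((n : ℝ) - 2)⁻¹) + c)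

lemma cot_trace (hn : 3 ≤ n) (a : Fin n) : ∑ b, ∑ e, Q.gi b e * Q.cot e a b = 0 := by
  rw [sum_gi_cot, divP_eq Q hn, sub_self]

lemma div_weyl_eq (hn : 3 ≤ n) (a b e : Fin n) :
    Q.div4 Q.weyl a b e = ((n : R) - 3) * Q.cot e a b := by
  rw [div_weyl Q hn, divP_eq Q hn, divP_eq Q hn]; ring

end AlgMetric
end Tractor

/-! ### Conformal change, the almost Einstein equation and parallel tractors. -/

namespace Tractor
namespace AlgMetric

variable {n : ℕ} {R : Type*} [CommRing R] [Algebra ℝ R] (Q : AlgMetric n R)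

/-- Raising an index of a covector. -/
def up (u : Fin n → R) (a : Fin n) : R := ∑ b, Q.gi a b * u b

lemma sum_g_up (u : Fin n → R) (a : Fin n) : ∑ b, Q.g a b * Q.up u b = u a := by
  simp only [up, Finset.mul_sum, ← mul_assoc]
  rw [Finset.sum_comm]
  simp only [← Finset.sum_mul, sum_g_gi]
  simp

/-- The difference of the Christoffel symbols of the metrics `σ⁻² g` and `g`, where
`u = σ⁻¹ dσ`. -/
def confDiff (u : Fin n → R) (k i j : Fin n) : R :=
  -((if k = j then 1 else 0) * u i) - (if k = i then 1 else 0) * u j + Q.g i j * Q.up u k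

section ConformalChange

variable {Q} {Q' : AlgMetric n R} {σ v : R} (hd : Q'.d = Q.d) (hv : σ * v = 1)
  (hg : ∀ a b, Q'.g a b = v ^ 2 * Q.g a b)

include hv in
lemma d_inv (i : Fin n) : Q.d i v = -(v * (v * Q.d i σ)) := by
  have h := congrArg (Q.d i) hv
  rw [Derivation.leibniz, Derivation.map_one_eq_zero, smul_eq_mul, smul_eq_mul] at h
  linear_combination v * h - (Q.d i v) * hv

include hv hg in
lemma gi_conf (a b : Fin n) : Q'.gi a b = σ ^ 2 * Q.gi a b := by
  have e : Q'.g = v ^ 2 • Q.g := by ext a b; simp [hg]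
  have h : (σ ^ 2 • Q.gi) * Q'.g = 1 := by
    rw [e, Matrix.smul_mul, Matrix.mul_smul, smul_smul, gi_mul_g, ← mul_pow, hv, one_pow, one_smul]
  have : Q'.gi = σ ^ 2 • Q.gi := by
    calc Q'.gi = ((σ ^ 2 • Q.gi) * Q'.g) * Q'.gi := by rw [h, one_mul]
      _ = _ := by rw [mul_assoc, g_mul_gi, mul_one]
  rw [this]; simp

include hd hv hg in
lemma Γ_conf (k i j : Fin n) :
    Q'.Γ k i j = Q.Γ k i j + Q.confDiff (fun a => v * Q.d a σ) k i j := by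
  have dg : ∀ i j l, Q.d i (v ^ 2 * Q.g j l)
      = v ^ 2 * (Q.d i (Q.g j l) - 2 * (v * Q.d i σ) * Q.g j l) := fun i j l => by
    rw [Derivation.leibniz, Derivation.leibniz_pow, d_inv hv]
    simp only [smul_eq_mul, nsmul_eq_mul, Nat.cast_ofNat]
    ring
  have t : ∀ l, Q'.gi k l * (Q'.d i (Q'.g j l) + Q'.d j (Q'.g i l) - Q'.d l (Q'.g i j))
      = Q.gi k l * (Q.d i (Q.g j l) + Q.d j (Q.g i l) - Q.d l (Q.g i j))
        - 2 * (v * Q.d i σ) * (Q.gi k l * Q.g l j) - 2 * (v * Q.d j σ) * (Q.gi k l * Q.g l i)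
        + 2 * Q.g i j * (Q.gi k l * (v * Q.d l σ)) := fun l => by
    rw [gi_conf hv hg, hd]
    simp only [hg, dg]
    rw [Q.g_comm l j, Q.g_comm l i]
    linear_combination (Q.gi k l * (Q.d i (Q.g j l) + Q.d j (Q.g i l) - Q.d l (Q.g i j))
        - 2 * (v * Q.d i σ) * (Q.gi k l * Q.g j l) - 2 * (v * Q.d j σ) * (Q.gi k l * Q.g i l)
        + 2 * Q.g i j * (Q.gi k l * (v * Q.d l σ))) * (σ * v + 1) * hv
  simp only [Γ, t, Finset.sum_add_distrib, Finset.sum_sub_distrib, ← Finset.mul_sum, sum_gi_g,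
    confDiff, up]
  linear_combination (-(if k = j then 1 else 0) * (v * Q.d i σ)
    - (if k = i then 1 else 0) * (v * Q.d j σ) + Q.g i j * ∑ b, Q.gi k b * (v * Q.d b σ)) *
      half (R := R)

/-- The conformal change of Ricci curvature with `Υ_a = -u_a`, for any closed `u`. All multiples of
the metric are collected in one factor, since the Einstein condition only constrains the rest. -/
lemma ric_conf_aux (u : Fin n → R) (hu : ∀ i j, Q.d i (u j) = Q.d j (u i)) (j l : Fin n) :
    ∑ k, (Q.d k (Q.Γ k j l + Q.confDiff u k j l) - Q.d j (Q.Γ k k l + Q.confDiff u k k l)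
      + ∑ m, ((Q.Γ k k m + Q.confDiff u k k m) * (Q.Γ m j l + Q.confDiff u m j l)
        - (Q.Γ k j m + Q.confDiff u k j m) * (Q.Γ m k l + Q.confDiff u m k l)))
    = Q.ric j l + ((n : R) - 2) * (Q.d j (u l) - ∑ m, Q.Γ m j l * u m + u j * u l)
      + Q.g j l * (∑ k, Q.d k (Q.up u k) + ∑ k, ∑ m, Q.Γ k k m * Q.up u m
        - ((n : R) - 2) * ∑ k, u k * Q.up u k) := by
  have gu : ∀ a, ∑ b, Q.g b a * Q.up u b = u a := fun a => by
    rw [← Q.sum_g_up u a]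
    exact Finset.sum_congr rfl fun b _ => by rw [Q.g_comm]
  have A1 : ∀ m, ∑ k, Q.confDiff u k k m = -((n : R) * u m) := fun m => by
    simp only [confDiff, Finset.sum_add_distrib, Finset.sum_sub_distrib, Finset.sum_neg_distrib, gu]
    simp
    ring
  have A2 : ∑ k, Q.d k (Q.confDiff u k j l) = -Q.d l (u j) - Q.d j (u l)
      + ∑ k, Q.d k (Q.g j l) * Q.up u k + Q.g j l * ∑ k, Q.d k (Q.up u k) := by
    simp only [confDiff, map_add, map_sub, map_neg, ite_mul, one_mul, zero_mul, apply_ite (Q.d _),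
      map_zero, Finset.sum_add_distrib, Finset.sum_sub_distrib, Finset.sum_neg_distrib,
      Finset.sum_ite_eq', Finset.mem_univ, if_true, Derivation.leibniz, smul_eq_mul, Finset.mul_sum]
    simp only [mul_comm (Q.up u _)]
    ring
  have A3 : ∑ k, ∑ m, Q.Γ k k m * Q.confDiff u m j l = -((∑ k, Q.Γ k k l) * u j)
      - (∑ k, Q.Γ k k j) * u l + Q.g j l * ∑ k, ∑ m, Q.Γ k k m * Q.up u m := by
    simp only [confDiff, mul_add, mul_sub, mul_neg, ite_mul, one_mul, zero_mul, mul_ite, mul_zero,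
      Finset.sum_add_distrib, Finset.sum_sub_distrib, Finset.sum_neg_distrib, Finset.sum_ite_eq',
      Finset.mem_univ, if_true, Finset.mul_sum, Finset.sum_mul]
    congr 1
    exact Finset.sum_congr rfl fun _ _ => Finset.sum_congr rfl fun _ _ => by ring
  have A4 : ∀ X : Fin n → R, ∑ k, ∑ m, Q.confDiff u k k m * X m
      = -((n : R) * ∑ m, u m * X m) := fun X => by
    rw [Finset.sum_comm]
    simp only [← Finset.sum_mul, A1, Finset.mul_sum, ← Finset.sum_neg_distrib]
    exact Finset.sum_congr rfl fun _ _ => by ring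
  have A5 : ∑ k, ∑ m, Q.Γ k j m * Q.confDiff u m k l = -(∑ m, Q.Γ m j l * u m)
      - (∑ k, Q.Γ k j k) * u l + ∑ k, ∑ m, Q.Γ k j m * Q.g k l * Q.up u m := by
    simp only [confDiff, mul_add, mul_sub, mul_neg, ite_mul, one_mul, zero_mul, mul_ite, mul_zero,
      Finset.sum_add_distrib, Finset.sum_sub_distrib, Finset.sum_neg_distrib, Finset.sum_ite_eq',
      Finset.mem_univ, if_true, Finset.sum_mul, mul_assoc]
  have B : ∀ X : Fin n → Fin n → R, ∑ k, ∑ m, Q.confDiff u k j m * X m k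
      = -(u j * ∑ k, X k k) - ∑ m, u m * X m j + ∑ m, Q.g j m * ∑ k, Q.up u k * X m k := fun X => by
    have e : ∀ k m, Q.confDiff u k j m * X m k = -((if k = m then 1 else 0) * (u j * X m k))
        - (if k = j then 1 else 0) * (u m * X m k) + Q.g j m * (Q.up u k * X m k) := fun k m => by
      rw [confDiff]; ring
    simp only [e, Finset.sum_add_distrib, Finset.sum_sub_distrib, Finset.sum_neg_distrib]
    congr 1
    · simp only [← Finset.mul_sum]
      simp [Finset.mul_sum]
    · rw [Finset.sum_comm]
      simp only [Finset.mul_sum]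
  have A6 : ∑ k, ∑ m, Q.confDiff u k j m * Q.Γ m k l = -(u j * (∑ k, Q.Γ k k l))
      - ∑ m, u m * Q.Γ m j l + ∑ k, ∑ m, Q.Γ k m l * Q.g j k * Q.up u m := by
    rw [B fun m k => Q.Γ m k l]
    simp only [Finset.mul_sum]
    congr 1
    exact Finset.sum_congr rfl fun _ _ => Finset.sum_congr rfl fun _ _ => by ring
  have C1 : ∑ m, u m * Q.confDiff u m j l = -(2 * (u j * u l))
      + Q.g j l * ∑ k, u k * Q.up u k := by
    simp only [confDiff, mul_add, mul_sub, mul_neg, ite_mul, one_mul, zero_mul, mul_ite, mul_zero,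
      Finset.sum_add_distrib, Finset.sum_sub_distrib, Finset.sum_neg_distrib, Finset.sum_ite_eq',
      Finset.mem_univ, if_true, Finset.mul_sum]
    simp only [mul_left_comm (Q.g j l)]
    ring
  have C2 : ∀ m, ∑ k, Q.up u k * Q.confDiff u m k l
      = -((if m = l then 1 else 0) * ∑ k, u k * Q.up u k) - Q.up u m * u l + u l * Q.up u m :=
    fun m => by
    simp only [confDiff, mul_add, mul_sub, mul_neg, Finset.sum_add_distrib, Finset.sum_sub_distrib,
      Finset.sum_neg_distrib]
    congr 1
    · congr 1
      · congr 1
        rw [Finset.mul_sum]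
        exact Finset.sum_congr rfl fun _ _ => by ring
      · simp
    · rw [← gu l, Finset.sum_mul]
      exact Finset.sum_congr rfl fun _ _ => by ring
  have A7 : ∑ k, ∑ m, Q.confDiff u k j m * Q.confDiff u m k l = ((n : R) + 2) * (u j * u l)
      - 2 * (Q.g j l * ∑ k, u k * Q.up u k) := by
    rw [B fun m k => Q.confDiff u m k l, A1, C1]
    simp only [C2]
    have : ∀ m, Q.g j m * (-((if m = l then 1 else 0) * ∑ k, u k * Q.up u k) - Q.up u m * u l
        + u l * Q.up u m) = -((if m = l then 1 else 0) * (Q.g j m * ∑ k, u k * Q.up u k)) :=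
      fun m => by ring
    simp only [this]
    simp
    ring
  have D1 : ∑ k, Q.d k (Q.g j l) * Q.up u k = ∑ k, ∑ m, Q.Γ k j m * Q.g k l * Q.up u m
      + ∑ k, ∑ m, Q.Γ k m l * Q.g j k * Q.up u m := by
    simp only [d_g, Finset.sum_mul, add_mul, Finset.sum_add_distrib]
    rw [Finset.sum_comm, Finset.sum_comm (f := fun x i => Q.Γ i x l * Q.g j i * Q.up u x)]
    congr 1
    exact Finset.sum_congr rfl fun k _ => Finset.sum_congr rfl fun m _ => by rw [Q.Γ_symm k j m]
  have A1' : ∑ k, Q.d j (Q.confDiff u k k l) = -((n : R) * Q.d j (u l)) := by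
    rw [← map_sum, A1, map_neg, Derivation.leibniz]
    simp
  have E1 : ∑ k, Q.Γ k j k = ∑ k, Q.Γ k k j := Finset.sum_congr rfl fun k _ => Q.Γ_symm k j k
  have E2 : ∑ m, u m * Q.Γ m j l = ∑ m, Q.Γ m j l * u m :=
    Finset.sum_congr rfl fun m _ => mul_comm _ _
  simp only [map_add, mul_add, add_mul, Finset.sum_add_distrib, Finset.sum_sub_distrib, A1', A2, A3,
    A4, A5, A6, A7, C1, D1, E1, E2, ric, riem]
  rw [hu l j]
  ring

end ConformalChange

/-- The Hessian `∇_a ∇_b f`. -/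
def hess (f : R) (a b : Fin n) : R := Q.d a (Q.d b f) - ∑ m, Q.Γ m a b * Q.d m f

/-- The Laplacian on functions. -/
def lap (f : R) : R := ∑ a, ∑ b, Q.gi a b * Q.hess f a b

/-- The bottom slot of `(1/n) D_A σ`. -/
def tau (f : R) : R := -(algebraMap ℝ R (1 / (n : ℝ)) * (Q.lap f + Q.J * f))

/-- The equation that says that `σ⁻² g` is Einstein. -/
def IsAlmostEinstein (f : R) : Prop :=
  ∀ a b, Q.hess f a b = -(Q.P a b * f) - Q.g a b * Q.tau f

lemma cast_inv (hn : 3 ≤ n) : algebraMap ℝ R (1 / (n : ℝ)) * (n : R) = 1 := by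
  have h : (n : ℝ) ≠ 0 := by
    have : (3 : ℝ) ≤ n := by exact_mod_cast hn
    intro h; linarith
  have : (n : R) = algebraMap ℝ R (n : ℝ) := by rw [map_natCast]
  rw [this, ← map_mul, one_div_mul_cancel h, map_one]

/-- Taking the trace identifies the multiplier: `n X = Δf + J f`, that is `X = -tau f`. -/
lemma isAlmostEinstein_of_eq (hn : 3 ≤ n) {f X : R}
    (h : ∀ a b, Q.hess f a b + Q.P a b * f = X * Q.g a b) : Q.IsAlmostEinstein f := by
  have hX : Q.lap f + Q.J * f = n * X := by
    rw [← Q.sum_gi_g_trace, lap, J, Finset.sum_mul, Finset.sum_mul, ← Finset.sum_add_distrib]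
    refine Finset.sum_congr rfl fun a _ => ?_
    rw [Finset.sum_mul, Finset.sum_mul, ← Finset.sum_add_distrib]
    refine Finset.sum_congr rfl fun b _ => ?_
    linear_combination Q.gi a b * h a b
  intro a b
  rw [tau, hX]
  linear_combination h a b - Q.g a b * X * cast_inv (R := R) hn

/-- If `σ⁻² g` is Einstein, then `σ` satisfies the almost Einstein equation. -/
lemma isAlmostEinstein_of_einstein (hn : 3 ≤ n) {Q' : AlgMetric n R} {σ v f : R}
    (hd : Q'.d = Q.d) (hv : σ * v = 1) (hg : ∀ a b, Q'.g a b = v ^ 2 * Q.g a b)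
    (hE : ∀ a b, Q'.ric a b = f * Q'.g a b) : Q.IsAlmostEinstein σ := by
  -- With `u = σ⁻¹ dσ` one has `∇u + u ⊗ u = σ⁻¹ ∇∇σ`, so the quadratic term of the Ricci formula
  -- disappears and the equation becomes linear in `σ`.
  have hu : ∀ i j, Q.d i (v * Q.d j σ) = v * Q.d i (Q.d j σ) - (v * Q.d i σ) * (v * Q.d j σ) := by
    intro i j
    rw [Derivation.leibniz, Q.d_inv hv]
    simp only [smul_eq_mul]; ring
  have hr : ∀ j l, Q'.ric j l = _ := fun j l =>
    (by simp only [ric, riem, Γ_conf hd hv hg, hd] : Q'.ric j l = _).trans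
      (Q.ric_conf_aux (fun a => v * Q.d a σ) (fun i j => by
        simp only [hu]; rw [Q.d_comm]; ring) j l)
  set Y := (∑ k, Q.d k (Q.up (fun a => v * Q.d a σ) k)
    + ∑ k, ∑ m, Q.Γ k k m * Q.up (fun a => v * Q.d a σ) m
    - ((n : R) - 2) * ∑ k, (v * Q.d k σ) * Q.up (fun a => v * Q.d a σ) k)
  -- This witness is whatever multiplies the metric once the Ricci formula is solved for `∇∇σ + σP`;
  -- its value is of no further use.
  refine Q.isAlmostEinstein_of_eq hn (X := algebraMap ℝ R (((n : ℝ) - 2)⁻¹) * σ *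
    (f * v ^ 2 - Q.J - Y)) fun a b => ?_
  have h := hr a b
  rw [hE, hg, hu, Q.ric_eq hn] at h
  have e : ∑ m, Q.Γ m a b * (v * Q.d m σ) = v * ∑ m, Q.Γ m a b * Q.d m σ := by
    rw [Finset.mul_sum]
    exact Finset.sum_congr rfl fun _ _ => by ring
  rw [e] at h
  have c := cast_sub_two_inv (R := R) hn
  rw [hess]
  set c2 := algebraMap ℝ R (((n : ℝ) - 2)⁻¹)
  set S := ∑ m, Q.Γ m a b * Q.d m σ
  linear_combination -c2 * σ * h - (Q.d a (Q.d b σ) - S + Q.P a b * σ) * c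
    - (Q.d a (Q.d b σ) - S) * c2 * ((n : R) - 2) * hv

/-- The connection matrices of the tractor connection. -/
def tconn (a : Fin n) : Matrix (TIdx n) (TIdx n) R
  | .inl _, .inr (.inl b) => if b = a then -1 else 0
  | .inr (.inl b), .inl _ => Q.P a b
  | .inr (.inl b), .inr (.inl c) => -Q.Γ c a b
  | .inr (.inl b), .inr (.inr _) => Q.g a b
  | .inr (.inr _), .inr (.inl c) => -Q.Pm a c
  | _, _ => 0

/-- The curvature of the tractor connection. -/
def tcurv (a b : Fin n) : Matrix (TIdx n) (TIdx n) R
  | .inr (.inl c), .inl _ => Q.cot c a b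
  | .inr (.inl c), .inr (.inl e) => -Q.weyl a b e c
  | .inr (.inr _), .inr (.inl e) => -∑ c, Q.cot c a b * Q.gi c e
  | _, _ => 0

lemma cot_eq (a b c : Fin n) : Q.cot a b c = Q.d b (Q.P c a) - Q.d c (Q.P b a)
    - ∑ m, (Q.Γ m b a * Q.P c m - Q.Γ m c a * Q.P b m) := by
  have : ∑ m, Q.Γ m b c * Q.P m a = ∑ m, Q.Γ m c b * Q.P m a :=
    Finset.sum_congr rfl fun m _ => by rw [Q.Γ_symm]
  simp only [cot, cov2, Finset.sum_add_distrib, Finset.sum_sub_distrib, this]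
  ring

/-- Slot by slot: symmetry of `P`, `g`, `Γ` and metric compatibility kill the entries absent from
`tcurv`. The middle block is the Riemann tensor minus its Schouten part, and the others are skewed
derivatives of `P`. -/
lemma curv_tconn (a b : Fin n) : curv Q.d Q.tconn a b = Q.tcurv a b := by
  have s : ∀ f : TIdx n → R, ∑ K, f K = f (.inl ()) + (∑ c, f (.inr (.inl c)) + f (.inr (.inr ()))) :=
    fun f => by
    rw [Fintype.sum_sum_type, Fintype.sum_sum_type]; simp
  ext I K
  simp only [curv, Matrix.add_apply, Matrix.sub_apply, matD_apply, Matrix.mul_apply, s]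
  rcases I with _ | c | _ <;> rcases K with _ | e | _
  · simp [tconn, tcurv, Q.P_symm a b]
  · simp [tconn, tcurv, apply_ite, Q.Γ_symm e a b]
  · simp [tconn, tcurv, Q.g_comm a b]
  · simp [tconn, tcurv, cot_eq]
    ring
  · have e1 : ∀ a b, ∑ m, Q.Γ m a c * Q.Γ e b m = ∑ m, Q.Γ e b m * Q.Γ m a c := fun a b =>
      Finset.sum_congr rfl fun _ _ => mul_comm _ _
    simp only [tconn, tcurv, weyl, riem, Finset.sum_sub_distrib, e1, mul_ite, mul_neg, mul_one,
      mul_zero, ite_mul, one_mul, zero_mul, map_neg, neg_mul, neg_neg, Q.g_comm c]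
    split_ifs <;> ring
  · simp only [tconn, tcurv, d_g, Finset.sum_add_distrib, neg_mul, Finset.sum_neg_distrib]
    have e1 : ∑ m, Q.Γ m a b * Q.g m c = ∑ m, Q.Γ m b a * Q.g m c :=
      Finset.sum_congr rfl fun m _ => by rw [Q.Γ_symm]
    rw [e1]
    simp [Q.g_comm b, Q.g_comm a]
  · simp only [tconn, tcurv]
    have e1 : ∑ x, Q.Pm a x * Q.P b x = ∑ x, Q.Pm b x * Q.P a x := by
      simp only [Pm, Finset.sum_mul]
      rw [Finset.sum_comm]
      exact Finset.sum_congr rfl fun x _ => Finset.sum_congr rfl fun y _ => by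
        rw [Q.gi_comm]; ring
    simp [e1]
  · have e1 : ∀ a b, Q.d a (Q.Pm b e) = ∑ c, Q.d a (Q.P b c) * Q.gi c e
        - ∑ c, ∑ m, Q.P b c * Q.Γ c a m * Q.gi m e - ∑ c, Q.Pm b c * Q.Γ e a c := fun a b => by
      simp only [Pm, map_sum, Derivation.leibniz, d_gi, smul_eq_mul, Finset.sum_mul,
        Finset.sum_add_distrib, mul_neg, Finset.sum_neg_distrib, mul_add, Finset.mul_sum]
      rw [Finset.sum_comm (f := fun c i => Q.P b i * Q.gi i c * Q.Γ e a c)]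
      have t1 : ∀ c i, Q.P b c * (Q.Γ c a i * Q.gi i e) = Q.P b c * Q.Γ c a i * Q.gi i e :=
        fun _ _ => by ring
      have t2 : ∀ c i, Q.P b c * (Q.Γ e a i * Q.gi c i) = Q.P b c * Q.gi c i * Q.Γ e a i :=
        fun _ _ => by ring
      have t3 : ∀ c, Q.gi c e * Q.d a (Q.P b c) = Q.d a (Q.P b c) * Q.gi c e := fun _ => by ring
      simp only [t1, t2, t3]
      ring
    have e2 : ∀ a b, ∑ c, ∑ m, Q.P b c * Q.Γ c a m * Q.gi m e
        = ∑ c, (∑ m, Q.Γ m a c * Q.P b m) * Q.gi c e := fun a b => by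
      rw [Finset.sum_comm]
      simp only [Finset.sum_mul]
      exact Finset.sum_congr rfl fun _ _ => Finset.sum_congr rfl fun _ _ => by ring
    simp only [tconn, tcurv, map_neg, e1, e2, cot_eq, sub_mul, Finset.sum_sub_distrib,
      zero_mul, neg_mul_neg, add_zero, zero_add]
    ring
  · simp only [tconn, tcurv]
    have e1 : ∀ a b, ∑ x, Q.Pm a x * Q.g b x = Q.P a b := fun a b => by
      rw [← Q.sum_g_Pm]
      exact Finset.sum_congr rfl fun _ _ => mul_comm _ _
    simp [e1, Q.P_symm a b]

lemma sum_TIdx (f : TIdx n → R) :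
    ∑ K, f K = f (.inl ()) + (∑ c, f (.inr (.inl c)) + f (.inr (.inr ()))) := by
  rw [Fintype.sum_sum_type, Fintype.sum_sum_type]; simp

/-- The tractor `(1/n) D_A σ`. -/
def scaleVec (f : R) : TIdx n → R
  | .inl _ => f
  | .inr (.inl a) => Q.d a f
  | .inr (.inr _) => Q.tau f

/-- The Ricci identity: if `∇v = E`, commuting the derivations on `v` yields curvature times `v` as
the skew derivative of `E`. -/
lemma curv_mulVec_of_d {κ : Type*} [Fintype κ] [DecidableEq κ] (A : Fin n → Matrix κ κ R)
    (v : κ → R) (E : Fin n → κ → R)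
    (h : ∀ a K, Q.d a (v K) = -∑ L, A a K L * v L + E a K) (a b : Fin n) (K : κ) :
    ∑ L, curv Q.d A a b K L * v L = Q.d a (E b K) - Q.d b (E a K)
      + ∑ L, A a K L * E b L - ∑ L, A b K L * E a L := by
  have key : ∀ a b, Q.d a (Q.d b (v K)) = -∑ L, Q.d a (A b K L) * v L
      + ∑ L, (A b * A a) K L * v L - ∑ L, A b K L * E a L + Q.d a (E b K) := fun a b => by
    rw [h b]
    simp only [map_add, map_neg, map_sum, Derivation.leibniz, h a, smul_eq_mul, mul_add, mul_neg,
      Finset.sum_add_distrib, Finset.sum_neg_distrib, Finset.mul_sum, Matrix.mul_apply,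
      Finset.sum_mul]
    rw [Finset.sum_comm (f := fun x i => A b K i * A a i x * v x)]
    simp only [mul_assoc, mul_comm (v _)]
    ring
  have h2 := Q.d_comm a b (v K)
  rw [key, key] at h2
  simp only [curv, Matrix.add_apply, Matrix.sub_apply, matD_apply, add_mul, sub_mul,
    Finset.sum_add_distrib, Finset.sum_sub_distrib]
  linear_combination -h2

variable {Q} in
-- The top slot of `∇I` vanishes by construction and the middle one by the almost Einstein equation.
-- The bottom slot stays open until `d_tau`.
lemma IsAlmostEinstein.d_scaleVec {f : R} (hf : Q.IsAlmostEinstein f) (a : Fin n) (K : TIdx n) :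
    Q.d a (Q.scaleVec f K) = -∑ L, Q.tconn a K L * Q.scaleVec f L
      + (if K = .inr (.inr ()) then Q.d a (Q.tau f) - ∑ m, Q.Pm a m * Q.d m f else 0) := by
  rcases K with _ | b | _
  · simp [tconn, scaleVec]
  · have h := hf a b
    rw [hess] at h
    simp [tconn, scaleVec]
    linear_combination h
  · simp [tconn, scaleVec]

variable {Q} in
/-- The bottom slot of the parallel tractor of an Einstein scale. -/
lemma IsAlmostEinstein.d_tau (hn : 3 ≤ n) {f : R} (hf : Q.IsAlmostEinstein f) (a : Fin n) :
    Q.d a (Q.tau f) = ∑ m, Q.Pm a m * Q.d m f := by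
  -- `e` is the possible bottom slot of `∇I`. In the middle slot of `Ω I` it enters only through the
  -- metric, while Weyl and Cotton are trace-free; contracting gives `(1 - n) e = 0`.
  set e : Fin n → R := fun a => Q.d a (Q.tau f) - ∑ m, Q.Pm a m * Q.d m f with he
  have h : ∀ b c, Q.cot c a b * f - ∑ m, Q.weyl a b m c * Q.d m f
      = Q.g a c * e b - Q.g b c * e a := fun b c => by
    have h := Q.curv_mulVec_of_d Q.tconn (Q.scaleVec f) _ hf.d_scaleVec a b (.inr (.inl c))
    simp only [curv_tconn] at h
    simpa [tcurv, tconn, scaleVec, ← sub_eq_add_neg] using h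
  have h' := Finset.sum_congr (rfl : (Finset.univ : Finset (Fin n)) = _) fun b _ =>
    Finset.sum_congr (rfl : (Finset.univ : Finset (Fin n)) = _) fun c _ =>
      congrArg (Q.gi b c * ·) (h b c)
  simp only [mul_sub, Finset.sum_sub_distrib] at h'
  have e1 : ∑ b, ∑ c, Q.gi b c * (Q.cot c a b * f) = 0 := by
    simp only [← mul_assoc, ← Finset.sum_mul, Q.cot_trace hn, zero_mul]
  have e2 : ∑ b, ∑ c, Q.gi b c * ∑ m, Q.weyl a b m c * Q.d m f = 0 := by
    have : ∑ b, ∑ c, Q.gi b c * ∑ m, Q.weyl a b m c * Q.d m f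
        = ∑ m, (∑ b, ∑ c, Q.gi b c * Q.weyl a b m c) * Q.d m f := by
      simp only [Finset.mul_sum, Finset.sum_mul]
      symm
      rw [Finset.sum_comm]
      refine Finset.sum_congr rfl fun b _ => ?_
      rw [Finset.sum_comm]
      exact Finset.sum_congr rfl fun c _ => Finset.sum_congr rfl fun m _ => by ring
    rw [this]
    simp only [Q.weyl_trace_gi hn, zero_mul, Finset.sum_const_zero]
  have e3 : ∑ b, ∑ c, Q.gi b c * (Q.g b c * e a) = n * e a := by
    rw [← Q.sum_gi_g_trace]
    simp only [Finset.sum_mul, mul_assoc]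
  have e4 : ∑ b, ∑ c, Q.gi b c * (Q.g a c * e b) = e a := by
    have : ∀ b, ∑ c, Q.gi b c * (Q.g a c * e b) = (if b = a then 1 else 0) * e b := fun b => by
      rw [← sum_gi_g, Finset.sum_mul]
      exact Finset.sum_congr rfl fun e _ => by rw [Q.g_comm]; ring
    simp [this]
  rw [e1, e2, e3, e4] at h'
  have c := cast_sub_one_inv (R := R) hn
  have : e a = 0 := by
    linear_combination 2 * algebraMap ℝ R ((2 * ((n : ℝ) - 1))⁻¹) * h' - e a * c
  exact sub_eq_zero.mp this

variable {Q} in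
/-- The tractor of an Einstein scale is parallel. -/
lemma IsAlmostEinstein.scaleVec_parallel (hn : 3 ≤ n) {f : R} (hf : Q.IsAlmostEinstein f)
    (a : Fin n) (K : TIdx n) :
    Q.d a (Q.scaleVec f K) = -∑ L, Q.tconn a K L * Q.scaleVec f L := by
  rw [hf.d_scaleVec, hf.d_tau hn, sub_self, ite_self, add_zero]

variable {Q} in
-- The middle slot of `Ω I = 0`, valid because `I` is parallel.
lemma IsAlmostEinstein.cot_mul (hn : 3 ≤ n) {f : R} (hf : Q.IsAlmostEinstein f)
    (a b c : Fin n) : Q.cot c a b * f = ∑ m, Q.weyl a b m c * Q.d m f := by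
  have h := Q.curv_mulVec_of_d Q.tconn (Q.scaleVec f) 0
    (fun a K => by rw [hf.scaleVec_parallel hn]; simp) a b (.inr (.inl c))
  simp only [curv_tconn] at h
  simp [tcurv, scaleVec] at h
  linear_combination h

end AlgMetric
end Tractor

/-! ### The conformal Killing field of two Einstein scales. -/

namespace Tractor
namespace AlgMetric

variable {n : ℕ} {R : Type*} [CommRing R] [Algebra ℝ R] (Q : AlgMetric n R)

/-- The gradient `∇^a f`. -/
def grad (f : R) (a : Fin n) : R := Q.up (fun b => Q.d b f) a

/-- The inner product `g^{ab} ∇_a f ∇_b h`. -/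
def ip (f h : R) : R := ∑ a, Q.grad f a * Q.d a h

/-- The derivative of a function along a vector field. -/
def vd (X : Fin n → R) (f : R) : R := ∑ a, X a * Q.d a f

lemma vd_mul (X : Fin n → R) (f h : R) : Q.vd X (f * h) = f * Q.vd X h + h * Q.vd X f := by
  simp only [vd, Derivation.leibniz, smul_eq_mul, Finset.mul_sum, ← Finset.sum_add_distrib]
  exact Finset.sum_congr rfl fun _ _ => by ring

lemma ip_comm (f h : R) : Q.ip f h = Q.ip h f := by
  simp only [ip, grad, up, Finset.sum_mul]
  rw [Finset.sum_comm]
  exact Finset.sum_congr rfl fun a _ => Finset.sum_congr rfl fun b _ => by rw [Q.gi_comm]; ring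

/-- `∇_a X^c`. -/
def covV (X : Fin n → R) (a c : Fin n) : R := Q.d a (X c) + ∑ m, Q.Γ c a m * X m

/-- The divergence `∇_c X^c`. -/
def dvg (X : Fin n → R) : R := ∑ c, Q.covV X c c

lemma covV_grad (f : R) (a c : Fin n) : Q.covV (Q.grad f) a c = ∑ b, Q.gi c b * Q.hess f a b := by
  simp only [covV, grad, up, hess, map_sum, Derivation.leibniz, d_gi, smul_eq_mul, mul_sub,
    Finset.sum_add_distrib, Finset.sum_sub_distrib, Finset.mul_sum, mul_neg,
    Finset.sum_neg_distrib, mul_add]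
  have e1 : ∑ x, ∑ y, Q.Γ c a x * (Q.gi x y * Q.d y f)
      = ∑ x, ∑ y, Q.d x f * (Q.Γ c a y * Q.gi y x) := by
    rw [Finset.sum_comm]
    exact Finset.sum_congr rfl fun _ _ => Finset.sum_congr rfl fun _ _ => by ring
  have e2 : ∑ x, ∑ y, Q.d x f * (Q.Γ x a y * Q.gi c y)
      = ∑ x, ∑ y, Q.gi c x * (Q.Γ y a x * Q.d y f) := by
    rw [Finset.sum_comm]
    exact Finset.sum_congr rfl fun _ _ => Finset.sum_congr rfl fun _ _ => by ring
  rw [e1, e2]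
  ring

lemma dvg_grad (f : R) : Q.dvg (Q.grad f) = Q.lap f := by
  simp only [dvg, covV_grad, lap]

variable {Q} in
lemma IsAlmostEinstein.covV_grad {f : R} (hf : Q.IsAlmostEinstein f) (a c : Fin n) :
    Q.covV (Q.grad f) a c = -(Q.Pm a c * f) - (if a = c then 1 else 0) * Q.tau f := by
  rw [AlgMetric.covV_grad]
  have e : ∀ b, Q.gi c b * Q.hess f a b = -(Q.P a b * Q.gi b c) * f
      - Q.g a b * Q.gi b c * Q.tau f := fun b => by
    rw [hf a b, Q.gi_comm c b]; ring
  simp only [e, Finset.sum_sub_distrib, ← Finset.sum_mul, Finset.sum_neg_distrib, sum_g_gi, Pm]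
  ring

lemma lap_eq_tau (hn : 3 ≤ n) (f : R) : Q.lap f = -(Q.J * f) - n * Q.tau f := by
  rw [tau]
  linear_combination -(Q.lap f + Q.J * f) * cast_inv (R := R) hn

/-- The conformal Killing field `s' ∇^a s - s ∇^a s'` of two Einstein scales. -/
def kf (s t : R) (a : Fin n) : R := t * Q.grad s a - s * Q.grad t a

/-- The conformal factor of the field `kf`. -/
def kν (s t : R) : R := s * Q.tau t - t * Q.tau s

section TwoScales

variable {Q} (hn : 3 ≤ n) {s t : R} (hs : Q.IsAlmostEinstein s) (ht : Q.IsAlmostEinstein t)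

include hn hs ht in
-- The Schouten terms of the two Hessians cancel. What is left is a skew part plus `ν` times the
-- identity: `k` is a conformal Killing field.
lemma covV_kf (a c : Fin n) : Q.covV (Q.kf s t) a c = Q.d a t * Q.grad s c - Q.d a s * Q.grad t c
    + (if a = c then 1 else 0) * Q.kν s t := by
  have e : Q.covV (Q.kf s t) a c = Q.d a t * Q.grad s c - Q.d a s * Q.grad t c
      + t * Q.covV (Q.grad s) a c - s * Q.covV (Q.grad t) a c := by
    simp only [covV, kf, map_sub, Derivation.leibniz, smul_eq_mul, mul_sub, mul_add,
      Finset.sum_sub_distrib, Finset.mul_sum]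
    simp only [mul_left_comm (Q.Γ _ _ _)]
    ring
  rw [e, hs.covV_grad, ht.covV_grad, kν]
  ring

lemma d_eq_covV (X : Fin n → R) (a c : Fin n) :
    Q.d a (X c) = Q.covV X a c - ∑ m, Q.Γ c a m * X m := by
  rw [covV]; ring

lemma sum_gi_d (f : R) (a : Fin n) : ∑ c, Q.gi a c * Q.d c f = Q.grad f a := rfl

lemma sum_gi_d' (f : R) (a : Fin n) : ∑ c, Q.gi c a * Q.d c f = Q.grad f a := by
  rw [← sum_gi_d]
  exact Finset.sum_congr rfl fun c _ => by rw [Q.gi_comm]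

include hn hs ht in
-- The Lie derivative of the inverse metric, written with plain partial derivatives, as needed for
-- the second order part of `[Δ, ∇_k]`.
lemma killing (a b : Fin n) : Q.vd (Q.kf s t) (Q.gi a b) = ∑ c, Q.gi c b * Q.d c (Q.kf s t a)
    + ∑ c, Q.gi a c * Q.d c (Q.kf s t b) - 2 * Q.kν s t * Q.gi a b := by
  have e1 : ∀ a b, ∑ c, Q.gi c b * Q.covV (Q.kf s t) c a = Q.grad t b * Q.grad s a
      - Q.grad s b * Q.grad t a + Q.kν s t * Q.gi a b := fun a b => by
    simp only [covV_kf hn hs ht, mul_add, mul_sub, Finset.sum_add_distrib, Finset.sum_sub_distrib,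
      ← mul_assoc, ← Finset.sum_mul, sum_gi_d']
    simp
    ring
  have e2 : ∀ f : Fin n → R, ∑ c, Q.gi a c * f c = ∑ c, Q.gi c a * f c := fun f =>
    Finset.sum_congr rfl fun c _ => by rw [Q.gi_comm]
  rw [e2]
  simp only [d_eq_covV (Q.kf s t), mul_sub, Finset.sum_sub_distrib, e1, vd, d_gi]
  have e3 : ∑ c, Q.kf s t c * -∑ m, (Q.Γ a c m * Q.gi m b + Q.Γ b c m * Q.gi a m)
      = -∑ c, Q.gi c b * ∑ m, Q.Γ a c m * Q.kf s t m
        - ∑ c, Q.gi c a * ∑ m, Q.Γ b c m * Q.kf s t m := by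
    simp only [Finset.mul_sum, mul_neg, mul_add, Finset.sum_add_distrib, Finset.sum_neg_distrib]
    rw [Finset.sum_comm, Finset.sum_comm (f := fun x i => Q.kf s t x * (Q.Γ b x i * Q.gi a i))]
    rw [neg_add, ← sub_eq_add_neg]
    congr 1
    · congr 1
      exact Finset.sum_congr rfl fun _ _ => Finset.sum_congr rfl fun _ _ => by
        rw [Q.Γ_symm]; ring
    · exact Finset.sum_congr rfl fun _ _ => Finset.sum_congr rfl fun _ _ => by
        rw [Q.Γ_symm, Q.gi_comm a]; ring
  rw [e3, Q.gi_comm b a]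
  ring

lemma sum_riem_trace (i j : Fin n) : ∑ k, Q.riem i j k k = 0 := by
  have h : ∑ k, Q.riem i j k k = -∑ k, Q.riem i j k k := by
    conv_lhs => simp only [← sum_gi_riemLow]
    rw [Finset.sum_comm]
    simp only [← sum_gi_riemLow, ← Finset.sum_neg_distrib]
    exact Finset.sum_congr rfl fun k _ => Finset.sum_congr rfl fun m _ => by
      rw [Q.riemLow_swap', Q.gi_comm]; ring
  linear_combination algebraMap ℝ R (1 / 2) * h - (∑ k, Q.riem i j k k) * half (R := R)

variable (Q) in
/-- The contracted Christoffel symbols `Γ^c_{ca}`. -/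
def θ (a : Fin n) : R := ∑ c, Q.Γ c c a

/-- Geometrically `θ` is the differential of `log √|det g|`; algebraically, its closedness is the
vanishing of the trace `R_{ij}{}^k{}_k`. -/
lemma d_θ_symm (a c : Fin n) : Q.d a (Q.θ c) = Q.d c (Q.θ a) := by
  have h := Q.sum_riem_trace a c
  simp only [riem, Finset.sum_add_distrib, Finset.sum_sub_distrib] at h
  rw [Finset.sum_comm (f := fun k m => Q.Γ k c m * Q.Γ m a k)] at h
  have e : ∑ x, ∑ i, Q.Γ x a i * Q.Γ i c x = ∑ y, ∑ x, Q.Γ x c y * Q.Γ y a x :=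
    Finset.sum_congr rfl fun _ _ => Finset.sum_congr rfl fun _ _ => by ring
  rw [e] at h
  simp only [θ, map_sum]
  have e' : ∀ a c, ∑ x, Q.d a (Q.Γ x x c) = ∑ x, Q.d a (Q.Γ x c x) := fun a c =>
    Finset.sum_congr rfl fun _ _ => by rw [Q.Γ_symm]
  rw [e', e']
  linear_combination h

variable (Q) in
/-- `g^{ab} Γ^c_{ab}`. -/
def γ (c : Fin n) : R := ∑ a, ∑ b, Q.gi a b * Q.Γ c a b

lemma sum_d_gi (b : Fin n) : ∑ a, Q.d a (Q.gi a b) = -Q.up Q.θ b - Q.γ b := by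
  simp only [d_gi, up, θ, γ, Finset.sum_add_distrib, Finset.sum_neg_distrib, Finset.mul_sum]
  rw [neg_add, ← sub_eq_add_neg]
  congr 1
  · rw [Finset.sum_comm]
    congr 1
    exact Finset.sum_congr rfl fun _ _ => Finset.sum_congr rfl fun _ _ => by
      rw [Q.gi_comm b]; ring
  · exact Finset.sum_congr rfl fun _ _ => Finset.sum_congr rfl fun _ _ => by ring

include hn hs ht in
lemma dvg_kf : ∑ a, Q.d a (Q.kf s t a) + ∑ a, Q.kf s t a * Q.θ a = n * Q.kν s t := by
  have h : Q.dvg (Q.kf s t) = n * Q.kν s t := by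
    simp only [dvg, covV_kf hn hs ht, Finset.sum_add_distrib, Finset.sum_sub_distrib]
    have : ∑ x, Q.d x t * Q.grad s x = ∑ x, Q.d x s * Q.grad t x := by
      have := Q.ip_comm s t
      simpa only [ip, mul_comm] using this
    rw [this]
    simp
  rw [← h]
  simp only [dvg, covV, Finset.sum_add_distrib, θ, Finset.mul_sum]
  congr 1
  rw [Finset.sum_comm]
  exact Finset.sum_congr rfl fun _ _ => Finset.sum_congr rfl fun _ _ => mul_comm _ _

include hn hs ht in
lemma vd_up_θ (b : Fin n) : Q.vd (Q.kf s t) (Q.up Q.θ b) = ∑ c, Q.up Q.θ c * Q.d c (Q.kf s t b)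
    - 2 * Q.kν s t * Q.up Q.θ b + ∑ c, Q.gi c b * Q.d c (∑ a, Q.kf s t a * Q.θ a) := by
  have e1 : Q.vd (Q.kf s t) (Q.up Q.θ b) = ∑ a, Q.vd (Q.kf s t) (Q.gi b a) * Q.θ a
      + ∑ c, Q.gi c b * ∑ a, Q.kf s t a * Q.d c (Q.θ a) := by
    simp only [vd, up, map_sum, Derivation.leibniz, smul_eq_mul, mul_add, Finset.sum_add_distrib,
      Finset.mul_sum, Finset.sum_mul]
    rw [add_comm]
    congr 1
    · rw [Finset.sum_comm]
      exact Finset.sum_congr rfl fun _ _ => Finset.sum_congr rfl fun _ _ => by ring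
    · rw [Finset.sum_comm]
      exact Finset.sum_congr rfl fun c _ => Finset.sum_congr rfl fun a _ => by
        rw [Q.gi_comm b c, d_θ_symm a c]; ring
  rw [e1]
  simp only [killing hn hs ht, sub_mul, add_mul, Finset.sum_add_distrib, Finset.sum_sub_distrib,
    map_sum, Derivation.leibniz, smul_eq_mul, mul_add, up, Finset.mul_sum, Finset.sum_mul]
  have t1 : ∑ x, ∑ i, Q.gi i x * Q.d i (Q.kf s t b) * Q.θ x
      = ∑ x, ∑ i, Q.gi x i * Q.θ i * Q.d x (Q.kf s t b) := by
    rw [Finset.sum_comm]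
    exact Finset.sum_congr rfl fun _ _ => Finset.sum_congr rfl fun _ _ => by ring
  have t2 : ∑ x, ∑ i, Q.gi b i * Q.d i (Q.kf s t x) * Q.θ x
      = ∑ x, ∑ i, Q.gi x b * (Q.θ i * Q.d x (Q.kf s t i)) := by
    rw [Finset.sum_comm]
    exact Finset.sum_congr rfl fun _ _ => Finset.sum_congr rfl fun _ _ => by rw [Q.gi_comm b]; ring
  have t3 : ∑ x, 2 * Q.kν s t * Q.gi b x * Q.θ x = ∑ x, 2 * Q.kν s t * (Q.gi b x * Q.θ x) :=
    Finset.sum_congr rfl fun _ _ => by ring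
  rw [t1, t2, t3]
  ring

include hn hs ht in
-- This controls the first order part of `[Δ, ∇_k]`. It comes from computing the divergence of
-- `killing` in two ways, the traces being governed by `dvg_kf`; no curvature of `g` is needed.
lemma second_deriv_kf (b : Fin n) :
    ∑ a, ∑ c, Q.gi a c * Q.d a (Q.d c (Q.kf s t b)) - ∑ c, Q.γ c * Q.d c (Q.kf s t b)
      + Q.vd (Q.kf s t) (Q.γ b) = -(2 * Q.kν s t * Q.γ b) + (2 - (n : R)) * Q.grad (Q.kν s t) b := by
  have h1 : ∑ a, Q.d a (Q.vd (Q.kf s t) (Q.gi a b)) = ∑ a, ∑ c, Q.d a (Q.gi c b) * Q.d c (Q.kf s t a)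
      + Q.vd (Q.kf s t) (∑ a, Q.d a (Q.gi a b)) := by
    simp only [vd, map_sum, Derivation.leibniz, smul_eq_mul, Finset.sum_add_distrib,
      Finset.mul_sum]
    rw [add_comm]
    congr 1
    · rw [Finset.sum_comm]
    · rw [Finset.sum_comm]
      exact Finset.sum_congr rfl fun a _ => Finset.sum_congr rfl fun c _ => by rw [Q.d_comm]
  have h2 : ∑ a, Q.d a (Q.vd (Q.kf s t) (Q.gi a b)) = ∑ a, ∑ c, Q.d a (Q.gi c b) * Q.d c (Q.kf s t a)
      + ∑ c, Q.gi c b * Q.d c (∑ a, Q.d a (Q.kf s t a))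
      + ∑ c, (∑ a, Q.d a (Q.gi a c)) * Q.d c (Q.kf s t b)
      + ∑ a, ∑ c, Q.gi a c * Q.d a (Q.d c (Q.kf s t b))
      - 2 * Q.grad (Q.kν s t) b - 2 * Q.kν s t * ∑ a, Q.d a (Q.gi a b) := by
    have d2 : ∀ (a : Fin n) (f : R), Q.d a (2 * f) = 2 * Q.d a f := fun a f => by
      rw [two_mul, map_add, two_mul]
    rw [← sum_gi_d']
    simp only [killing hn hs ht, map_sum, map_add, map_sub, Derivation.leibniz, smul_eq_mul,
      Finset.sum_add_distrib, Finset.sum_sub_distrib, Finset.mul_sum, Finset.sum_mul, mul_assoc, d2]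
    rw [Finset.sum_comm (f := fun x i => Q.gi i b * Q.d x (Q.d i (Q.kf s t x))),
      Finset.sum_comm (f := fun x i => Q.d i (Q.kf s t b) * Q.d x (Q.gi x i))]
    simp only [Q.d_comm _ _ (Q.kf s t _), mul_comm (Q.d _ (Q.kf s t _)) (Q.d _ (Q.gi _ _))]
    simp only [mul_add, Finset.sum_add_distrib]
    ring
  have h3 := vd_up_θ hn hs ht b
  have h4 : ∑ c, Q.gi c b * Q.d c (∑ a, Q.d a (Q.kf s t a) + ∑ a, Q.kf s t a * Q.θ a)
      = n * Q.grad (Q.kν s t) b := by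
    rw [dvg_kf hn hs ht, ← sum_gi_d', Finset.mul_sum]
    exact Finset.sum_congr rfl fun c _ => by rw [Derivation.leibniz]; simp; ring
  simp only [map_add, mul_add, Finset.sum_add_distrib] at h4
  rw [h2] at h1
  have h5 : Q.vd (Q.kf s t) (∑ a, Q.d a (Q.gi a b)) = -Q.vd (Q.kf s t) (Q.up Q.θ b)
      - Q.vd (Q.kf s t) (Q.γ b) := by
    rw [sum_d_gi]
    simp only [vd, map_sub, map_neg, mul_sub, mul_neg, Finset.sum_sub_distrib,
      Finset.sum_neg_distrib]
  rw [h5, h3] at h1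
  simp only [sum_d_gi, sub_mul, neg_mul, Finset.sum_sub_distrib, Finset.sum_neg_distrib] at h1
  linear_combination h1 - h4

variable (Q) in
/-- The vector `P^a{}_b X^b`. -/
def PX (X : Fin n → R) (a : Fin n) : R := ∑ m, Q.Pm m a * X m

lemma sum_Pm_d (f : R) (a : Fin n) : ∑ m, Q.Pm a m * Q.d m f = ∑ m, Q.P a m * Q.grad f m := by
  simp only [Pm, grad, up, Finset.sum_mul, Finset.mul_sum]
  rw [Finset.sum_comm]
  exact Finset.sum_congr rfl fun _ _ => Finset.sum_congr rfl fun _ _ => by ring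

lemma sum_gi_P (X : Fin n → R) (c : Fin n) : ∑ a, Q.gi c a * ∑ m, Q.P a m * X m = Q.PX X c := by
  simp only [PX, Pm, Finset.mul_sum, Finset.sum_mul]
  rw [Finset.sum_comm]
  exact Finset.sum_congr rfl fun _ _ => Finset.sum_congr rfl fun _ _ => by
    rw [Q.gi_comm c, Q.P_symm]; ring

variable (Q) in
/-- The contraction `P(∇f, ∇h)`. -/
def Pgg (f h : R) : R := ∑ a, ∑ m, Q.P a m * Q.grad f a * Q.grad h m

lemma Pgg_comm (f h : R) : Q.Pgg f h = Q.Pgg h f := by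
  rw [Pgg, Pgg, Finset.sum_comm]
  exact Finset.sum_congr rfl fun _ _ => Finset.sum_congr rfl fun _ _ => by rw [Q.P_symm]; ring

include hn ht in
lemma vd_grad_tau (f : R) : Q.vd (Q.grad f) (Q.tau t) = Q.Pgg f t := by
  simp only [vd, ht.d_tau hn, sum_Pm_d, Pgg, Finset.mul_sum]
  exact Finset.sum_congr rfl fun _ _ => Finset.sum_congr rfl fun _ _ => by ring

include hn hs ht in
lemma grad_kν (c : Fin n) : Q.grad (Q.kν s t) c = Q.tau t * Q.grad s c - Q.tau s * Q.grad t c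
    - Q.PX (Q.kf s t) c := by
  have e : ∀ a, Q.d a (Q.kν s t) = Q.tau t * Q.d a s - Q.tau s * Q.d a t
      - ∑ m, Q.P a m * Q.kf s t m := fun a => by
    simp only [kν, map_sub, Derivation.leibniz, smul_eq_mul, hs.d_tau hn, ht.d_tau hn, sum_Pm_d,
      kf, mul_sub, Finset.sum_sub_distrib, mul_left_comm (Q.P _ _), ← Finset.mul_sum]
    ring
  rw [← sum_gi_P]
  simp only [grad, up, e, mul_sub, Finset.sum_sub_distrib, Finset.mul_sum]
  congr 1
  congr 1 <;> exact Finset.sum_congr rfl fun _ _ => by ring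

include hn in
lemma dvg_PX (X : Fin n → R) : Q.dvg (Q.PX X) = Q.vd X Q.J
    + ∑ c, ∑ m, Q.Pm m c * Q.covV X c m := by
  have e : ∀ m, Q.d m Q.J = Q.divP m := fun m => (Q.divP_eq hn m).symm
  simp only [dvg, covV, PX, vd, e, divP, map_sum, Derivation.leibniz, smul_eq_mul, mul_add, mul_sub,
    Finset.sum_add_distrib, Finset.mul_sum, Finset.sum_sub_distrib]
  rw [Finset.sum_comm (f := fun x i => X x * Q.d i (Q.Pm x i))]
  have s1 : ∀ f : Fin n → Fin n → Fin n → R,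
      ∑ m, ∑ b, ∑ e, f m b e = ∑ b, ∑ e, ∑ m, f m b e := fun f => by
    rw [Finset.sum_comm]
    exact Finset.sum_congr rfl fun b _ => Finset.sum_comm
  have t1 : ∑ x, ∑ y, ∑ i, Q.Γ x x y * (Q.Pm i y * X i)
      = ∑ x, ∑ y, ∑ i, X x * (Q.Γ y y i * Q.Pm x i) := by
    rw [← s1]
    exact Finset.sum_congr rfl fun _ _ => Finset.sum_congr rfl fun _ _ =>
      Finset.sum_congr rfl fun _ _ => by ring
  have t2 : ∑ x, ∑ y, ∑ i, Q.Pm y x * (Q.Γ y x i * X i)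
      = ∑ x, ∑ y, ∑ i, X x * (Q.Γ i y x * Q.Pm i y) := by
    rw [s1 fun x y i => X x * (Q.Γ i y x * Q.Pm i y)]
    exact Finset.sum_congr rfl fun _ _ => Finset.sum_congr rfl fun _ _ =>
      Finset.sum_congr rfl fun _ _ => by ring
  rw [t1, t2]
  ring

lemma dvg_mul (f : R) (X : Fin n → R) :
    Q.dvg (fun c => f * X c) = f * Q.dvg X + Q.vd X f := by
  simp only [dvg, covV, vd, Derivation.leibniz, smul_eq_mul, mul_left_comm (Q.Γ _ _ _),
    ← Finset.mul_sum, Finset.sum_add_distrib]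
  ring

lemma dvg_sub (X Y : Fin n → R) : Q.dvg (fun c => X c - Y c) = Q.dvg X - Q.dvg Y := by
  simp only [dvg, covV, map_sub, mul_sub, Finset.sum_sub_distrib, Finset.sum_add_distrib]
  ring

include hn hs ht in
-- Take the divergence of `grad_kν`. The contracted Bianchi identity turns the divergence of `P(k)`
-- into `k(J) + νJ`, and the `P(∇s, ∇t)` terms cancel. This makes the `w J` term of `op` compatible
-- with `kop`.
lemma lap_kν : Q.lap (Q.kν s t) = -Q.vd (Q.kf s t) Q.J - 2 * Q.kν s t * Q.J := by
  have e : Q.grad (Q.kν s t) = fun c => (Q.tau t * Q.grad s c - Q.tau s * Q.grad t c)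
    - Q.PX (Q.kf s t) c := funext (grad_kν hn hs ht)
  rw [← dvg_grad, e, dvg_sub, dvg_sub, dvg_mul, dvg_mul, dvg_PX hn, dvg_grad, dvg_grad,
    vd_grad_tau hn ht, vd_grad_tau hn hs, lap_eq_tau Q hn, lap_eq_tau Q hn, Q.Pgg_comm t s]
  have t1 : ∑ c, ∑ m, Q.Pm m c * Q.covV (Q.kf s t) c m = Q.kν s t * Q.J := by
    simp only [covV_kf hn hs ht, mul_add, mul_sub, Finset.sum_add_distrib, Finset.sum_sub_distrib]
    have a1 : ∀ f h, ∑ c, ∑ m, Q.Pm m c * (Q.d c f * Q.grad h m) = Q.Pgg h f := fun f h => by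
      rw [Finset.sum_comm]
      simp only [Pgg]
      refine Finset.sum_congr rfl fun a _ => ?_
      have := Q.sum_Pm_d f a
      calc _ = Q.grad h a * ∑ m, Q.Pm a m * Q.d m f := by
            rw [Finset.mul_sum]; exact Finset.sum_congr rfl fun _ _ => by ring
        _ = _ := by rw [this, Finset.mul_sum]; exact Finset.sum_congr rfl fun _ _ => by ring
    rw [a1, a1, Q.Pgg_comm]
    simp [← Finset.sum_mul, sum_Pm, mul_comm]
  rw [t1, kν]
  ring

include hn hs ht in
lemma vd_kf_self : Q.vd (Q.kf s t) s = t * Q.ip s s - s * Q.ip s t := by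
  simp only [vd, kf, sub_mul, Finset.sum_sub_distrib, mul_assoc, ← Finset.mul_sum]
  rw [Q.ip_comm s t]; rfl

include hn hs ht in
lemma vd_kf_tau : Q.vd (Q.kf s t) (Q.tau s) + Q.vd (Q.grad s) (Q.kν s t)
    = Q.tau t * Q.ip s s - Q.tau s * Q.ip s t := by
  have h1 : Q.vd (Q.kf s t) (Q.tau s) = t * Q.Pgg s s - s * Q.Pgg t s := by
    rw [← vd_grad_tau hn hs, ← vd_grad_tau hn hs]
    simp only [vd, kf, sub_mul, Finset.sum_sub_distrib, mul_assoc, ← Finset.mul_sum]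
  rw [h1, kν]
  have h2 : Q.vd (Q.grad s) (s * Q.tau t - t * Q.tau s) = s * Q.Pgg s t + Q.tau t * Q.ip s s
      - t * Q.Pgg s s - Q.tau s * Q.ip s t := by
    rw [← vd_grad_tau hn hs, ← vd_grad_tau hn ht]
    simp only [vd, ip, map_sub, Derivation.leibniz, smul_eq_mul, mul_sub, mul_add,
      Finset.sum_sub_distrib, Finset.sum_add_distrib, Finset.mul_sum]
    simp only [mul_left_comm (Q.grad _ _)]
    ring
  rw [h2, Q.Pgg_comm t s]
  ring

include hn hs ht in
-- The bracket of `∇s` and `k`. Adding `s ∇ν` removes the Schouten terms; the coefficients left are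
-- `ν`, `h(I,I') = sτ_t + tτ_s + ⟨∇s,∇t⟩` and `h(I,I) = 2sτ_s + ⟨∇s,∇s⟩`.
lemma bracket_kf (c : Fin n) : ∑ a, Q.grad s a * Q.d a (Q.kf s t c)
      - ∑ a, Q.kf s t a * Q.d a (Q.grad s c) + s * Q.grad (Q.kν s t) c
    = (Q.kν s t + (s * Q.tau t + t * Q.tau s + Q.ip s t)) * Q.grad s c
      - (2 * s * Q.tau s + Q.ip s s) * Q.grad t c := by
  have e : ∑ a, Q.grad s a * ∑ m, Q.Γ c a m * Q.kf s t m
      = ∑ a, Q.kf s t a * ∑ m, Q.Γ c a m * Q.grad s m := by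
    simp only [Finset.mul_sum]
    rw [Finset.sum_comm]
    exact Finset.sum_congr rfl fun _ _ => Finset.sum_congr rfl fun _ _ => by rw [Q.Γ_symm]; ring
  have e2 : ∑ a, Q.kf s t a * -(Q.Pm a c * s) = -(s * Q.PX (Q.kf s t) c) := by
    simp only [PX, Finset.mul_sum, ← Finset.sum_neg_distrib]
    exact Finset.sum_congr rfl fun _ _ => by ring
  have e3 : ∑ a, Q.grad s a * (Q.d a t * Q.grad s c) = Q.ip s t * Q.grad s c := by
    simp only [ip, Finset.sum_mul, mul_assoc]
  have e4 : ∑ a, Q.grad s a * (Q.d a s * Q.grad t c) = Q.ip s s * Q.grad t c := by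
    simp only [ip, Finset.sum_mul, mul_assoc]
  simp only [d_eq_covV, covV_kf hn hs ht, hs.covV_grad, grad_kν hn hs ht, mul_sub, mul_add,
    Finset.sum_sub_distrib, Finset.sum_add_distrib, e, e2, e3, e4]
  simp [kf, kν]
  ring

include hn hs ht in
-- By `cot_mul`, contracting Weyl with `t∇s - s∇t` gives `t(sA) - s(tA) = 0`; pair symmetry moves
-- `k` to the first index.
lemma sum_kf_weyl (b c e : Fin n) : ∑ a, Q.kf s t a * Q.weyl a b c e = 0 := by
  have h1 : ∀ a b c, ∑ m, Q.weylLow a b m c * Q.kf s t m = 0 := fun a b c => by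
    have e1 : ∀ f, ∑ m, Q.weylLow a b m c * Q.grad f m = ∑ m, Q.weyl a b m c * Q.d m f := fun f => by
      simp only [grad, up, ← sum_gi_weylLow, Finset.mul_sum, Finset.sum_mul]
      rw [Finset.sum_comm]
      exact Finset.sum_congr rfl fun _ _ => Finset.sum_congr rfl fun _ _ => by
        rw [Q.gi_comm]; ring
    have : ∑ m, Q.weylLow a b m c * Q.kf s t m
        = t * (∑ m, Q.weylLow a b m c * Q.grad s m) - s * ∑ m, Q.weylLow a b m c * Q.grad t m := by
      simp only [kf, mul_sub, Finset.sum_sub_distrib, Finset.mul_sum]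
      congr 1 <;> exact Finset.sum_congr rfl fun _ _ => by ring
    rw [this, e1, e1, ← hs.cot_mul hn, ← ht.cot_mul hn]
    ring
  simp only [← sum_gi_weylLow, Finset.mul_sum]
  rw [Finset.sum_comm]
  refine Finset.sum_eq_zero fun m _ => ?_
  rw [← mul_zero (Q.gi c m), ← h1 m e b, Finset.mul_sum]
  exact Finset.sum_congr rfl fun a _ => by rw [Q.weylLow_pair a b m e]; ring

include hn hs ht in
lemma sum_kf_cot {v : R} (hv : s * v = 1) (b e : Fin n) : ∑ a, Q.kf s t a * Q.cot e a b = 0 := by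
  have : ∑ a, Q.kf s t a * Q.cot e a b
      = v * ∑ m, (∑ a, Q.kf s t a * Q.weyl a b m e) * Q.d m s := by
    simp only [Finset.mul_sum, Finset.sum_mul]
    rw [Finset.sum_comm]
    refine Finset.sum_congr rfl fun a _ => ?_
    have h := hs.cot_mul hn a b e
    have : ∑ x, v * (Q.kf s t a * Q.weyl a b x e * Q.d x s)
        = v * Q.kf s t a * ∑ m, Q.weyl a b m e * Q.d m s := by
      rw [Finset.mul_sum]
      exact Finset.sum_congr rfl fun _ _ => by ring
    rw [this, ← h]
    linear_combination -(Q.kf s t a * Q.cot e a b) * hv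
  rw [this]
  simp [sum_kf_weyl hn hs ht]

include hn hs ht in
-- The entries of `Ω` are Weyl and Cotton tensors. This is what lets `∇_k` commute with covariant
-- differentiation on all tractors.
lemma sum_kf_tcurv {v : R} (hv : s * v = 1) (b : Fin n) :
    ∑ a, Q.kf s t a • Q.tcurv a b = 0 := by
  ext I K
  rw [Matrix.sum_apply]
  simp only [Matrix.smul_apply, smul_eq_mul, Matrix.zero_apply]
  rcases I with _ | c | _ <;> rcases K with _ | e | _ <;>
    simp only [tcurv, mul_zero, Finset.sum_const_zero, mul_neg, Finset.sum_neg_distrib,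
      sum_kf_weyl hn hs ht, sum_kf_cot hn hs ht hv, neg_zero]
  simp only [Finset.mul_sum, ← mul_assoc]
  rw [Finset.sum_comm]
  simp only [← Finset.sum_mul, sum_kf_cot hn hs ht hv, zero_mul, Finset.sum_const_zero, neg_zero]

end TwoScales

end AlgMetric
end Tractor

/-! ### The operators on a module with connection: commutation and powers. -/

namespace Tractor
namespace AlgMetric

variable {n : ℕ} {R : Type*} [CommRing R] [Algebra ℝ R] (Q : AlgMetric n R)
  {Md : Type*} [AddCommGroup Md] [Module R Md] (D : Fin n → Md →+ Md)

/-- The covariant derivative `X^a ∇_a` on a module with connection. -/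
def nab (X : Fin n → R) (m : Md) : Md := ∑ a, X a • D a m

/-- The Laplacian on a module with connection. -/
def lapM (m : Md) : Md :=
  ∑ a, ∑ b, Q.gi a b • (D a (D b m) - ∑ c, Q.Γ c a b • D c m)

lemma nab_add (X : Fin n → R) (m m' : Md) : nab D X (m + m') = nab D X m + nab D X m' := by
  simp only [nab, map_add, smul_add, Finset.sum_add_distrib]

lemma nab_sub (X : Fin n → R) (m m' : Md) : nab D X (m - m') = nab D X m - nab D X m' := by
  simp only [nab, map_sub, smul_sub, Finset.sum_sub_distrib]

lemma lapM_eq (m : Md) : Q.lapM D m = ∑ a, ∑ b, Q.gi a b • D a (D b m) - nab D Q.γ m := by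
  simp only [lapM, smul_sub, Finset.sum_sub_distrib, nab, γ, Finset.sum_smul, Finset.smul_sum,
    smul_smul]
  congr 1
  symm
  rw [Finset.sum_comm]
  exact Finset.sum_congr rfl fun a _ => Finset.sum_comm

lemma lapM_sub (m m' : Md) : Q.lapM D (m - m') = Q.lapM D m - Q.lapM D m' := by
  simp only [lapM_eq, map_sub, smul_sub, Finset.sum_sub_distrib, nab_sub]
  abel

section Leibniz

variable {Q D} (hD : ∀ a (f : R) (m : Md), D a (f • m) = Q.d a f • m + f • D a m)

include hD

lemma nab_smul (X : Fin n → R) (f : R) (m : Md) :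
    nab D X (f • m) = Q.vd X f • m + f • nab D X m := by
  simp only [nab, hD, vd, smul_add, Finset.sum_add_distrib, Finset.sum_smul, Finset.smul_sum,
    smul_smul, mul_comm f]

lemma lapM_smul (f : R) (m : Md) :
    Q.lapM D (f • m) = Q.lap f • m + (2 : R) • nab D (Q.grad f) m + f • Q.lapM D m := by
  simp only [lapM, hD, map_add, smul_add, smul_sub, Finset.sum_add_distrib, Finset.sum_sub_distrib,
    lap, hess, mul_sub, sub_smul, Finset.sum_smul, Finset.smul_sum, smul_smul, Finset.mul_sum]
  have e1 : ∑ a, ∑ b, (Q.gi a b * Q.d b f) • D a m = nab D (Q.grad f) m := by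
    simp only [nab, grad, up, Finset.sum_smul]
  have e2 : ∑ a, ∑ b, (Q.gi a b * Q.d a f) • D b m = nab D (Q.grad f) m := by
    rw [← e1, Finset.sum_comm]
    exact Finset.sum_congr rfl fun _ _ => Finset.sum_congr rfl fun _ _ => by rw [Q.gi_comm]
  rw [e1, e2]
  simp only [mul_comm f, mul_assoc]
  module

variable {k : Fin n → R} (hk : ∀ b (m : Md), ∑ a, k a • (D a (D b m) - D b (D a m)) = 0)

include hk

/-- By `hk` the curvature contracted with `k` vanishes, so only derivatives of the coefficients of
`k` appear. -/
lemma D_nab (b : Fin n) (m : Md) :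
    D b (nab D k m) = ∑ c, Q.d b (k c) • D c m + nab D k (D b m) := by
  have h := hk b m
  simp only [smul_sub, Finset.sum_sub_distrib] at h
  simp only [nab, map_sum, hD, Finset.sum_add_distrib]
  rw [sub_eq_zero.mp h]

lemma nab_nab (X : Fin n → R) (m : Md) : nab D X (nab D k m) - nab D k (nab D X m)
    = nab D (fun c => ∑ a, X a * Q.d a (k c) - ∑ a, k a * Q.d a (X c)) m := by
  have h1 : nab D X (nab D k m) = ∑ a, ∑ c, (X a * Q.d a (k c)) • D c m
      + ∑ a, X a • nab D k (D a m) := by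
    conv_lhs => rw [nab]
    simp only [D_nab hD hk, smul_add, Finset.sum_add_distrib, Finset.smul_sum, smul_smul]
  have h2 : nab D k (nab D X m) = ∑ c, ∑ a, (k a * Q.d a (X c)) • D c m
      + ∑ a, X a • nab D k (D a m) := by
    have : nab D k (nab D X m) = ∑ c, nab D k (X c • D c m) := by
      simp only [nab, map_sum, Finset.smul_sum]
      rw [Finset.sum_comm]
    rw [this]
    simp only [nab_smul hD, Finset.sum_add_distrib, vd, Finset.sum_smul]
  rw [h1, h2, Finset.sum_comm]
  simp only [nab, sub_smul, Finset.sum_smul, Finset.sum_sub_distrib]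
  abel

/-- In the commutator, `h1` handles the second order coefficients, `h2` the first order ones, and
`hk` removes curvature. -/
lemma lapM_nab {ν : R} (h1 : ∀ a b, Q.vd k (Q.gi a b) = ∑ c, Q.gi c b * Q.d c (k a)
      + ∑ c, Q.gi a c * Q.d c (k b) - 2 * ν * Q.gi a b)
    (h2 : ∀ c, ∑ a, ∑ b, Q.gi a b * Q.d a (Q.d b (k c)) - ∑ b, Q.γ b * Q.d b (k c)
      + Q.vd k (Q.γ c) = -(2 * ν * Q.γ c) + (2 - (n : R)) * Q.grad ν c) (m : Md) :
    Q.lapM D (nab D k m) = nab D k (Q.lapM D m) + (2 * ν) • Q.lapM D m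
      + (2 - (n : R)) • nab D (Q.grad ν) m := by
  have hDD : ∀ a b, D a (D b (nab D k m)) = ∑ c, Q.d a (Q.d b (k c)) • D c m
      + ∑ c, Q.d b (k c) • D a (D c m) + ∑ c, Q.d a (k c) • D c (D b m)
      + nab D k (D a (D b m)) := fun a b => by
    rw [D_nab hD hk, map_add, D_nab hD hk, map_sum]
    simp only [hD, Finset.sum_add_distrib]
    abel
  have e1 : ∑ a, ∑ b, Q.gi a b • nab D k (D a (D b m))
      = nab D k (∑ a, ∑ b, Q.gi a b • D a (D b m))
        - ∑ a, ∑ b, Q.vd k (Q.gi a b) • D a (D b m) := by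
    have hs : ∀ f : Fin n → Md, nab D k (∑ a, f a) = ∑ a, nab D k (f a) := fun f => by
      simp only [nab, map_sum, Finset.smul_sum]
      rw [Finset.sum_comm]
    simp only [hs, nab_smul hD, Finset.sum_add_distrib]
    abel
  have e2 : ∑ a, ∑ b, Q.vd k (Q.gi a b) • D a (D b m)
      = ∑ a, ∑ b, Q.gi a b • (∑ c, Q.d a (k c) • D c (D b m))
        + ∑ a, ∑ b, Q.gi a b • (∑ c, Q.d b (k c) • D a (D c m))
        - (2 * ν) • ∑ a, ∑ b, Q.gi a b • D a (D b m) := by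
    simp only [h1, sub_smul, add_smul, Finset.sum_smul, Finset.sum_add_distrib,
      Finset.sum_sub_distrib, Finset.smul_sum, smul_smul]
    congr 1
    congr 1
    · rw [Finset.sum_comm, Finset.sum_comm (f := fun a b => ∑ c, (Q.gi a b * Q.d a (k c)) • _)]
      refine Finset.sum_congr rfl fun b _ => ?_
      rw [Finset.sum_comm]
    · refine Finset.sum_congr rfl fun b _ => ?_
      rw [Finset.sum_comm]
  have e3 : nab D Q.γ (nab D k m) = nab D k (nab D Q.γ m)
      + nab D (fun c => ∑ b, Q.γ b * Q.d b (k c) - Q.vd k (Q.γ c)) m :=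
    eq_add_of_sub_eq' (nab_nab hD hk Q.γ m)
  have e4 : ∑ a, ∑ b, Q.gi a b • ∑ c, Q.d a (Q.d b (k c)) • D c m
      = nab D (fun c => ∑ a, ∑ b, Q.gi a b * Q.d a (Q.d b (k c))) m := by
    simp only [nab, Finset.sum_smul, Finset.smul_sum, smul_smul]
    symm
    rw [Finset.sum_comm]
    refine Finset.sum_congr rfl fun b _ => ?_
    rw [Finset.sum_comm]
  have e5 : nab D (fun c => ∑ a, ∑ b, Q.gi a b * Q.d a (Q.d b (k c))) m
      = nab D (fun c => ∑ b, Q.γ b * Q.d b (k c) - Q.vd k (Q.γ c)) m - (2 * ν) • nab D Q.γ m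
        + (2 - (n : R)) • nab D (Q.grad ν) m := by
    simp only [nab, Finset.smul_sum, smul_smul, ← Finset.sum_add_distrib, ← Finset.sum_sub_distrib,
      ← add_smul, ← sub_smul]
    refine Finset.sum_congr rfl fun c _ => ?_
    congr 1
    linear_combination h2 c
  rw [lapM_eq, lapM_eq, e3, nab_sub]
  simp only [hDD, smul_add, Finset.sum_add_distrib]
  rw [e4, e5, e1, e2]
  module

end Leibniz

/-- The operator `I^A 𝔻_A` of the scale `s` on tractors of weight `w`. -/
def op (E : Md →ₗ[R] Md) (s w : R) (m : Md) : Md :=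
  ((n : R) + 2 * w - 2) • ((w * Q.tau s) • m + nab D (Q.grad s) m)
    - s • (Q.lapM D m + (w * Q.J) • m + E m)

/-- The first order operator `k^a ∇_a - w ν`. -/
def kop (s t w : R) (m : Md) : Md := nab D (Q.kf s t) m - (w * Q.kν s t) • m

section Commutation

variable {Q D} (hn : 3 ≤ n) {s t : R} (hs : Q.IsAlmostEinstein s) (ht : Q.IsAlmostEinstein t)
  (hD : ∀ a (f : R) (m : Md), D a (f • m) = Q.d a f • m + f • D a m) (E : Md →ₗ[R] Md)

lemma nab_kf (m : Md) : nab D (Q.kf s t) m = t • nab D (Q.grad s) m - s • nab D (Q.grad t) m := by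
  simp only [nab, kf, sub_smul, Finset.sum_sub_distrib, Finset.smul_sum, smul_smul]

/-- The Laplacian, `J` and curvature terms are multiplied by the scale alone and cancel. The first
order rest has the factor `n + 2w - 2`, zero at the critical weight. -/
lemma op_sub_op (w : R) (m : Md) : t • Q.op D E s w m - s • Q.op D E t w m
    = ((n : R) + 2 * w - 2) • Q.kop D s t w m := by
  rw [op, op, kop, nab_kf, kν]
  module

include hn hD in
lemma op_smul_self (w : R) (m : Md) : Q.op D E s w (s • m) = s • Q.op D E s (w - 1) m
    + (((n : R) + 2 * w - 2) * (2 * s * Q.tau s + Q.ip s s)) • m := by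
  have : Q.vd (Q.grad s) s = Q.ip s s := rfl
  rw [op, op, nab_smul hD, lapM_smul hD, map_smul, this, lap_eq_tau Q hn]
  module

include hn hD in
-- The Leibniz rule, with `Δt` eliminated by `lap_eq_tau`. The zeroth order factor is `h(I,I')`; for
-- `t = s` the `kop` term vanishes, as in `op_smul_self`.
lemma op_smul (w : R) (m : Md) : Q.op D E s w (t • m) = t • Q.op D E s (w - 1) m
    + (((n : R) + 2 * w - 2) * (s * Q.tau t + t * Q.tau s + Q.ip s t)) • m
    + (2 : R) • Q.kop D s t (w - 1) m := by
  have : Q.vd (Q.grad s) t = Q.ip s t := rfl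
  rw [op, op, nab_smul hD, lapM_smul hD, map_smul, this, lap_eq_tau Q hn, kop, nab_kf, kν]
  module

variable (hk : ∀ b (m : Md), ∑ a, Q.kf s t a • (D a (D b m) - D b (D a m)) = 0)
  (hE : ∀ m, E (nab D (Q.kf s t) m) = nab D (Q.kf s t) (E m) + (2 * Q.kν s t) • E m)
  {w : R} (hw : ∀ a, Q.d a w = 0)

lemma vd_const_mul (hw : ∀ a, Q.d a w = 0) (X : Fin n → R) (f : R) :
    Q.vd X (w * f) = w * Q.vd X f := by
  rw [vd_mul]; simp [vd, hw]

lemma grad_const_mul (hw : ∀ a, Q.d a w = 0) (f : R) (a : Fin n) :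
    Q.grad (w * f) a = w * Q.grad f a := by
  simp only [grad, up, Derivation.leibniz, hw, smul_eq_mul, mul_zero, add_zero, Finset.mul_sum]
  exact Finset.sum_congr rfl fun _ _ => by ring

lemma lap_const_mul (hw : ∀ a, Q.d a w = 0) (f : R) : Q.lap (w * f) = w * Q.lap f := by
  simp only [lap, hess, Derivation.leibniz, hw, smul_eq_mul, mul_zero, add_zero, Finset.mul_sum,
    mul_sub]
  simp only [mul_left_comm w]

include hn hs ht hD hk hE hw

/-- `kop` acts as an infinitesimal conformal symmetry, so the commutator only sees the change of
`I`: a rotation in the plane of `I` and `I'`, with coefficients `h(I,I')` and `-h(I,I)`. -/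
lemma op_kop (m : Md) : Q.op D E s w (Q.kop D s t w m) - Q.kop D s t (w - 1) (Q.op D E s w m)
    = (s * Q.tau t + t * Q.tau s + Q.ip s t) • Q.op D E s w m
      - (2 * s * Q.tau s + Q.ip s s) • Q.op D E t w m := by
  have hd : ∀ a, Q.d a ((n : R) + 2 * w - 2) = 0 := fun a => by
    have e2 : Q.d a (2 : R) = 0 := by
      have := Derivation.map_natCast (Q.d a) 2
      exact_mod_cast this
    simp [hw, e2]
  have v1 : Q.vd (Q.kf s t) ((n : R) + 2 * w - 2) = 0 := by simp only [vd, hd]; simp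
  have b1 : nab D (fun c => ∑ a, Q.grad s a * Q.d a (Q.kf s t c)
      - ∑ a, Q.kf s t a * Q.d a (Q.grad s c)) m
      = (Q.kν s t + (s * Q.tau t + t * Q.tau s + Q.ip s t)) • nab D (Q.grad s) m
        - (2 * s * Q.tau s + Q.ip s s) • nab D (Q.grad t) m - s • nab D (Q.grad (Q.kν s t)) m := by
    simp only [nab, Finset.smul_sum, smul_smul, ← Finset.sum_sub_distrib, ← sub_smul]
    refine Finset.sum_congr rfl fun c _ => ?_
    congr 1
    rw [Finset.sum_sub_distrib]
    linear_combination bracket_kf hn hs ht c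
  have b2 := nab_nab hD hk (Q.grad s) m
  rw [b1, sub_eq_iff_eq_add] at b2
  have l1 := lapM_nab hD hk (killing hn hs ht) (second_deriv_kf hn hs ht) m
  have g1 : nab D (Q.grad (w * Q.kν s t)) m = w • nab D (Q.grad (Q.kν s t)) m := by
    simp only [nab, grad_const_mul hw, Finset.smul_sum, smul_smul]
  have h1 := vd_kf_self hn hs ht
  have h2 := vd_kf_tau hn hs ht
  have h3 := lap_kν hn hs ht
  simp only [kop, op, nab_sub, nab_add, nab_smul hD, lapM_sub, lapM_smul hD, map_sub, map_smul,
    vd_const_mul hw, lap_const_mul hw, g1, l1, b2, hE, h1, h3, v1, eq_sub_of_add_eq h2]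
  generalize nab D (Q.grad (Q.kν s t)) m = m1
  generalize Q.vd (Q.grad s) (Q.kν s t) = x1
  generalize Q.vd (Q.kf s t) Q.J = x2
  simp only [kν]
  module

/-- Compute `op_s (s • op_t m)` by `op_smul_self`, and again after replacing `s • op_t m` through
`op_sub_op`. The result is `s` times the commutator, and `s` is invertible. -/
lemma op_comm {v : R} (hv : s * v = 1) (m : Md) :
    Q.op D E s (w - 1) (Q.op D E t w m) = Q.op D E t (w - 1) (Q.op D E s w m) := by
  have hd : ∀ a, Q.d a ((n : R) + 2 * w - 2) = 0 := fun a => by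
    have e2 : Q.d a (2 : R) = 0 := by
      have := Derivation.map_natCast (Q.d a) 2
      exact_mod_cast this
    simp [hw, e2]
  have v1 : ∀ X : Fin n → R, Q.vd X ((n : R) + 2 * w - 2) = 0 := fun X => by
    simp only [vd, hd]; simp
  have hop : ∀ x : Md, Q.op D E s w (((n : R) + 2 * w - 2) • x)
      = ((n : R) + 2 * w - 2) • Q.op D E s w x := fun x => by
    have l1 : Q.lap ((n : R) + 2 * w - 2) = 0 := by simp [lap, hess, hd]
    have l2 : nab D (Q.grad ((n : R) + 2 * w - 2)) x = 0 := by simp [nab, grad, up, hd]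
    simp only [op, nab_smul hD, lapM_smul hD, map_smul, v1, l1, l2]
    module
  have hsub : ∀ x y : Md, Q.op D E s w (x - y) = Q.op D E s w x - Q.op D E s w y := fun x y => by
    simp only [op, nab_sub, lapM_sub, map_sub]
    module
  set X := Q.op D E s w m with hX
  set Y := Q.op D E t w m with hY
  have i1 : t • X - s • Y = ((n : R) + 2 * w - 2) • Q.kop D s t w m := op_sub_op E w m
  have i2 := op_sub_op (Q := Q) (D := D) (s := s) (t := t) E (w - 1) X
  have i3 := op_smul_self (Q := Q) hn hD (s := s) E w Y
  have i4 := op_smul (Q := Q) hn hD (s := s) (t := t) E w X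
  have i5 := op_kop hn hs ht hD E hk hE hw m
  have i6 : s • Y = t • X - ((n : R) + 2 * w - 2) • Q.kop D s t w m := by rw [← i1]; abel
  rw [i6, hsub, hop, i4] at i3
  rw [← hX, ← hY] at i5
  -- With `N = n + 2w - 2`, the products `h(I,I')`, `h(I,I)` cancel, and the remaining `(2 - N) •
  -- kop X` cancels against `(N - 2) • kop X` from `op_sub_op` at weight `w - 1`.
  have key : s • (Q.op D E s (w - 1) Y - Q.op D E t (w - 1) X) = 0 := by
    linear_combination (norm := module) i2 - i3 - ((n : R) + 2 * w - 2) • i5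
  have : (s * v) • (Q.op D E s (w - 1) Y - Q.op D E t (w - 1) X) = 0 := by
    rw [mul_comm, mul_smul, key, smul_zero]
  rw [hv, one_smul] at this
  exact sub_eq_zero.mp this

end Commutation

section Powers

variable {Q D} (E : Md →ₗ[R] Md)

variable (Q D) in
/-- The powers of `op`; each factor lowers the weight by `1`. -/
def opPow (s : R) : ℕ → R → Md → Md
  | 0, _, m => m
  | p + 1, w, m => opPow s p (w - 1) (Q.op D E s w m)

/-- `S` stands for the admissible weights, later those killed by the derivations. Commuting past `p`
factors lowers the weight at which `op_s` acts from `w` to `w - p`. -/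
lemma opPow_op {s t : R} (S : R → Prop) (hS : ∀ w, S w → S (w - 1))
    (hc : ∀ w, S w → ∀ m : Md,
      Q.op D E s (w - 1) (Q.op D E t w m) = Q.op D E t (w - 1) (Q.op D E s w m))
    (p : ℕ) : ∀ w, S w → ∀ m : Md, Q.opPow D E t p (w - 1) (Q.op D E s w m)
      = Q.op D E s (w - p) (Q.opPow D E t p w m) := by
  induction p with
  | zero => intro w _ m; simp [opPow]
  | succ p ih =>
    intro w hw m
    rw [opPow, opPow, ← hc w hw, ih (w - 1) (hS w hw)]
    congr 1
    push_cast; ring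

/-- Equality of the scaled powers of commuting operators at the critical weight. -/
lemma pow_smul_opPow {s t : R} (S : R → Prop) (hS : ∀ w, S w → S (w - 1))
    (hc : ∀ w, S w → ∀ m : Md,
      Q.op D E s (w - 1) (Q.op D E t w m) = Q.op D E t (w - 1) (Q.op D E s w m))
    (p : ℕ) : ∀ w, S w → (n : R) + 2 * w = 2 * p → ∀ m : Md,
      t ^ p • Q.opPow D E s p w m = s ^ p • Q.opPow D E t p w m := by
  induction p with
  | zero => intro w _ _ m; simp [opPow]
  | succ p ih =>
    intro w hw hp m
    -- The outermost of the `p + 1` factors acts at weight `w - p`, exactly where the right side of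
    -- `op_sub_op` vanishes.
    have h0 : (n : R) + 2 * (w - p) - 2 = 0 := by push_cast at hp; linear_combination hp
    have h1 := op_sub_op (Q := Q) (D := D) (s := s) (t := t) E (w - p) (Q.opPow D E t p w m)
    rw [h0, zero_smul, sub_eq_zero] at h1
    -- The inner `op_s` is moved outside the `p` factors `op_t` and traded there for `op_t`; the
    -- trivial case `s = t` of `opPow_op` reassembles the power.
    rw [opPow, pow_succ', mul_smul, ih (w - 1) (hS w hw) (by push_cast at hp; linear_combination hp),
      opPow_op E S hS hc p w hw, smul_comm, h1, opPow,
      opPow_op E S hS (fun _ _ _ => rfl) p w hw, smul_smul, ← pow_succ]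

end Powers

end AlgMetric
end Tractor

/-! ### Cotton and Bach tensors in an Einstein scale. -/

namespace Tractor
namespace AlgMetric

variable {n : ℕ} {R : Type*} [CommRing R] [Algebra ℝ R] {Q : AlgMetric n R}

section Bach

variable (hn : 3 ≤ n) {s : R} (hs : Q.IsAlmostEinstein s)

lemma sum_weylLow_grad (f : R) (a b c : Fin n) :
    ∑ m, Q.weylLow m a b c * Q.grad f m = ∑ m, Q.weyl b c m a * Q.d m f := by
  simp only [grad, up, ← sum_gi_weylLow, Finset.mul_sum, Finset.sum_mul]
  rw [Finset.sum_comm]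
  exact Finset.sum_congr rfl fun _ _ => Finset.sum_congr rfl fun _ _ => by
    rw [Q.gi_comm, Q.weylLow_pair]; ring

include hn hs in
lemma cot_mul_self (a b c : Fin n) : Q.cot a b c * s = ∑ m, Q.weylLow m a b c * Q.grad s m := by
  rw [sum_weylLow_grad, hs.cot_mul hn]

include hn hs in
lemma sum_gi_cot_mul (a e b : Fin n) :
    (∑ c, Q.gi e c * Q.cot a c b) * s = ∑ m, Q.weyl m a e b * Q.grad s m := by
  simp only [← sum_gi_weylLow, Finset.sum_mul, mul_assoc, cot_mul_self hn hs, Finset.mul_sum]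
  rw [Finset.sum_comm]

variable (Q) in
/-- `∇_e T_a{}^e{}_b`. -/
def div3 (T : Fin n → Fin n → Fin n → R) (a b : Fin n) : R :=
  ∑ e, (Q.d e (T a e b) + ∑ m, (Q.Γ e e m * T a m b - Q.Γ m e a * T m e b - Q.Γ m e b * T a e m))

lemma div3_raise (T : Fin n → Fin n → Fin n → R) (a b : Fin n) :
    Q.div3 (fun a e b => ∑ c, Q.gi e c * T a c b) a b = ∑ c, ∑ e, Q.gi c e * (Q.d e (T a c b)
      - ∑ m, (Q.Γ m e a * T m c b + Q.Γ m e c * T a m b + Q.Γ m e b * T a c m)) := by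
  rw [Finset.sum_comm, div3]
  refine Finset.sum_congr rfl fun e _ => ?_
  simp only [map_sum, Derivation.leibniz, d_gi, smul_eq_mul, Finset.sum_add_distrib,
    Finset.sum_sub_distrib, mul_sub, mul_add, Finset.mul_sum, mul_neg, Finset.sum_neg_distrib]
  have t1 : ∑ x, ∑ y, T a x b * (Q.Γ x e y * Q.gi e y)
      = ∑ x, ∑ y, Q.gi x e * (Q.Γ y e x * T a y b) := by
    rw [Finset.sum_comm]
    exact Finset.sum_congr rfl fun _ _ => Finset.sum_congr rfl fun _ _ => by rw [Q.gi_comm e]; ring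
  have t2 : ∑ x, ∑ y, T a x b * (Q.Γ e e y * Q.gi y x)
      = ∑ x, ∑ y, Q.Γ e e x * (Q.gi x y * T a y b) := by
    rw [Finset.sum_comm]
    exact Finset.sum_congr rfl fun _ _ => Finset.sum_congr rfl fun _ _ => by ring
  have t3 : ∑ x, ∑ y, Q.Γ x e a * (Q.gi e y * T x y b)
      = ∑ x, ∑ y, Q.gi x e * (Q.Γ y e a * T y x b) := by
    rw [Finset.sum_comm]
    exact Finset.sum_congr rfl fun _ _ => Finset.sum_congr rfl fun _ _ => by rw [Q.gi_comm e]; ring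
  have t4 : ∑ x, ∑ y, Q.Γ x e b * (Q.gi e y * T a y x)
      = ∑ x, ∑ y, Q.gi x e * (Q.Γ y e b * T a x y) := by
    rw [Finset.sum_comm]
    exact Finset.sum_congr rfl fun _ _ => Finset.sum_congr rfl fun _ _ => by rw [Q.gi_comm e]; ring
  have t5 : ∑ x, Q.gi e x * Q.d e (T a x b) = ∑ x, Q.gi x e * Q.d e (T a x b) :=
    Finset.sum_congr rfl fun _ _ => by rw [Q.gi_comm]
  rw [t1, t2, t3, t4, t5]
  ring

lemma div3_mul (T : Fin n → Fin n → Fin n → R) (f : R) (a b : Fin n) :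
    Q.div3 (fun a e b => T a e b * f) a b = Q.div3 T a b * f + ∑ e, T a e b * Q.d e f := by
  simp only [div3, Finset.sum_mul, ← Finset.sum_add_distrib]
  refine Finset.sum_congr rfl fun e _ => ?_
  rw [Derivation.leibniz, add_mul, Finset.sum_mul]
  simp only [smul_eq_mul]
  have : ∑ m, (Q.Γ e e m * (T a m b * f) - Q.Γ m e a * (T m e b * f) - Q.Γ m e b * (T a e m * f))
      = ∑ m, (Q.Γ e e m * T a m b - Q.Γ m e a * T m e b - Q.Γ m e b * T a e m) * f :=
    Finset.sum_congr rfl fun _ _ => by ring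
  rw [this]
  ring

lemma div3_contract (T : Fin n → Fin n → Fin n → Fin n → R) (X : Fin n → R) (a b : Fin n) :
    Q.div3 (fun a e b => ∑ m, T m a e b * X m) a b
      = ∑ m, Q.div4 T m a b * X m + ∑ e, ∑ m, T m a e b * Q.covV X e m := by
  simp only [div3, div4, covV, map_sum, Derivation.leibniz, smul_eq_mul, mul_add,
    Finset.sum_add_distrib, Finset.sum_sub_distrib, Finset.sum_mul, Finset.mul_sum, add_mul, sub_mul]
  have s1 : ∀ f : Fin n → Fin n → Fin n → R,
      ∑ m, ∑ b, ∑ e, f m b e = ∑ b, ∑ e, ∑ m, f m b e := fun f => by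
    rw [Finset.sum_comm]
    exact Finset.sum_congr rfl fun b _ => Finset.sum_comm
  have t1 : ∑ x, ∑ y, Q.d y (T x a y b) * X x = ∑ x, ∑ y, X y * Q.d x (T y a x b) := by
    rw [Finset.sum_comm]
    exact Finset.sum_congr rfl fun _ _ => Finset.sum_congr rfl fun _ _ => by ring
  have t2 : ∑ x, ∑ y, ∑ z, Q.Γ y y z * T x a z b * X x
      = ∑ x, ∑ y, ∑ z, Q.Γ x x y * (T z a y b * X z) := by
    rw [s1]
    exact Finset.sum_congr rfl fun _ _ => Finset.sum_congr rfl fun _ _ =>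
      Finset.sum_congr rfl fun _ _ => by ring
  have t3 : ∑ x, ∑ y, ∑ z, Q.Γ z y b * T x a y z * X x
      = ∑ x, ∑ y, ∑ z, Q.Γ y x b * (T z a x y * X z) := by
    rw [s1]
    exact Finset.sum_congr rfl fun _ _ => Finset.sum_congr rfl fun _ _ =>
      Finset.sum_congr rfl fun _ _ => by ring
  have t4 : ∑ x, ∑ y, ∑ z, Q.Γ z y a * T x z y b * X x
      = ∑ x, ∑ y, ∑ z, Q.Γ y x a * (T z y x b * X z) := by
    rw [s1]
    exact Finset.sum_congr rfl fun _ _ => Finset.sum_congr rfl fun _ _ =>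
      Finset.sum_congr rfl fun _ _ => by ring
  have t5 : ∑ x, ∑ y, ∑ z, Q.Γ z y x * T z a y b * X x
      = ∑ x, ∑ y, ∑ z, T y a x b * (Q.Γ y x z * X z) := by
    rw [Finset.sum_comm]
    refine Finset.sum_congr rfl fun _ _ => ?_
    rw [Finset.sum_comm]
    exact Finset.sum_congr rfl fun _ _ => Finset.sum_congr rfl fun _ _ => by ring
  rw [t1, t2, t3, t4, t5]
  ring

lemma sum_PUp_weylLow (a b : Fin n) :
    ∑ c, ∑ e, Q.PUp e c * Q.weylLow e a c b = ∑ e, ∑ m, Q.weyl m a e b * Q.Pm e m := by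
  rw [Finset.sum_comm, Finset.sum_comm (f := fun e m => Q.weyl m a e b * Q.Pm e m)]
  refine Finset.sum_congr rfl fun e _ => ?_
  simp only [← sum_gi_weylLow, PUp, Finset.sum_mul, Pm, Finset.mul_sum]
  have s1 : ∀ f : Fin n → Fin n → Fin n → R,
      ∑ m, ∑ b, ∑ e, f m b e = ∑ e, ∑ b, ∑ m, f m b e := fun f => by
    rw [Finset.sum_comm]
    conv_rhs => rw [Finset.sum_comm]
    exact Finset.sum_congr rfl fun b _ => Finset.sum_comm
  rw [s1]
  refine Finset.sum_congr rfl fun x _ => Finset.sum_congr rfl fun y _ =>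
    Finset.sum_congr rfl fun z _ => ?_
  rw [Q.gi_comm z x, Q.gi_comm e y, Q.P_symm y x]; ring

include hn hs in
-- Substituting `A = s⁻¹ C·∇s` turns both sides into Weyl contracted twice with `∇s`, symmetric by
-- pair symmetry.
lemma sum_grad_cot_symm {v : R} (hv : s * v = 1) (a b : Fin n) :
    ∑ m, Q.grad s m * Q.cot b m a = ∑ m, Q.grad s m * Q.cot a m b := by
  have h : ∀ a b, ∑ m, Q.grad s m * Q.cot b m a
      = v * ∑ m, ∑ p, Q.grad s m * Q.weylLow p b m a * Q.grad s p := fun a b => by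
    rw [Finset.mul_sum]
    refine Finset.sum_congr rfl fun m _ => ?_
    have := cot_mul_self hn hs b m a
    simp only [mul_assoc, ← Finset.mul_sum, ← this]
    linear_combination -(Q.grad s m * Q.cot b m a) * hv
  rw [h, h, Finset.sum_comm]
  congr 1
  exact Finset.sum_congr rfl fun m _ => Finset.sum_congr rfl fun p _ => by
    rw [Q.weylLow_pair]; ring

include hn hs in
-- Take the divergence of `s A = C·∇s`. The left gives `s ∇·A + A·∇s`; the right gives `(n - 3) A·∇s
-- - s P·C`, the `τ` part of the Hessian dropping out by trace-freeness.
lemma bach_mul {v : R} (hv : s * v = 1) (a b : Fin n) :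
    Q.bachT a b * s = ((n : R) - 4) * ∑ m, Q.grad s m * Q.cot a m b := by
  have h1 := congrArg (fun T => Q.div3 T a b) (funext fun a => funext fun e => funext fun b =>
    sum_gi_cot_mul hn hs a e b : (fun a e b => (∑ c, Q.gi e c * Q.cot a c b) * s)
      = fun a e b => ∑ m, Q.weyl m a e b * Q.grad s m)
  simp only [div3_mul, div3_contract, Q.div_weyl_eq hn, hs.covV_grad] at h1
  rw [div3_raise] at h1
  have e1 : ∑ e, ∑ m, Q.weyl m a e b * (-(Q.Pm e m * s) - (if e = m then 1 else 0) * Q.tau s)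
      = -(∑ c, ∑ e, Q.PUp e c * Q.weylLow e a c b) * s := by
    have : ∀ e m, Q.weyl m a e b * (-(Q.Pm e m * s) - (if e = m then 1 else 0) * Q.tau s)
        = -(Q.weyl m a e b * Q.Pm e m * s)
          - (if e = m then 1 else 0) * (Q.weyl m a e b * Q.tau s) := fun e m => by ring
    simp only [this, Finset.sum_sub_distrib, Finset.sum_neg_distrib, sum_PUp_weylLow, neg_mul,
      Finset.sum_mul]
    simp [← Finset.sum_mul, Q.weyl_trace hn]
  have e2 : ∑ e, (∑ c, Q.gi e c * Q.cot a c b) * Q.d e s = ∑ m, Q.grad s m * Q.cot a m b := by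
    simp only [Finset.sum_mul, grad, up]
    rw [Finset.sum_comm]
    exact Finset.sum_congr rfl fun _ _ => Finset.sum_congr rfl fun _ _ => by rw [Q.gi_comm]; ring
  have e3 : ∑ m, ((n : R) - 3) * Q.cot b m a * Q.grad s m
      = ((n : R) - 3) * ∑ m, Q.grad s m * Q.cot a m b := by
    rw [← sum_grad_cot_symm hn hs hv, Finset.mul_sum]
    exact Finset.sum_congr rfl fun _ _ => by ring
  rw [e1, e2, e3] at h1
  simp only [bachT, covCot, Finset.sum_add_distrib] at h1 ⊢
  linear_combination h1

end Bach

end AlgMetric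
end Tractor

/-! ### The action on tractor tensors; Lie derivatives along `k` of the curvature data. -/

namespace Tractor

section Action

variable {n r : ℕ} {R : Type*} [CommRing R] [Algebra ℝ R] {κ : Type*} [Fintype κ] [DecidableEq κ]

/-- The action of endomorphisms on covariant tensors of rank `r`. -/
def act : Matrix κ κ R →ₗ[R] ((Fin r → κ) → R) →ₗ[R] ((Fin r → κ) → R) :=
  LinearMap.mk₂ R (fun S V I => ∑ k, ∑ K, S (I k) K * V (Function.update I k K))
    (fun S T V => by
      funext I; simp [add_mul, Finset.sum_add_distrib])
    (fun c S V => by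
      funext I; simp [Finset.mul_sum, mul_assoc])
    (fun S V W => by
      funext I; simp [mul_add, Finset.sum_add_distrib])
    (fun c S V => by
      funext I; simp [Finset.mul_sum, mul_left_comm])

lemma act_apply (S : Matrix κ κ R) (V : (Fin r → κ) → R) (I : Fin r → κ) :
    act S V I = ∑ k, ∑ K, S (I k) K * V (Function.update I k K) := rfl

/-- Two actions on the same slot compose to the matrix product. The part on different slots is
symmetric in `S` and `T`, so it disappears in `act_comm`. -/
lemma act_act_apply (S T : Matrix κ κ R) (V : (Fin r → κ) → R) (I : Fin r → κ) :
    act S (act T V) I = act (S * T) V I + ∑ k, ∑ l, if l = k then 0 else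
      ∑ K, ∑ L, S (I k) K * T (I l) L * V (Function.update (Function.update I k K) l L) := by
  simp only [act_apply, Finset.mul_sum, Matrix.mul_apply, Finset.sum_mul]
  rw [← Finset.sum_add_distrib]
  refine Finset.sum_congr rfl fun k _ => ?_
  rw [Finset.sum_comm, ← Finset.add_sum_erase _ _ (Finset.mem_univ k),
    ← Finset.add_sum_erase (a := k) (s := Finset.univ) (f := fun l => if l = k then 0 else _)
      (Finset.mem_univ k)]
  simp only [if_true, zero_add]
  congr 1
  · rw [Finset.sum_comm]
    simp [mul_assoc]
  · refine Finset.sum_congr rfl fun l hl => ?_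
    have hl' : l ≠ k := Finset.ne_of_mem_erase hl
    simp [hl', mul_assoc]

lemma act_comm (S T : Matrix κ κ R) (V : (Fin r → κ) → R) :
    act S (act T V) - act T (act S V) = act (S * T - T * S) V := by
  funext I
  rw [Pi.sub_apply, act_act_apply, act_act_apply, map_sub, LinearMap.sub_apply, Pi.sub_apply]
  have : ∑ k, ∑ l, (if l = k then 0 else ∑ K, ∑ L, S (I k) K * T (I l) L
        * V (Function.update (Function.update I k K) l L))
      = ∑ k, ∑ l, (if l = k then 0 else ∑ K, ∑ L, T (I k) K * S (I l) L
        * V (Function.update (Function.update I k K) l L)) := by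
    rw [Finset.sum_comm]
    refine Finset.sum_congr rfl fun k _ => Finset.sum_congr rfl fun l _ => ?_
    by_cases h : l = k
    · simp [h]
    · rw [if_neg h, if_neg (Ne.symm h), Finset.sum_comm]
      refine Finset.sum_congr rfl fun K _ => Finset.sum_congr rfl fun L _ => ?_
      rw [Function.update_comm h]; ring
  rw [this]; ring

/-- The connection on covariant tensors of rank `r` induced by connection matrices. -/
def tensD (d : Fin n → Derivation ℝ R R) (A : Fin n → Matrix κ κ R) (a : Fin n) :
    ((Fin r → κ) → R) →+ ((Fin r → κ) → R) where
  toFun V := (fun I => d a (V I)) + act (A a) V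
  map_zero' := by
    funext I; simp
  map_add' V W := by
    rw [map_add]; funext I; simp only [Pi.add_apply, map_add]; ring

variable (d : Fin n → Derivation ℝ R R) (A : Fin n → Matrix κ κ R)

lemma tensD_apply (a : Fin n) (V : (Fin r → κ) → R) :
    tensD d A a V = (fun I => d a (V I)) + act (A a) V := rfl

lemma tensD_smul (a : Fin n) (f : R) (V : (Fin r → κ) → R) :
    tensD d A a (f • V) = d a f • V + f • tensD d A a V := by
  rw [tensD_apply, tensD_apply, map_smul]
  funext I
  simp only [Pi.add_apply, Pi.smul_apply, Derivation.leibniz, smul_eq_mul]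
  ring

lemma d_act (a : Fin n) (S : Matrix κ κ R) (V : (Fin r → κ) → R) :
    (fun I => d a (act S V I)) = act (matD (d a) S) V + act S (fun I => d a (V I)) := by
  funext I
  simp only [act_apply, map_sum, Derivation.leibniz, smul_eq_mul, Finset.sum_add_distrib,
    Pi.add_apply, matD_apply]
  rw [add_comm]
  congr 1
  exact Finset.sum_congr rfl fun _ _ => Finset.sum_congr rfl fun _ _ => mul_comm _ _

lemma tensD_act (a : Fin n) (S : Matrix κ κ R) (V : (Fin r → κ) → R) :
    tensD d A a (act S V) = act S (tensD d A a V) + act (endD d A a S) V := by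
  have h := act_comm (A a) S V
  rw [tensD_apply, tensD_apply, d_act, endD, map_add, map_add, LinearMap.add_apply, ← h]
  abel

lemma tensD_comm (hd : ∀ i j f, d i (d j f) = d j (d i f)) (a b : Fin n) (V : (Fin r → κ) → R) :
    tensD d A a (tensD d A b V) - tensD d A b (tensD d A a V) = act (curv d A a b) V := by
  have h := act_comm (A a) (A b) V
  have e : ∀ a b, tensD d A a (tensD d A b V) = (fun I => d a (d b (V I)))
      + act (A a) (fun I => d b (V I)) + (act (matD (d a) (A b)) V + act (A b) (fun I => d a (V I)))
      + act (A a) (act (A b) V) := fun a b => by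
    rw [tensD_apply, tensD_apply, ← d_act, map_add]
    funext I
    simp only [Pi.add_apply, map_add]
    ring
  have hd' : (fun I => d a (d b (V I))) = fun I => d b (d a (V I)) := funext fun I => hd _ _ _
  rw [e, e, hd', curv, map_add, map_sub, LinearMap.add_apply, LinearMap.sub_apply, ← h]
  abel

end Action

namespace AlgMetric

variable {n r : ℕ} {R : Type*} [CommRing R] [Algebra ℝ R] {Q : AlgMetric n R}

variable (Q) in
/-- The covector `Z_B^b - u^b X_B`. -/
def zv (u : Fin n → R) (b : Fin n) : TIdx n → R
  | .inl _ => 0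
  | .inr (.inl e) => if e = b then 1 else 0
  | .inr (.inr _) => -u b

variable (Q) in
/-- The vector obtained from `Z_A^a - u^a X_A` by raising the tractor index. -/
def zd (u : Fin n → R) (a : Fin n) : TIdx n → R
  | .inl _ => -u a
  | .inr (.inl e) => Q.gi a e
  | .inr (.inr _) => 0

variable (Q) in
/-- The endomorphism with components `(Z_B^b - u^b X_B) (Z^{Aa} - u^a X^A)`. -/
def zz (u : Fin n → R) (a b : Fin n) : Matrix (TIdx n) (TIdx n) R :=
  Matrix.of fun B A => zv u b B * Q.zd u a A

variable (Q) in
/-- The curvature term of the operator `𝔻`, in terms of an Einstein scale. -/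
def curvTerm (u : Fin n → R) : ((Fin r → TIdx n) → R) →ₗ[R] ((Fin r → TIdx n) → R) :=
  -∑ a, ∑ b, act (Q.zz u a b) ∘ₗ act (Q.tcurv a b)

lemma curvTerm_apply (u : Fin n → R) (V : (Fin r → TIdx n) → R) :
    Q.curvTerm u V = -∑ a, ∑ b, act (Q.zz u a b) (act (Q.tcurv a b) V) := by
  simp [curvTerm, LinearMap.neg_apply, LinearMap.sum_apply]

lemma tcurv_swap (a b : Fin n) : Q.tcurv b a = -Q.tcurv a b := by
  rw [← curv_tconn, ← curv_tconn, curv_swap]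

section TwoScales

variable (hn : 3 ≤ n) {s t v : R} (hs : Q.IsAlmostEinstein s) (ht : Q.IsAlmostEinstein t)
  (hv : s * v = 1)

include hn hs ht hv

/-- Cartan's formula: `Ω` is closed by the Bianchi identity and `k` contracts it to zero, so its Lie
derivative along `k` vanishes. -/
lemma lie_tcurv (a b : Fin n) : ∑ c, Q.kf s t c • endD Q.d Q.tconn c (Q.tcurv a b)
    = -∑ c, Q.d a (Q.kf s t c) • Q.tcurv c b - ∑ c, Q.d b (Q.kf s t c) • Q.tcurv a c := by
  have h : ∀ a b, ∑ c, Q.kf s t c • endD Q.d Q.tconn a (Q.tcurv c b)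
      = -∑ c, Q.d a (Q.kf s t c) • Q.tcurv c b := fun a b => by
    have h0 := sum_kf_tcurv hn hs ht hv b
    have h1 := congrArg (endD Q.d Q.tconn a) h0
    have z : endD Q.d Q.tconn a (0 : Matrix (TIdx n) (TIdx n) R) = 0 := by
      rw [endD, mul_zero, zero_mul, sub_zero, add_zero]; ext; simp
    have e : endD Q.d Q.tconn a (∑ c, Q.kf s t c • Q.tcurv c b)
        = ∑ c, Q.d a (Q.kf s t c) • Q.tcurv c b
          + ∑ c, Q.kf s t c • endD Q.d Q.tconn a (Q.tcurv c b) := by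
      have m : matD (Q.d a) (∑ c, Q.kf s t c • Q.tcurv c b)
          = ∑ c, Q.d a (Q.kf s t c) • Q.tcurv c b + ∑ c, Q.kf s t c • matD (Q.d a) (Q.tcurv c b) := by
        ext I K
        simp only [matD_apply, Matrix.sum_apply, Matrix.add_apply, Matrix.smul_apply, smul_eq_mul,
          map_sum, Derivation.leibniz, Finset.sum_add_distrib]
        rw [add_comm]
        congr 1
        exact Finset.sum_congr rfl fun _ _ => mul_comm _ _
      simp only [endD, m, Finset.mul_sum, Finset.sum_mul, Matrix.mul_smul, Matrix.smul_mul,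
        smul_add, smul_sub, Finset.sum_add_distrib, Finset.sum_sub_distrib]
      abel
    rw [z, e] at h1
    exact eq_neg_of_add_eq_zero_right h1
  have hb : ∀ c, endD Q.d Q.tconn c (Q.tcurv a b) = endD Q.d Q.tconn a (Q.tcurv c b)
      - endD Q.d Q.tconn b (Q.tcurv c a) := fun c => by
    have := bianchi Q.d Q.d_comm Q.tconn a b c
    simp only [curv_tconn] at this
    rw [tcurv_swap c b] at this
    have n1 : endD Q.d Q.tconn a (-Q.tcurv c b) = -endD Q.d Q.tconn a (Q.tcurv c b) := by
      rw [endD, endD, matD_neg]; noncomm_ring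
    rw [n1] at this
    rw [← sub_eq_zero, ← this]
    abel
  simp only [hb, smul_sub, Finset.sum_sub_distrib, h]
  have : ∑ c, Q.d b (Q.kf s t c) • Q.tcurv a c = -∑ c, Q.d b (Q.kf s t c) • Q.tcurv c a := by
    rw [← Finset.sum_neg_distrib]
    exact Finset.sum_congr rfl fun c _ => by rw [tcurv_swap c a, smul_neg]
  rw [this]

lemma d_u (c b : Fin n) : Q.d c (v * Q.grad s b) =
    -(v * (v * Q.d c s) * Q.grad s b) - Q.Pm c b - (if c = b then 1 else 0) * (v * Q.tau s)
      - v * ∑ m, Q.Γ b c m * Q.grad s m := by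
  rw [Derivation.leibniz, Q.d_inv hv, d_eq_covV, hs.covV_grad]
  simp only [smul_eq_mul]
  linear_combination -Q.Pm c b * hv

/-- What matters is that the result is a multiple of `k^b`: such terms vanish once contracted with
`Ω`. -/
lemma lie_u (b : Fin n) : -∑ c, Q.kf s t c * (Q.d c (v * Q.grad s b) + Q.Pm c b)
      + ∑ c, Q.d c (Q.kf s t b) * (v * Q.grad s c) - Q.kν s t * (v * Q.grad s b)
    = Q.kf s t b * (v * (Q.tau s + v * Q.ip s s)) := by
  have e1 : ∑ c, Q.kf s t c * (Q.d c (v * Q.grad s b) + Q.Pm c b)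
      = -(v * v * Q.grad s b * Q.vd (Q.kf s t) s) - Q.kf s t b * (v * Q.tau s)
        - v * ∑ c, Q.kf s t c * ∑ m, Q.Γ b c m * Q.grad s m := by
    have : ∀ c, Q.kf s t c * (Q.d c (v * Q.grad s b) + Q.Pm c b)
        = -(v * v * Q.grad s b * (Q.kf s t c * Q.d c s))
          - (if c = b then 1 else 0) * (Q.kf s t c * (v * Q.tau s))
          - v * (Q.kf s t c * ∑ m, Q.Γ b c m * Q.grad s m) := fun c => by
      rw [d_u hn hs ht hv]; ring
    simp only [this, Finset.sum_sub_distrib, Finset.sum_neg_distrib, ← Finset.mul_sum, vd]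
    simp
  have e2 : ∑ c, Q.d c (Q.kf s t b) * (v * Q.grad s c) = v * (Q.grad s b * Q.ip s t
      - Q.grad t b * Q.ip s s + Q.kν s t * Q.grad s b
      - ∑ c, Q.kf s t c * ∑ m, Q.Γ b c m * Q.grad s m) := by
    have f1 : ∑ c, Q.grad s c * ∑ m, Q.Γ b c m * Q.kf s t m
        = ∑ c, Q.kf s t c * ∑ m, Q.Γ b c m * Q.grad s m := by
      simp only [Finset.mul_sum]
      rw [Finset.sum_comm]
      exact Finset.sum_congr rfl fun _ _ => Finset.sum_congr rfl fun _ _ => by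
        rw [Q.Γ_symm]; ring
    rw [← f1]
    have : ∀ c, Q.d c (Q.kf s t b) * (v * Q.grad s c)
        = v * (Q.grad s b * (Q.grad s c * Q.d c t) - Q.grad t b * (Q.grad s c * Q.d c s)
          + (if c = b then 1 else 0) * (Q.kν s t * Q.grad s c)
          - Q.grad s c * ∑ m, Q.Γ b c m * Q.kf s t m) := fun c => by
      rw [d_eq_covV, covV_kf hn hs ht]; ring
    simp only [this, ← Finset.mul_sum, Finset.sum_add_distrib, Finset.sum_sub_distrib, ip]
    simp
  rw [e1, e2, vd_kf_self hn hs ht, kf]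
  linear_combination v * Q.ip s s * Q.grad t b * hv - v * Q.ip s t * Q.grad s b * hv

lemma kf_low (e : Fin n) : ∑ c, Q.kf s t c * Q.g c e = t * Q.d e s - s * Q.d e t := by
  have h : ∀ f, ∑ c, Q.grad f c * Q.g c e = Q.d e f := fun f => by
    have h := Q.sum_g_up (fun b => Q.d b f) e
    have h' : ∑ c, Q.grad f c * Q.g c e = ∑ b, Q.g e b * Q.up (fun b => Q.d b f) b :=
      Finset.sum_congr rfl fun c _ => by rw [Q.g_comm, mul_comm]; rfl
    rw [h', h]
  simp only [kf, sub_mul, Finset.sum_sub_distrib, mul_assoc, ← Finset.mul_sum, h]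

/-- The derivative of `Z - uX` along `k` consists of the Lie term of the index `b`, a weight term in
`ν`, and a term proportional to `k^b` that `Ω` will kill. -/
lemma lie_zv (b : Fin n) (B : TIdx n) :
    ∑ c, Q.kf s t c * (Q.d c (zv (fun a => v * Q.grad s a) b B)
        + ∑ K, Q.tconn c B K * zv (fun a => v * Q.grad s a) b K)
      = ∑ c, Q.d c (Q.kf s t b) * zv (fun a => v * Q.grad s a) c B
        - Q.kν s t * zv (fun a => v * Q.grad s a) b B
        + Q.kf s t b * (match B with
          | .inl _ => -1
          | .inr (.inl e) => -(v * Q.d e s)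
          | .inr (.inr _) => v * (Q.tau s + v * Q.ip s s)) := by
  rcases B with _ | e | _
  · simp [tconn, zv]
  · simp only [sum_TIdx, tconn, zv]
    have e1 := covV_kf hn hs ht e b
    have e2 := kf_low hn hs ht hv e
    have f1 : ∑ x, Q.kf s t x * (Q.g x e * (v * Q.grad s b))
        = (∑ x, Q.kf s t x * Q.g x e) * (v * Q.grad s b) := by
      rw [Finset.sum_mul]
      exact Finset.sum_congr rfl fun _ _ => by ring
    have f2 : ∑ x, Q.kf s t x * Q.Γ b x e = ∑ m, Q.Γ b e m * Q.kf s t m :=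
      Finset.sum_congr rfl fun _ _ => by rw [Q.Γ_symm]; ring
    rw [covV] at e1
    simp [apply_ite, mul_add, Finset.sum_add_distrib, f1, f2, e2]
    rw [eq_sub_of_add_eq e1, kf]
    by_cases h : e = b
    · simp only [h, if_true]
      linear_combination (Q.d b t * Q.grad s b - Q.d b s * Q.grad t b) * hv
    · simp only [h, if_false]
      linear_combination (Q.d e t * Q.grad s b - Q.d e s * Q.grad t b) * hv
  · have := lie_u hn hs ht hv b
    simp only [sum_TIdx, tconn, zv]
    simp [mul_add, Finset.sum_add_distrib] at this ⊢
    linear_combination this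

lemma lie_zd (a : Fin n) (A : TIdx n) :
    ∑ c, Q.kf s t c * (Q.d c (Q.zd (fun a => v * Q.grad s a) a A)
        - ∑ K, Q.zd (fun a => v * Q.grad s a) a K * Q.tconn c K A)
      = ∑ c, Q.d c (Q.kf s t a) * Q.zd (fun a => v * Q.grad s a) c A
        - Q.kν s t * Q.zd (fun a => v * Q.grad s a) a A
        + Q.kf s t a * (match A with
          | .inl _ => v * (Q.tau s + v * Q.ip s s)
          | .inr (.inl e) => -(v * Q.grad s e)
          | .inr (.inr _) => -1) := by
  rcases A with _ | e | _
  · have := lie_u hn hs ht hv a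
    have e1 : ∀ c, ∑ x, Q.gi a x * Q.P c x = Q.Pm c a := fun c =>
      Finset.sum_congr rfl fun _ _ => by rw [Q.gi_comm, mul_comm]
    simp only [sum_TIdx, tconn, zd]
    simp [mul_add, mul_sub, Finset.sum_add_distrib, Finset.sum_sub_distrib, e1] at this ⊢
    linear_combination this
  · simp only [sum_TIdx, tconn, zd]
    have e1 := killing hn hs ht a e
    have e2 : ∑ c, Q.gi a c * Q.covV (Q.kf s t) c e = Q.grad t a * Q.grad s e
        - Q.grad s a * Q.grad t e + Q.gi a e * Q.kν s t := by
      simp only [covV_kf hn hs ht, mul_add, mul_sub, Finset.sum_add_distrib,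
        Finset.sum_sub_distrib, ← mul_assoc, ← Finset.sum_mul, sum_gi_d]
      simp
    have e3 : ∑ c, Q.kf s t c * ∑ m, Q.gi a m * Q.Γ e c m
        = ∑ c, Q.gi a c * ∑ m, Q.Γ e c m * Q.kf s t m := by
      simp only [Finset.mul_sum]
      rw [Finset.sum_comm]
      exact Finset.sum_congr rfl fun _ _ => Finset.sum_congr rfl fun _ _ => by
        rw [Q.Γ_symm]; ring
    simp only [vd] at e1
    simp only [covV, mul_add, Finset.sum_add_distrib] at e2
    simp [mul_add, mul_sub, Finset.sum_add_distrib, Finset.sum_sub_distrib, e1, e3]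
    simp only [mul_comm (Q.d _ _) (Q.gi _ _)]
    rw [eq_sub_of_add_eq e2]
    simp only [kf]
    linear_combination (Q.grad s a * Q.grad t e - Q.grad t a * Q.grad s e) * hv
  · simp only [sum_TIdx, tconn, zd]
    have e1 : ∀ c, ∑ x, Q.gi a x * Q.g c x = if a = c then 1 else 0 := fun c => by
      rw [← sum_gi_g]
      exact Finset.sum_congr rfl fun _ _ => by rw [Q.g_comm]
    simp [e1]

/-- `X` and `Y` are left existential: they are multiplied by `k^a` and `k^b`, so only their
existence is used. -/
lemma lie_zz : ∃ X Y : Fin n → Matrix (TIdx n) (TIdx n) R, ∀ a b,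
    ∑ c, Q.kf s t c • endD Q.d Q.tconn c (Q.zz (fun a => v * Q.grad s a) a b)
      = ∑ c, Q.d c (Q.kf s t a) • Q.zz (fun a => v * Q.grad s a) c b
        + ∑ c, Q.d c (Q.kf s t b) • Q.zz (fun a => v * Q.grad s a) a c
        - (2 * Q.kν s t) • Q.zz (fun a => v * Q.grad s a) a b
        + Q.kf s t a • X b + Q.kf s t b • Y a := by
  set u : Fin n → R := fun a => v * Q.grad s a with hu
  refine ⟨fun b => Matrix.of fun B A => zv u b B * (match A with
          | .inl _ => v * (Q.tau s + v * Q.ip s s)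
          | .inr (.inl e) => -(v * Q.grad s e)
          | .inr (.inr _) => -1),
    fun a => Matrix.of fun B A => (match B with
          | .inl _ => -1
          | .inr (.inl e) => -(v * Q.d e s)
          | .inr (.inr _) => v * (Q.tau s + v * Q.ip s s)) * Q.zd u a A, fun a b => ?_⟩
  ext B A
  have h1 := lie_zv hn hs ht hv b B
  have h2 := lie_zd hn hs ht hv a A
  rw [← hu] at h1 h2
  simp only [Matrix.sum_apply, Matrix.add_apply, Matrix.sub_apply, Matrix.smul_apply, smul_eq_mul,
    endD, matD_apply, Matrix.mul_apply, zz, Matrix.of_apply, Derivation.leibniz]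
  generalize hp : (match B with
          | .inl _ => -1
          | .inr (.inl e) => -(v * Q.d e s)
          | .inr (.inr _) => v * (Q.tau s + v * Q.ip s s) : R) = p at h1 ⊢
  generalize hq : (match A with
          | .inl _ => v * (Q.tau s + v * Q.ip s s)
          | .inr (.inl e) => -(v * Q.grad s e)
          | .inr (.inr _) => -1 : R) = q at h2 ⊢
  have e : ∀ c, Q.kf s t c * (zv u b B * Q.d c (Q.zd u a A) + Q.zd u a A * Q.d c (zv u b B)
      + (∑ K, Q.tconn c B K * (zv u b K * Q.zd u a A)
        - ∑ K, zv u b B * Q.zd u a K * Q.tconn c K A))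
      = Q.zd u a A * (Q.kf s t c * (Q.d c (zv u b B) + ∑ K, Q.tconn c B K * zv u b K))
        + zv u b B * (Q.kf s t c * (Q.d c (Q.zd u a A) - ∑ K, Q.zd u a K * Q.tconn c K A)) := by
    intro c
    simp only [mul_assoc (zv u b B), ← Finset.mul_sum, ← mul_assoc (Q.tconn c B _),
      ← Finset.sum_mul]
    ring
  have f1 : ∑ c, Q.d c (Q.kf s t a) * (zv u b B * Q.zd u c A)
      = zv u b B * ∑ c, Q.d c (Q.kf s t a) * Q.zd u c A := by
    rw [Finset.mul_sum]
    exact Finset.sum_congr rfl fun _ _ => by ring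
  have f2 : ∑ c, Q.d c (Q.kf s t b) * (zv u c B * Q.zd u a A)
      = Q.zd u a A * ∑ c, Q.d c (Q.kf s t b) * zv u c B := by
    rw [Finset.mul_sum]
    exact Finset.sum_congr rfl fun _ _ => by ring
  simp only [e, Finset.sum_add_distrib, ← Finset.mul_sum, f1, f2, h1, h2]
  ring

end TwoScales

end AlgMetric
end Tractor

/-! ### The curvature term of `𝔻` and its compatibility with `∇_k`. -/

namespace Tractor
namespace AlgMetric

variable {n r : ℕ} {R : Type*} [CommRing R] [Algebra ℝ R] {Q : AlgMetric n R}

lemma nab_sum {Md ι : Type*} [AddCommGroup Md] [Module R Md] (D : Fin n → Md →+ Md)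
    (X : Fin n → R) (S : Finset ι) (f : ι → Md) :
    nab D X (∑ i ∈ S, f i) = ∑ i ∈ S, nab D X (f i) := by
  simp only [nab, map_sum, Finset.smul_sum]
  rw [Finset.sum_comm]

lemma nab_neg {Md : Type*} [AddCommGroup Md] [Module R Md] (D : Fin n → Md →+ Md)
    (X : Fin n → R) (m : Md) : nab D X (-m) = -nab D X m := by
  simp only [nab, map_neg, smul_neg, Finset.sum_neg_distrib]

lemma nab_act (X : Fin n → R) (S : Matrix (TIdx n) (TIdx n) R) (V : (Fin r → TIdx n) → R) :
    nab (tensD Q.d Q.tconn) X (act S V) = act S (nab (tensD Q.d Q.tconn) X V)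
      + act (∑ c, X c • endD Q.d Q.tconn c S) V := by
  simp only [nab, tensD_act, smul_add, Finset.sum_add_distrib, map_sum, map_smul,
    LinearMap.sum_apply, LinearMap.smul_apply]

section TwoScales

variable (hn : 3 ≤ n) {s t v : R} (hs : Q.IsAlmostEinstein s) (ht : Q.IsAlmostEinstein t)
  (hv : s * v = 1)

include hn hs ht hv

/-- The index terms of `lie_zz` and `lie_tcurv` cancel in the contraction, the `X` and `Y` terms die
by `k^a Ω_ab = 0`, and the weight term `2ν` survives. -/
lemma curvTerm_nab (m : (Fin r → TIdx n) → R) :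
    Q.curvTerm (fun a => v * Q.grad s a) (nab (tensD Q.d Q.tconn) (Q.kf s t) m)
      = nab (tensD Q.d Q.tconn) (Q.kf s t) (Q.curvTerm (fun a => v * Q.grad s a) m)
        + (2 * Q.kν s t) • Q.curvTerm (fun a => v * Q.grad s a) m := by
  obtain ⟨X, Y, h⟩ := lie_zz hn hs ht hv
  set S := Q.zz (fun a => v * Q.grad s a)
  have kT : ∀ b, ∑ a, Q.kf s t a • act (Q.tcurv a b) m = 0 := fun b => by
    have := congrArg (fun T => act T m) (sum_kf_tcurv hn hs ht hv b)
    simpa only [map_sum, map_smul, LinearMap.sum_apply, LinearMap.smul_apply, map_zero,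
      LinearMap.zero_apply] using this
  have kT' : ∀ a, ∑ b, Q.kf s t b • act (Q.tcurv a b) m = 0 := fun a => by
    have : ∑ b, Q.kf s t b • act (Q.tcurv a b) m = -∑ b, Q.kf s t b • act (Q.tcurv b a) m := by
      rw [← Finset.sum_neg_distrib]
      exact Finset.sum_congr rfl fun b _ => by
        rw [tcurv_swap, map_neg, LinearMap.neg_apply, smul_neg]
    rw [this, kT, neg_zero]
  have z1 : ∑ a, ∑ b, Q.kf s t a • act (X b) (act (Q.tcurv a b) m) = 0 := by
    rw [Finset.sum_comm]
    refine Finset.sum_eq_zero fun b _ => ?_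
    rw [← map_zero (act (X b)), ← kT b]
    simp only [map_sum, map_smul]
  have z2 : ∑ a, ∑ b, Q.kf s t b • act (Y a) (act (Q.tcurv a b) m) = 0 := by
    refine Finset.sum_eq_zero fun a _ => ?_
    rw [← map_zero (act (Y a)), ← kT' a]
    simp only [map_sum, map_smul]
  have key : ∑ a, ∑ b, (act (S a b) (act (∑ c, Q.kf s t c • endD Q.d Q.tconn c (Q.tcurv a b)) m)
        + act (∑ c, Q.kf s t c • endD Q.d Q.tconn c (S a b)) (act (Q.tcurv a b) m))
      = -((2 * Q.kν s t) • ∑ a, ∑ b, act (S a b) (act (Q.tcurv a b) m)) := by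
    simp only [h, lie_tcurv hn hs ht hv, map_add, map_sub, map_neg, map_sum, map_smul,
      LinearMap.add_apply, LinearMap.sub_apply, LinearMap.neg_apply, LinearMap.sum_apply,
      LinearMap.smul_apply, Finset.sum_add_distrib, Finset.sum_sub_distrib,
      Finset.sum_neg_distrib, z1, z2, Finset.smul_sum]
    have t1 : ∑ a, ∑ b, ∑ c, Q.d a (Q.kf s t c) • act (S a b) (act (Q.tcurv c b) m)
        = ∑ a, ∑ b, ∑ c, Q.d c (Q.kf s t a) • act (S c b) (act (Q.tcurv a b) m) := by
      rw [Finset.sum_comm, Finset.sum_comm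
        (f := fun a b => ∑ c, Q.d c (Q.kf s t a) • act (S c b) (act (Q.tcurv a b) m))]
      refine Finset.sum_congr rfl fun _ _ => ?_
      rw [Finset.sum_comm]
    have t2 : ∑ a, ∑ b, ∑ c, Q.d b (Q.kf s t c) • act (S a b) (act (Q.tcurv a c) m)
        = ∑ a, ∑ b, ∑ c, Q.d c (Q.kf s t b) • act (S a c) (act (Q.tcurv a b) m) := by
      refine Finset.sum_congr rfl fun _ _ => ?_
      rw [Finset.sum_comm]
    rw [t1, t2]
    abel
  simp only [curvTerm_apply, nab_neg, nab_sum, nab_act, map_add]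
  simp only [Finset.sum_add_distrib] at key ⊢
  rw [smul_neg, ← key]
  abel

lemma sum_kf_tensD (b : Fin n) (m : (Fin r → TIdx n) → R) :
    ∑ a, Q.kf s t a • (tensD Q.d Q.tconn a (tensD Q.d Q.tconn b m)
      - tensD Q.d Q.tconn b (tensD Q.d Q.tconn a m)) = 0 := by
  simp only [tensD_comm Q.d Q.tconn Q.d_comm, curv_tconn]
  have := congrArg (fun T => act T m) (sum_kf_tcurv hn hs ht hv b)
  simpa only [map_sum, map_smul, LinearMap.sum_apply, LinearMap.smul_apply, map_zero,
    LinearMap.zero_apply] using this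

end TwoScales

section WTractor

/-- The components of `Z_A^a`, in an algebra. -/
def zA (a : Fin n) : TIdx n → R
  | .inl _ => 0
  | .inr (.inl b) => if b = a then 1 else 0
  | .inr (.inr _) => 0

/-- The components of `X_A`, in an algebra. -/
def xA : TIdx n → R
  | .inl _ => 0
  | .inr (.inl _) => 0
  | .inr (.inr _) => 1

/-- The components of `2 X_{[A} Z_{B]}^b`, in an algebra. -/
def xzA (b : Fin n) (A B : TIdx n) : R := xA A * zA b B - xA B * zA b A

variable (Q) in
/-- The inverse tractor metric. -/
def hI : TIdx n → TIdx n → R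
  | .inl _, .inr (.inr _) => 1
  | .inr (.inr _), .inl _ => 1
  | .inr (.inl a), .inr (.inl b) => Q.gi a b
  | _, _ => 0

variable (Q) in
/-- The `W`-tractor. -/
def wT (A B C E : TIdx n) : R :=
  ((n : R) - 4) *
      ((∑ a, ∑ b, ∑ c, ∑ e, zA a A * zA b B * zA c C * zA e E * Q.weylLow a b c e)
        - (∑ a, ∑ b, ∑ e, zA a A * zA b B * xzA e C E * Q.cot e a b)
        - (∑ b, ∑ c, ∑ e, xzA b A B * zA c C * zA e E * Q.cot b c e))
    + ∑ b, ∑ e, xzA b A B * xzA e C E * Q.bachT e b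

variable (Q) in
/-- The `W`-tractor with values in `End ⊗ End`. -/
def wE (A B C E : TIdx n) : R := ∑ A', ∑ C', Q.hI A A' * Q.hI C C' * Q.wT A' B C' E

variable (Q) in
/-- The tractor curvature with lowered indices. -/
def tcurvLow (a b : Fin n) (C E : TIdx n) : R :=
  (∑ c, ∑ e, zA c C * zA e E * Q.weylLow a b c e) - ∑ e, xzA e C E * Q.cot e a b

lemma sum_hI_tcurvLow (a b : Fin n) (C E : TIdx n) :
    ∑ C', Q.hI C C' * Q.tcurvLow a b C' E = -Q.tcurv a b E C := by
  rcases C with _ | c | _ <;> rcases E with _ | e | _ <;>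
    simp [hI, tcurvLow, xzA, zA, xA, tcurv, sum_gi_weylLow]
  exact Finset.sum_congr rfl fun _ _ => by rw [Q.gi_comm]; ring

lemma sum_hI_zA (u : Fin n → R) (X : Fin n → Fin n → R) (hX : ∀ a b, X b a = -X a b)
    (A B : TIdx n) : ∑ A', Q.hI A A' * (∑ a, ∑ b, zA a A' * zA b B * X a b
      - ∑ b, xzA b A' B * ∑ a, u a * X a b) = ∑ a, ∑ b, zv u b B * Q.zd u a A * X a b := by
  rcases A with _ | c | _ <;> rcases B with _ | e | _ <;>
    simp [hI, xzA, zA, xA, zv, zd]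
  -- The left side has no `X_A X_B` component; on the right it is `u u` contracted with a skew `X`.
  · have h : ∑ a, ∑ b, u b * u a * X a b = -∑ a, ∑ b, u b * u a * X a b := by
      conv_lhs => rw [Finset.sum_comm]
      simp only [← Finset.sum_neg_distrib]
      exact Finset.sum_congr rfl fun _ _ => Finset.sum_congr rfl fun _ _ => by rw [hX]; ring
    linear_combination -(algebraMap ℝ R (1 / 2)) * h
      + (∑ a, ∑ b, u b * u a * X a b) * half (R := R)
  · exact Finset.sum_congr rfl fun _ _ => by rw [Q.gi_comm]
  · simp only [Finset.mul_sum, ← Finset.sum_neg_distrib]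
    exact Finset.sum_congr rfl fun x _ => Finset.sum_congr rfl fun a _ => by
      rw [Q.gi_comm, hX a x]; ring

/-- Once Cotton and Bach are contractions with `u`, the four terms of `W` are the expansion of `(Z -
uX)(Z - uX)Ω`, whose `XX` part vanishes because `Ω` is skew. -/
lemma wT_eq {u : Fin n → R} (hc : ∀ a b c, Q.cot a b c = ∑ m, u m * Q.weylLow m a b c)
    (hb : ∀ a b, Q.bachT a b = ((n : R) - 4) * ∑ m, u m * Q.cot a m b) (A B C E : TIdx n) :
    Q.wT A B C E = ((n : R) - 4) * (∑ a, ∑ b, zA a A * zA b B * Q.tcurvLow a b C E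
      - ∑ b, xzA b A B * ∑ a, u a * Q.tcurvLow a b C E) := by
  have e1 : ∀ b, ∑ a, u a * Q.tcurvLow a b C E = (∑ c, ∑ e, zA c C * zA e E * Q.cot b c e)
      - ∑ e, xzA e C E * ∑ a, u a * Q.cot e a b := fun b => by
    simp only [tcurvLow, mul_sub, Finset.sum_sub_distrib]
    congr 1
    · simp only [hc b, Finset.mul_sum]
      rw [Finset.sum_comm]
      refine Finset.sum_congr rfl fun _ _ => ?_
      rw [Finset.sum_comm]
      exact Finset.sum_congr rfl fun _ _ => Finset.sum_congr rfl fun _ _ => by ring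
    · simp only [Finset.mul_sum]
      rw [Finset.sum_comm]
      exact Finset.sum_congr rfl fun _ _ => Finset.sum_congr rfl fun _ _ => by ring
  have e2 : ∑ b, ∑ e, xzA b A B * xzA e C E * Q.bachT e b
      = ((n : R) - 4) * ∑ b, xzA b A B * ∑ e, xzA e C E * ∑ a, u a * Q.cot e a b := by
    simp only [hb]
    rw [Finset.mul_sum]
    refine Finset.sum_congr rfl fun b _ => ?_
    rw [← mul_assoc, Finset.mul_sum]
    exact Finset.sum_congr rfl fun e _ => by ring
  simp only [e1]
  rw [wT, e2]
  simp only [tcurvLow, mul_sub, Finset.sum_sub_distrib, Finset.mul_sum, mul_assoc]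
  ring

lemma wE_eq {u : Fin n → R} (hc : ∀ a b c, Q.cot a b c = ∑ m, u m * Q.weylLow m a b c)
    (hb : ∀ a b, Q.bachT a b = ((n : R) - 4) * ∑ m, u m * Q.cot a m b) (A B C E : TIdx n) :
    Q.wE A B C E
      = -(((n : R) - 4) * ∑ a, ∑ b, zv u b B * Q.zd u a A * Q.tcurv a b E C) := by
  have hX := sum_hI_zA (Q := Q) u (fun a b => -Q.tcurv a b E C)
    (fun a b => by rw [tcurv_swap]; simp) A B
  simp only [mul_neg, Finset.sum_neg_distrib] at hX
  rw [← mul_neg, ← hX, wE, Finset.mul_sum]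
  refine Finset.sum_congr rfl fun A' _ => ?_
  simp only [wT_eq hc hb]
  have e : ∀ C', Q.hI A A' * Q.hI C C' * (((n : R) - 4) *
      (∑ a, ∑ b, zA a A' * zA b B * Q.tcurvLow a b C' E
        - ∑ b, xzA b A' B * ∑ a, u a * Q.tcurvLow a b C' E))
      = ((n : R) - 4) * (Q.hI A A' *
        (∑ a, ∑ b, zA a A' * zA b B * (Q.hI C C' * Q.tcurvLow a b C' E)
        - ∑ b, xzA b A' B * ∑ a, u a * (Q.hI C C' * Q.tcurvLow a b C' E))) := fun C' => by
    have h1 : ∑ a, ∑ b, zA a A' * zA b B * (Q.hI C C' * Q.tcurvLow a b C' E)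
        = Q.hI C C' * ∑ a, ∑ b, zA a A' * zA b B * Q.tcurvLow a b C' E := by
      simp only [Finset.mul_sum]
      exact Finset.sum_congr rfl fun _ _ => Finset.sum_congr rfl fun _ _ => by ring
    have h2 : ∑ b, xzA b A' B * ∑ a, u a * (Q.hI C C' * Q.tcurvLow a b C' E)
        = Q.hI C C' * ∑ b, xzA b A' B * ∑ a, u a * Q.tcurvLow a b C' E := by
      simp only [Finset.mul_sum]
      exact Finset.sum_congr rfl fun _ _ => Finset.sum_congr rfl fun _ _ => by ring
    rw [h1, h2]; ring
  simp only [e, ← Finset.mul_sum, Finset.sum_sub_distrib]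
  congr 2
  have s1 : ∑ C', ∑ a, ∑ b, zA a A' * zA b B * (Q.hI C C' * Q.tcurvLow a b C' E)
      = -∑ a, ∑ b, zA a A' * zA b B * Q.tcurv a b E C := by
    rw [Finset.sum_comm, ← Finset.sum_neg_distrib]
    refine Finset.sum_congr rfl fun a _ => ?_
    rw [Finset.sum_comm, ← Finset.sum_neg_distrib]
    refine Finset.sum_congr rfl fun b _ => ?_
    rw [← Finset.mul_sum, sum_hI_tcurvLow, mul_neg]
  have s2 : ∑ C', ∑ b, xzA b A' B * ∑ a, u a * (Q.hI C C' * Q.tcurvLow a b C' E)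
      = -∑ b, xzA b A' B * ∑ a, u a * Q.tcurv a b E C := by
    rw [Finset.sum_comm, ← Finset.sum_neg_distrib]
    refine Finset.sum_congr rfl fun b _ => ?_
    rw [← Finset.mul_sum, Finset.sum_comm, ← mul_neg, ← Finset.sum_neg_distrib]
    congr 1
    refine Finset.sum_congr rfl fun a _ => ?_
    rw [← Finset.mul_sum, sum_hI_tcurvLow, mul_neg]
  rw [s1, s2]

variable (Q) in
/-- The operator `W♯♯`. -/
def wSharp : ((Fin r → TIdx n) → R) →ₗ[R] ((Fin r → TIdx n) → R) where
  toFun V I := ∑ k, ∑ K, ∑ l, ∑ L, Q.wE K (I k) L (Function.update I k K l)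
    * V (Function.update (Function.update I k K) l L)
  map_add' V V' := by
    ext I; simp only [Pi.add_apply, mul_add, Finset.sum_add_distrib]
  map_smul' a V := by
    ext I; simp only [Pi.smul_apply, smul_eq_mul, Finset.mul_sum, RingHom.id_apply,
      mul_left_comm]

lemma wSharp_apply (V : (Fin r → TIdx n) → R) (I : Fin r → TIdx n) :
    Q.wSharp V I = ∑ k, ∑ K, ∑ l, ∑ L, Q.wE K (I k) L (Function.update I k K l)
      * V (Function.update (Function.update I k K) l L) := rfl

lemma sum_comm_five {ι κ T N : Type*} [AddCommMonoid N] [Fintype ι] [Fintype κ] [Fintype T]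
    (f : ι → κ → T → κ → T → N) : ∑ a, ∑ k, ∑ K, ∑ l, ∑ L, f a k K l L
      = ∑ k, ∑ K, ∑ l, ∑ L, ∑ a, f a k K l L := by
  rw [Finset.sum_comm]
  refine Finset.sum_congr rfl fun _ _ => ?_
  rw [Finset.sum_comm]
  refine Finset.sum_congr rfl fun _ _ => ?_
  rw [Finset.sum_comm]
  refine Finset.sum_congr rfl fun _ _ => ?_
  rw [Finset.sum_comm]

/-- The second `♯` reads the index already updated by the first, so `W♯♯` is a sum of composites of
`act`. -/
lemma wSharp_eq {u : Fin n → R} (hc : ∀ a b c, Q.cot a b c = ∑ m, u m * Q.weylLow m a b c)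
    (hb : ∀ a b, Q.bachT a b = ((n : R) - 4) * ∑ m, u m * Q.cot a m b)
    (V : (Fin r → TIdx n) → R) : Q.wSharp V = ((n : R) - 4) • Q.curvTerm u V := by
  ext I
  have hR : Q.curvTerm u V I = -∑ k, ∑ K, ∑ l, ∑ L, ∑ a, ∑ b,
      zv u b (I k) * Q.zd u a K * Q.tcurv a b (Function.update I k K l) L
        * V (Function.update (Function.update I k K) l L) := by
    rw [curvTerm_apply]
    simp only [Pi.neg_apply, Finset.sum_apply, act_apply, Finset.mul_sum, zz]
    congr 1
    rw [← sum_comm_five]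
    refine Finset.sum_congr rfl fun a _ => ?_
    rw [← sum_comm_five]
    simp only [Matrix.of_apply, mul_assoc]
  rw [wSharp_apply, Pi.smul_apply, smul_eq_mul, hR, mul_neg]
  simp only [wE_eq hc hb, Finset.mul_sum, ← Finset.sum_neg_distrib, neg_mul, Finset.sum_mul,
    mul_assoc]

variable (Q) in
/-- The curvature term of the operator `𝔻`. -/
def curvOp : ((Fin r → TIdx n) → R) →ₗ[R] ((Fin r → TIdx n) → R) :=
  if n = 4 then 0 else algebraMap ℝ R (1 / ((n : ℝ) - 4)) • Q.wSharp

lemma curvOp_nab (hn : 3 ≤ n) {s t v : R} (hs : Q.IsAlmostEinstein s) (ht : Q.IsAlmostEinstein t)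
    (hv : s * v = 1) (m : (Fin r → TIdx n) → R) :
    Q.curvOp (nab (tensD Q.d Q.tconn) (Q.kf s t) m)
      = nab (tensD Q.d Q.tconn) (Q.kf s t) (Q.curvOp m) + (2 * Q.kν s t) • Q.curvOp m := by
  unfold curvOp
  split_ifs with h4
  · simp [nab]
  · have h4' : (n : ℝ) - 4 ≠ 0 := by
      rw [sub_ne_zero]; exact_mod_cast h4
    -- Here `u = s⁻¹∇s`. The operator itself does not involve the scale, but this form of it does,
    -- and it is available only for an invertible Einstein scale.
    have hc : ∀ a b c, Q.cot a b c = ∑ m, (v * Q.grad s m) * Q.weylLow m a b c := fun a b c => by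
      have := cot_mul_self hn hs a b c
      simp only [mul_assoc, ← Finset.mul_sum]
      simp only [mul_comm (Q.grad s _), ← this]
      linear_combination (-Q.cot a b c) * hv
    have hb : ∀ a b, Q.bachT a b = ((n : R) - 4) * ∑ m, (v * Q.grad s m) * Q.cot a m b :=
      fun a b => by
        have := bach_mul hn hs hv a b
        simp only [mul_assoc, ← Finset.mul_sum]
        linear_combination v * this - Q.bachT a b * hv
    have hW : ∀ V : (Fin r → TIdx n) → R, (algebraMap ℝ R (1 / ((n : ℝ) - 4)) • Q.wSharp) V
        = Q.curvTerm (fun a => v * Q.grad s a) V := fun V => by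
      rw [LinearMap.smul_apply, wSharp_eq hc hb, smul_smul]
      have : (n : R) - 4 = algebraMap ℝ _ ((n : ℝ) - 4) := by simp [map_ofNat]
      rw [this, ← map_mul, one_div_mul_cancel h4', map_one, one_smul]
    rw [hW, hW]
    exact curvTerm_nab hn hs ht hv m

end WTractor

end AlgMetric
end Tractor

/-! ### From functions smooth on an open set to the differential algebra. -/

namespace Tractor

section SmoothFunctions

variable {n : ℕ} {U : TopologicalSpace.Opens (Coord n)}

lemma contDiffOn_pd {f : Coord n → ℝ} (hf : ContDiffOn ℝ ∞ f U) (i : Fin n) :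
    ContDiffOn ℝ ∞ (pd i f) U :=
  (hf.fderiv_of_isOpen U.2 (by norm_cast)).clm_apply contDiffOn_const

lemma differentiableAt_of_contDiffOn {f : Coord n → ℝ} (hf : ContDiffOn ℝ ∞ f U) {x : Coord n}
    (hx : x ∈ U) : DifferentiableAt ℝ f x :=
  (hf.contDiffAt (U.2.mem_nhds hx)).differentiableAt (by simp)

lemma pd_congr {f f' : Coord n → ℝ} (h : ∀ x ∈ U, f x = f' x) {x : Coord n} (hx : x ∈ U)
    (i : Fin n) : pd i f x = pd i f' x := by
  rw [pd, pd, Filter.EventuallyEq.fderiv_eq (Filter.eventuallyEq_of_mem (U.2.mem_nhds hx) h)]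

lemma pd_comm {f : Coord n → ℝ} (hf : ContDiffOn ℝ ∞ f U) {x : Coord n} (hx : x ∈ U)
    (i j : Fin n) : pd i (pd j f) x = pd j (pd i f) x := by
  have hd : DifferentiableAt ℝ (fderiv ℝ f) x :=
    ((hf.fderiv_of_isOpen (m := ∞) U.2 (by norm_cast)).contDiffAt
      (U.2.mem_nhds hx)).differentiableAt (by simp)
  have key : ∀ a b : Fin n, pd a (pd b f) x
      = fderiv ℝ (fderiv ℝ f) x (EuclideanSpace.single a 1) (EuclideanSpace.single b 1) :=
    fun a b => by
      have := (hd.hasFDerivAt.clm_apply (hasFDerivAt_const (EuclideanSpace.single b (1 : ℝ)) x))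
      rw [pd, show pd b f = fun y => fderiv ℝ f y (EuclideanSpace.single b 1) from rfl,
        this.fderiv]
      simp
  rw [key, key]
  exact ((hf.contDiffAt (U.2.mem_nhds hx)).isSymmSndFDerivAt (by
    rw [minSmoothness_of_isRCLikeNormedField]; exact WithTop.coe_le_coe.2 (le_top : (2 : ℕ∞) ≤ ⊤))) _ _

variable (U) in
/-- The functions that are smooth on an open set. -/
def smoothAlg : Subalgebra ℝ (Coord n → ℝ) where
  carrier := {f | ContDiffOn ℝ ∞ f U}
  mul_mem' ha hb := ContDiffOn.mul ha hb
  add_mem' ha hb := ContDiffOn.add ha hb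
  algebraMap_mem' _ := contDiffOn_const

variable (U) in
open Classical in
/-- The partial derivatives, extended by zero. -/
def smoothAlg.deriv (i : Fin n) : Derivation ℝ (smoothAlg U) (smoothAlg U) :=
  Derivation.mk'
    { toFun := fun f => ⟨fun x => if x ∈ U then pd i f.1 x else 0,
        (contDiffOn_pd f.2 i).congr fun x hx => if_pos hx⟩
      map_add' := fun f g => by
        ext x
        by_cases hx : x ∈ U
        · simp only [hx, if_true, pd, Subalgebra.coe_add, Pi.add_apply]
          rw [fderiv_add (differentiableAt_of_contDiffOn f.2 hx)
            (differentiableAt_of_contDiffOn g.2 hx)]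
          rfl
        · simp [hx]
      map_smul' := fun c f => by
        ext x
        by_cases hx : x ∈ U
        · simp only [hx, if_true, pd, Subalgebra.coe_smul, Pi.smul_apply, RingHom.id_apply]
          rw [fderiv_const_smul (differentiableAt_of_contDiffOn f.2 hx)]
          rfl
        · simp [hx] }
    (fun f g => by
      ext x
      by_cases hx : x ∈ U
      · simp only [LinearMap.coe_mk, AddHom.coe_mk, hx, if_true, pd, Subalgebra.coe_mul,
          Subalgebra.coe_add, Pi.add_apply, Pi.mul_apply, smul_eq_mul]
        rw [fderiv_mul (differentiableAt_of_contDiffOn f.2 hx)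
          (differentiableAt_of_contDiffOn g.2 hx)]
        rfl
      · simp [hx])

/-- The value at a point. -/
def smoothAlg.ev (x : Coord n) : smoothAlg U →ₐ[ℝ] ℝ :=
  (Pi.evalAlgHom ℝ (fun _ : Coord n => ℝ) x).comp (smoothAlg U).val

open smoothAlg

/-- As `U` is open, derivatives on `U` only see values on `U`. So functions need to match algebra
elements on `U` only, and the comparison survives iterated differentiation. -/
lemma smoothAlg.ev_deriv {f : smoothAlg U} {f' : Coord n → ℝ} (h : ∀ y ∈ U, f' y = ev y f)
    {x : Coord n} (hx : x ∈ U) (i : Fin n) : pd i f' x = ev x (deriv U i f) := by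
  rw [pd_congr h hx]
  exact (if_pos hx).symm

lemma smoothAlg.deriv_of_notMem {f : smoothAlg U} {x : Coord n} (hx : x ∉ U) (i : Fin n) :
    (deriv U i f).1 x = 0 := if_neg hx

lemma smoothAlg.deriv_comm (i j : Fin n) (f : smoothAlg U) :
    deriv U i (deriv U j f) = deriv U j (deriv U i f) := by
  ext x
  by_cases hx : x ∈ U
  · have h : ∀ a, ∀ y ∈ U, pd a f.1 y = ev y (deriv U a f) :=
      fun a y hy => ev_deriv (fun _ _ => rfl) hy a
    have h2 : ∀ a b, pd a (pd b f.1) x = ev x (deriv U a (deriv U b f)) :=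
      fun a b => ev_deriv (h b) hx a
    exact (h2 i j).symm.trans ((pd_comm f.2 hx i j).trans (h2 j i))
  · rw [deriv_of_notMem hx, deriv_of_notMem hx]

open Classical in
/-- A smooth function on an open set, extended by a constant. -/
def smoothAlg.extend (a : ℝ) (f : Coord n → ℝ) (hf : ContDiffOn ℝ ∞ f U) : smoothAlg U :=
  ⟨fun x => if x ∈ U then f x else a, hf.congr fun _ hx => if_pos hx⟩

lemma smoothAlg.ev_extend {a : ℝ} {f : Coord n → ℝ} (hf : ContDiffOn ℝ ∞ f U) {x : Coord n}
    (hx : x ∈ U) : ev x (extend a f hf) = f x := if_pos hx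

lemma smoothAlg.extend_of_notMem {a : ℝ} {f : Coord n → ℝ} (hf : ContDiffOn ℝ ∞ f U) {x : Coord n}
    (hx : x ∉ U) : ev x (extend a f hf) = a := if_neg hx

lemma smoothAlg.ext_ev {f g : smoothAlg U} (h : ∀ x, ev x f = ev x g) : f = g :=
  Subtype.ext (funext h)

/-- Elements are functions on the whole space, so non-vanishing is needed off `U` too. Hence metrics
are extended by the identity matrix and scales by `1`. -/
lemma smoothAlg.exists_inv (f : smoothAlg U) (hf : ∀ x, ev x f ≠ 0) : ∃ v, f * v = 1 :=
  ⟨⟨fun x => (f.1 x)⁻¹, f.2.inv fun x _ => hf x⟩, ext_ev fun x => by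
    rw [map_mul, map_one]; exact mul_inv_cancel₀ (hf x)⟩

/-- The conditions on the coefficients of a metric on an open set. -/
structure IsMetricOn (U : TopologicalSpace.Opens (Coord n)) (G : MetricCoeff n) : Prop where
  smooth : ∀ i j, ContDiffOn ℝ ∞ (fun x => G x i j) U
  symm : ∀ x ∈ U, ∀ i j, G x i j = G x j i
  det_ne_zero : ∀ x ∈ U, (G x).det ≠ 0

variable {G : MetricCoeff n}

/-- The coefficients of a metric, extended by the identity matrix. -/
def IsMetricOn.mat (hG : IsMetricOn U G) : Matrix (Fin n) (Fin n) (smoothAlg U) :=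
  Matrix.of fun i j => extend (if i = j then 1 else 0) (fun x => G x i j) (hG.smooth i j)

lemma IsMetricOn.ev_mat (hG : IsMetricOn U G) {x : Coord n} (hx : x ∈ U) :
    (ev x).mapMatrix hG.mat = G x := by
  ext i j
  exact ev_extend (hG.smooth i j) hx

lemma IsMetricOn.ev_mat_of_notMem (hG : IsMetricOn U G) {x : Coord n} (hx : x ∉ U) :
    (ev x).mapMatrix hG.mat = 1 := by
  ext i j
  rw [Matrix.one_apply]
  exact extend_of_notMem (hG.smooth i j) hx

lemma IsMetricOn.isUnit_det (hG : IsMetricOn U G) : IsUnit hG.mat.det := by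
  obtain ⟨v, hv⟩ := exists_inv hG.mat.det fun x => by
    rw [AlgHom.map_det]
    by_cases hx : x ∈ U
    · rw [hG.ev_mat hx]; exact hG.det_ne_zero x hx
    · rw [hG.ev_mat_of_notMem hx]; simp
  exact IsUnit.of_mul_eq_one v hv

/-- The metric over the algebra of smooth functions. -/
def IsMetricOn.alg (hG : IsMetricOn U G) : AlgMetric n (smoothAlg U) where
  d := deriv U
  d_comm := deriv_comm
  g := hG.mat
  gi := hG.mat⁻¹
  g_symm := Matrix.ext fun i j => ext_ev fun x => by
    change (ev x).mapMatrix hG.mat j i = (ev x).mapMatrix hG.mat i j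
    by_cases hx : x ∈ U
    · rw [hG.ev_mat hx]; exact hG.symm x hx j i
    · rw [hG.ev_mat_of_notMem hx, Matrix.one_apply, Matrix.one_apply]; simp only [eq_comm]
  gi_mul_g := Matrix.nonsing_inv_mul _ hG.isUnit_det

section Bridge

variable (hG : IsMetricOn U G) {x : Coord n} (hx : x ∈ U)

include hx

lemma IsMetricOn.g_eq (i j : Fin n) : G x i j = ev x (hG.alg.g i j) :=
  (ev_extend (hG.smooth i j) hx).symm

lemma IsMetricOn.ginv_eq (i j : Fin n) : ginv G i j x = ev x (hG.alg.gi i j) := by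
  have h : (ev x).mapMatrix hG.alg.gi * G x = 1 := by
    rw [← hG.ev_mat hx, ← map_mul]
    exact (congrArg _ hG.alg.gi_mul_g).trans (map_one _)
  rw [ginv, Matrix.inv_eq_left_inv h]
  rfl

lemma IsMetricOn.pd_eq {f : smoothAlg U} {f' : Coord n → ℝ} (h : ∀ y ∈ U, f' y = ev y f)
    (i : Fin n) : pd i f' x = ev x (hG.alg.d i f) := ev_deriv h hx i

lemma IsMetricOn.christoffel_eq (k i j : Fin n) :
    christoffel G k i j x = ev x (hG.alg.Γ k i j) := by
  have h : ∀ i j l, pd i (fun y => G y j l) x = ev x (hG.alg.d i (hG.alg.g j l)) :=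
    fun i j l => hG.pd_eq hx (fun y hy => hG.g_eq hy j l) i
  simp only [christoffel, AlgMetric.Γ, hG.ginv_eq hx, h, map_mul, map_sum, map_add, map_sub,
    AlgHom.commutes, Algebra.algebraMap_self_apply]

lemma IsMetricOn.riemann_eq (i j k l : Fin n) :
    riemann G i j k l x = ev x (hG.alg.riem i j k l) := by
  have h : ∀ a k i j, pd a (christoffel G k i j) x = ev x (hG.alg.d a (hG.alg.Γ k i j)) :=
    fun a k i j => hG.pd_eq hx (fun y hy => hG.christoffel_eq hy k i j) a
  simp only [riemann, AlgMetric.riem, hG.christoffel_eq hx, h, map_mul, map_sum, map_add, map_sub]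

lemma IsMetricOn.ricci_eq (j l : Fin n) : ricci G j l x = ev x (hG.alg.ric j l) := by
  simp only [ricci, AlgMetric.ric, hG.riemann_eq hx, map_sum]

lemma IsMetricOn.scalarCurv_eq : scalarCurv G x = ev x hG.alg.scal := by
  simp only [scalarCurv, AlgMetric.scal, hG.ricci_eq hx, hG.ginv_eq hx, map_sum, map_mul]

lemma IsMetricOn.schouten_eq (i j : Fin n) : schouten G i j x = ev x (hG.alg.P i j) := by
  simp only [schouten, AlgMetric.P, hG.ricci_eq hx, hG.scalarCurv_eq hx, hG.g_eq hx, map_sub,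
    map_mul, AlgHom.commutes, Algebra.algebraMap_self_apply]
  ring

lemma IsMetricOn.schoutenTrace_eq : schoutenTrace G x = ev x hG.alg.J := by
  simp only [schoutenTrace, AlgMetric.J, hG.schouten_eq hx, hG.ginv_eq hx, map_sum, map_mul]

lemma IsMetricOn.weyl_eq (a b c d : Fin n) : weyl G a b c d x = ev x (hG.alg.weylLow a b c d) := by
  simp only [weyl, riemannLow, AlgMetric.weylLow, hG.schouten_eq hx, hG.g_eq hx,
    hG.riemann_eq hx, map_sum, map_mul, map_sub]

lemma IsMetricOn.covSchouten_eq (a b c : Fin n) :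
    covSchouten G a b c x = ev x (hG.alg.cov2 hG.alg.P a b c) := by
  have h : ∀ a i j, pd a (schouten G i j) x = ev x (hG.alg.d a (hG.alg.P i j)) :=
    fun a i j => hG.pd_eq hx (fun y hy => hG.schouten_eq hy i j) a
  simp only [covSchouten, AlgMetric.cov2, hG.schouten_eq hx, h, hG.christoffel_eq hx,
    map_sum, map_mul, map_sub, map_add]

lemma IsMetricOn.cotton_eq (a b c : Fin n) : cotton G a b c x = ev x (hG.alg.cot a b c) := by
  simp only [cotton, AlgMetric.cot, hG.covSchouten_eq hx, map_sub]

lemma IsMetricOn.covCotton_eq (e a b c : Fin n) :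
    covCotton G e a b c x = ev x (hG.alg.covCot e a b c) := by
  have h : ∀ e a b c, pd e (cotton G a b c) x = ev x (hG.alg.d e (hG.alg.cot a b c)) :=
    fun e a b c => hG.pd_eq hx (fun y hy => hG.cotton_eq hy a b c) e
  simp only [covCotton, AlgMetric.covCot, hG.cotton_eq hx, h, hG.christoffel_eq hx,
    map_sum, map_mul, map_sub, map_add]

lemma IsMetricOn.bach_eq (a b : Fin n) : bach G a b x = ev x (hG.alg.bachT a b) := by
  simp only [bach, schoutenUp, AlgMetric.bachT, AlgMetric.PUp, hG.covCotton_eq hx,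
    hG.ginv_eq hx, hG.schouten_eq hx, hG.weyl_eq hx, map_sum, map_mul, map_add]

lemma IsMetricOn.hInv_eq (A B : TIdx n) : hInv G A B x = ev x (hG.alg.hI A B) := by
  rcases A with _ | a | _ <;> rcases B with _ | b | _ <;>
    simp [hInv, AlgMetric.hI, hG.ginv_eq hx]

omit hx in
lemma zC_eq (a : Fin n) (A : TIdx n) : zC a A = ev (U := U) x (AlgMetric.zA a A) := by
  rcases A with _ | b | _ <;> simp [zC, AlgMetric.zA, apply_ite (ev (U := U) x)]

omit hx in
lemma xC_eq (A : TIdx n) : xC A = ev (U := U) x (AlgMetric.xA A) := by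
  rcases A with _ | b | _ <;> simp [xC, AlgMetric.xA]

lemma IsMetricOn.wEnd_eq (A B C E : TIdx n) : wEnd G A B C E x = ev x (hG.alg.wE A B C E) := by
  simp only [wEnd, wTractor, xzWedge, AlgMetric.wE, AlgMetric.wT, AlgMetric.xzA, hG.hInv_eq hx,
    hG.weyl_eq hx, hG.cotton_eq hx, hG.bach_eq hx, zC_eq (U := U) (x := x),
    xC_eq (U := U) (x := x), map_sum, map_mul, map_add, map_sub, map_natCast, map_ofNat]

lemma IsMetricOn.tractorConn_eq (a : Fin n) (A B : TIdx n) :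
    tractorConn G a A B x = ev x (hG.alg.tconn a A B) := by
  rcases A with _ | b | _ <;> rcases B with _ | c | _ <;>
    simp [tractorConn, AlgMetric.tconn, AlgMetric.Pm, hG.schouten_eq hx, hG.ginv_eq hx,
      hG.christoffel_eq hx, hG.g_eq hx, apply_ite (ev (U := U) x)]

end Bridge

end SmoothFunctions
end Tractor

/-! ### The local tractor operators as operators over the algebra. -/

namespace Tractor

section LocalOperators

variable {n r : ℕ} {U : TopologicalSpace.Opens (Coord n)} {G : MetricCoeff n}
  (hG : IsMetricOn U G)

open smoothAlg

/-- The tractor connection over the algebra of smooth functions. -/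
abbrev IsMetricOn.nabla (r : ℕ) (a : Fin n) :
    ((Fin r → TIdx n) → smoothAlg U) →+ ((Fin r → TIdx n) → smoothAlg U) :=
  tensD hG.alg.d hG.alg.tconn a

variable {V : LocalTractor n r} {m : (Fin r → TIdx n) → smoothAlg U}
  (hV : ∀ y ∈ U, ∀ I, V y I = ev y (m I)) {s : Coord n → ℝ} {S : smoothAlg U}
  (hs : ∀ y ∈ U, s y = ev y S) {x : Coord n} (hx : x ∈ U)

include hV hx in
lemma IsMetricOn.tractorNabla_eq (a : Fin n) (I : Fin r → TIdx n) :
    tractorNabla G a V x I = ev x (hG.nabla r a m I) := by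
  simp only [tractorNabla, tensD_apply, Pi.add_apply, act_apply, hG.tractorConn_eq hx, hV x hx,
    hG.pd_eq hx (fun y hy => hV y hy I) a, map_add, map_sum, map_mul]

include hV hx in
lemma IsMetricOn.tractorLaplacian_eq (I : Fin r → TIdx n) :
    tractorLaplacian G V x I = ev x (hG.alg.lapM (hG.nabla r) m I) := by
  have h1 : ∀ b, ∀ y ∈ U, ∀ I, tractorNabla G b V y I = ev y (hG.nabla r b m I) :=
    fun b y hy I => hG.tractorNabla_eq hV hy b I
  have h2 : ∀ a b, tractorNabla G a (tractorNabla G b V) x I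
      = ev x (hG.nabla r a (hG.nabla r b m) I) :=
    fun a b => hG.tractorNabla_eq (h1 b) hx a I
  simp only [tractorLaplacian, AlgMetric.lapM, h2, h1 _ x hx, hG.ginv_eq hx,
    hG.christoffel_eq hx, Finset.sum_apply, Pi.smul_apply, Pi.sub_apply, smul_eq_mul, map_sum,
    map_mul, map_sub]

include hV hx in
lemma IsMetricOn.wSharpSharp_eq (I : Fin r → TIdx n) :
    wSharpSharp G V x I = ev x (hG.alg.wSharp m I) := by
  simp only [wSharpSharp, AlgMetric.wSharp_apply, hG.wEnd_eq hx, hV x hx, map_sum, map_mul]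

include hs hx in
lemma IsMetricOn.tractorNabla_scalar (a : Fin n) (I : Fin 0 → TIdx n) :
    tractorNabla G a (fun y _ => s y) x I = ev x (hG.alg.d a S) := by
  simp [tractorNabla, hG.pd_eq hx hs a]

include hs hx in
lemma IsMetricOn.tractorLaplacian_scalar (I : Fin 0 → TIdx n) :
    tractorLaplacian G (fun y _ => s y) x I = ev x (hG.alg.lap S) := by
  have h2 : ∀ a b, tractorNabla (r := 0) G a (tractorNabla G b (fun y _ => s y)) x I
      = ev x (hG.alg.d a (hG.alg.d b S)) := fun a b => by
    simp [tractorNabla, hG.pd_eq hx (f := hG.alg.d b S)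
      (fun y hy => hG.pd_eq hy hs b) a]
  simp only [tractorLaplacian, AlgMetric.lap, AlgMetric.hess, h2, hG.tractorNabla_scalar hs hx,
    hG.ginv_eq hx, hG.christoffel_eq hx, map_sum, map_mul, map_sub]

include hs hx in
lemma IsMetricOn.scaleTractor_eq (hn : 3 ≤ n) (A : TIdx n) :
    scaleTractor G s A x = ev x (hG.alg.scaleVec S A) := by
  have hn0 : (n : ℝ) ≠ 0 := by positivity
  -- At weight one the factor `n + 2w - 2` equals `n` and cancels the normalising `1/n`.
  rcases A with _ | a | _
  · simp only [scaleTractor, tractorD, AlgMetric.scaleVec, yC, zC, xC, hs x hx]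
    field_simp
    simp
  · simp only [scaleTractor, tractorD, AlgMetric.scaleVec, yC, zC, xC,
      hG.tractorNabla_scalar hs hx]
    field_simp
    simp
  · simp only [scaleTractor, tractorD, AlgMetric.scaleVec, yC, zC, xC,
      hG.tractorLaplacian_scalar hs hx, hs x hx, hG.schoutenTrace_eq hx, AlgMetric.tau, map_neg,
      map_mul, map_add, AlgHom.commutes, Algebra.algebraMap_self_apply]
    simp
    ring

include hV hs hx in
-- The tractor metric pairs top with bottom slots: `σ` multiplies the `X` part of `𝔻`, `τ` the `Y`
-- part, and `∇σ` the `Z` part.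
lemma IsMetricOn.localModBox_eq (hn : 3 ≤ n) (w : ℝ) (I : Fin r → TIdx n) :
    localModBox G s w V x I
      = ev x (hG.alg.op (hG.nabla r) (hG.alg.curvOp) S (algebraMap ℝ _ w) m I) := by
  have hD : ∀ A, modD G w V x (Fin.cons (α := fun _ => TIdx n) A I)
      = (n + 2 * w - 2) * w * yC A * ev x (m I)
        + (n + 2 * w - 2) * ∑ a, zC a A * ev x (hG.nabla r a m I)
        - xC A * (ev x (hG.alg.lapM (hG.nabla r) m I) + w * ev x hG.alg.J * ev x (m I)
          + ev x (hG.alg.curvOp m I)) := fun A => by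
    simp only [modD, tractorD, Fin.cons_zero, Fin.tail_cons, hV x hx,
      hG.tractorNabla_eq hV hx, hG.tractorLaplacian_eq hV hx, hG.schoutenTrace_eq hx,
      hG.wSharpSharp_eq hV hx, AlgMetric.curvOp]
    split_ifs
    · simp
    · simp only [LinearMap.smul_apply, Pi.smul_apply, smul_eq_mul, map_mul, AlgHom.commutes,
        Algebra.algebraMap_self_apply]
      ring
  have hc' : ∀ T : TIdx n → ℝ, ∑ A, T A = T (.inl ()) + (∑ c, T (.inr (.inl c)))
      + T (.inr (.inr ())) := fun T => by
    rw [Fintype.sum_sum_type, Fintype.sum_sum_type]; simp [add_assoc]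
  simp only [localModBox, hD, hG.scaleTractor_eq hs hx hn, hG.hInv_eq hx]
  simp only [AlgMetric.op, AlgMetric.nab, Pi.sub_apply, Pi.smul_apply, Pi.add_apply,
    Finset.sum_apply, smul_eq_mul, map_sub (ev x), map_mul (ev x), map_add (ev x), map_sum (ev x),
    hc', map_natCast, map_ofNat, AlgHom.commutes, Algebra.algebraMap_self_apply, AlgMetric.hI, AlgMetric.scaleVec, yC, zC, xC, AlgMetric.grad, AlgMetric.up]
  simp
  have e : ∑ a, ∑ b, ev x (hG.alg.gi a b) * ev x (hG.alg.d b S) *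
      ((n + 2 * w - 2) * ev x (hG.nabla r a m I)) = (n + 2 * w - 2) *
        ∑ a, (∑ b, ev x (hG.alg.gi a b) * ev x (hG.alg.d b S)) * ev x (hG.nabla r a m I) := by
    rw [Finset.mul_sum]
    refine Finset.sum_congr rfl fun a _ => ?_
    rw [← Finset.sum_mul]
    ring
  linear_combination e

/-- A local tractor that is smooth on an open set. -/
lemma exists_lift (hV : ∀ I, ContDiffOn ℝ ∞ (fun y => V y I) U) :
    ∃ m : (Fin r → TIdx n) → smoothAlg U, ∀ y ∈ U, ∀ I, V y I = ev y (m I) :=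
  ⟨fun I => extend 0 _ (hV I), fun _ hy I => (ev_extend (hV I) hy).symm⟩

end LocalOperators

end Tractor

/-! ### Einstein scales and powers on an open set; metrics in charts. -/

namespace Tractor

section PowersOnOpenSet

variable {n r : ℕ} {U : TopologicalSpace.Opens (Coord n)} {G G₀ : MetricCoeff n}
  (hG : IsMetricOn U G)

open smoothAlg

/-- Derivations vanish off `U`, so the extended metric is flat there, and the Einstein equation
holds in the algebra and not only on `U`. -/
lemma IsMetricOn.ric_of_notMem {x : Coord n} (hx : x ∉ U) (i j : Fin n) :
    ev x (hG.alg.ric i j) = 0 := by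
  have hd : ∀ a (f : smoothAlg U), ev x (hG.alg.d a f) = 0 := fun a f => deriv_of_notMem hx a
  have hΓ : ∀ k i j, ev x (hG.alg.Γ k i j) = 0 := fun k i j => by
    simp only [AlgMetric.Γ, map_mul, map_sum, map_add, map_sub, hd]
    simp
  simp only [AlgMetric.ric, AlgMetric.riem, map_sum, map_add, map_sub, map_mul, hd, hΓ]
  simp

/-- A nowhere vanishing function `s` such that `s⁻² g` is Einstein is an almost Einstein scale. -/
lemma IsMetricOn.isAlmostEinstein (hn : 3 ≤ n) (hG₀ : IsMetricOn U G₀) {s : Coord n → ℝ}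
    (hs : ContDiffOn ℝ ∞ s U) (hs0 : ∀ y ∈ U, s y ≠ 0)
    (h : ∀ y ∈ U, ∀ i j, G₀ y i j = ((s y) ^ 2)⁻¹ * G y i j)
    (hE : ∀ y ∈ U, ∀ i j, ricci G₀ i j y = scalarCurv G₀ y / n * G₀ y i j) :
    hG.alg.IsAlmostEinstein (extend 1 s hs) ∧ ∃ v, extend 1 s hs * v = 1 := by
  obtain ⟨v, hv⟩ := exists_inv (extend 1 s hs) fun x => by
    by_cases hx : x ∈ U
    · rw [ev_extend hs hx]; exact hs0 x hx
    · rw [extend_of_notMem hs hx]; exact one_ne_zero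
  refine ⟨?_, v, hv⟩
  have hvx : ∀ x, ev x (extend 1 s hs) * ev x v = 1 := fun x => by rw [← map_mul, hv, map_one]
  refine AlgMetric.isAlmostEinstein_of_einstein (Q := hG.alg) hn (Q' := hG₀.alg) rfl hv
    (f := algebraMap ℝ _ (1 / (n : ℝ)) * hG₀.alg.scal) (fun i j => ext_ev fun x => ?_)
    (fun i j => ext_ev fun x => ?_)
  · by_cases hx : x ∈ U
    · have := hvx x
      rw [ev_extend hs hx] at this
      rw [← hG₀.g_eq hx, map_mul, ← hG.g_eq hx, map_pow, h x hx, eq_inv_of_mul_eq_one_right this,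
        inv_pow]
    -- Off `U` both metrics are the identity and the scale is `1`.
    · have := hvx x
      rw [extend_of_notMem hs hx, one_mul] at this
      rw [map_mul, map_pow, this, one_pow, one_mul]
      exact (extend_of_notMem (hG₀.smooth i j) hx).trans
        (extend_of_notMem (hG.smooth i j) hx).symm
  · by_cases hx : x ∈ U
    · rw [← hG₀.ricci_eq hx, map_mul, map_mul, ← hG₀.g_eq hx, ← hG₀.scalarCurv_eq hx, hE x hx,
        AlgHom.commutes, Algebra.algebraMap_self_apply]
      ring
    · simp [AlgMetric.scal, hG₀.ric_of_notMem hx]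

section TwoScales

variable (hn : 3 ≤ n) {S T v : smoothAlg U} (hS : hG.alg.IsAlmostEinstein S)
  (hT : hG.alg.IsAlmostEinstein T) (hv : S * v = 1)

include hn hS hT hv

lemma IsMetricOn.pow_smul_opPow (p : ℕ) {w : ℝ} (hw : w = p - n / 2)
    (m : (Fin r → TIdx n) → smoothAlg U) :
    T ^ p • hG.alg.opPow (hG.nabla r) (hG.alg.curvOp) S p (algebraMap ℝ _ w) m
      = S ^ p • hG.alg.opPow (hG.nabla r) (hG.alg.curvOp) T p (algebraMap ℝ _ w) m := by
  -- Weights are elements of the algebra here; the admissible ones are the constants of all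
  -- derivations.
  refine AlgMetric.pow_smul_opPow (hG.alg.curvOp) (fun w => ∀ a, hG.alg.d a w = 0)
    (fun w hw a => by simp [hw]) (fun w hw m => ?_) p _ (fun a => by simp) ?_ m
  · exact AlgMetric.op_comm hn hS hT (tensD_smul _ _) _
      (fun b m => AlgMetric.sum_kf_tensD hn hS hT hv b m)
      (fun m => AlgMetric.curvOp_nab hn hS hT hv m) hw hv m
  · have : (n : smoothAlg U) + 2 * algebraMap ℝ _ w = algebraMap ℝ _ (n + 2 * w) := by
      simp [map_ofNat]
    rw [this, hw, add_comm, mul_sub, mul_div_cancel₀ _ (two_ne_zero' ℝ), sub_add_cancel]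
    simp [map_ofNat]

end TwoScales

end PowersOnOpenSet

section Manifolds

variable {n : ℕ} {M : Type*} [TopologicalSpace M] [ChartedSpace (Coord n) M]
  [IsManifold (𝓡 n) ∞ M]

lemma mdifferentiable_of_mem_maximalAtlas {e : OpenPartialHomeomorph M (Coord n)}
    (he : e ∈ IsManifold.maximalAtlas (𝓡 n) ∞ M) : e.MDifferentiable (𝓡 n) (𝓡 n) :=
  ⟨(contMDiffOn_of_mem_maximalAtlas he).mdifferentiableOn (by simp),
    (contMDiffOn_symm_of_mem_maximalAtlas he).mdifferentiableOn (by simp)⟩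

/-- The domain of a chart. -/
def Chart.dom (φ : Chart n M) : TopologicalSpace.Opens (Coord n) := ⟨φ.1.target, φ.1.open_target⟩

lemma PseudoMetric.isMetricOn (g : PseudoMetric n M) (φ : Chart n M) :
    IsMetricOn φ.dom (g.coeff φ) where
  smooth i j := g.smooth φ i j
  symm x _ i j := g.symm _ _ _
  det_ne_zero x hx hdet := by
    -- A kernel vector of the Gram matrix gives a tangent vector orthogonal to all coordinate
    -- vectors. These span, as the inverse chart has bijective derivative, so nondegeneracy applies.
    obtain ⟨c, hc0, hc⟩ := Matrix.exists_mulVec_eq_zero_iff.2 hdet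
    have hb := (mdifferentiable_of_mem_maximalAtlas φ.2).symm.mfderiv_bijective
      (show x ∈ φ.1.symm.source from hx)
    set L := mfderiv (𝓡 n) (𝓡 n) φ.1.symm x with hL
    have hsum : ∀ a : Coord n, L a = ∑ j, a j • coordVec φ j x := fun a => by
      have : a = ∑ j, a j • EuclideanSpace.single j (1 : ℝ) := by
        ext i; simp [Finset.sum_apply, Pi.single_apply]
      conv_lhs => rw [this]
      exact (map_sum L _ _).trans (Finset.sum_congr rfl fun j _ => map_smul L _ _)
    have h0 : L (WithLp.toLp 2 c) = 0 := by
      refine g.nondegenerate _ _ fun v => ?_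
      obtain ⟨a, rfl⟩ := hb.2 v
      rw [g.symm, hsum a, map_sum, LinearMap.sum_apply]
      refine Finset.sum_eq_zero fun i _ => ?_
      rw [map_smul, LinearMap.smul_apply, hsum, map_sum]
      have := congrFun hc i
      simp only [Matrix.mulVec, dotProduct, Pi.zero_apply] at this
      simp only [map_smul, smul_eq_mul]
      rw [Finset.sum_congr rfl fun j _ => mul_comm _ _]
      exact mul_eq_zero_of_right _ this
    have := hb.1 (h0.trans (map_zero L).symm)
    exact hc0 (WithLp.toLp_injective 2 this)

end Manifolds

end Tractor

/-! ### Densities and tractor fields on the manifold; conclusion. -/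

namespace Tractor

section Manifolds

variable {n : ℕ} {M : Type*} [TopologicalSpace M] [ChartedSpace (Coord n) M]
  [IsManifold (𝓡 n) ∞ M] {c : ConformalStructure n M}

lemma Density.contDiffOn_chart {w : ℝ} (σ : Density c w) (g : c.metrics) (φ : Chart n M) :
    ContDiffOn ℝ ∞ (fun y => σ.val g (φ.1.symm y)) φ.dom :=
  contMDiffOn_iff_contDiffOn.1
    ((σ.smooth g).comp_contMDiffOn (contMDiffOn_symm_of_mem_maximalAtlas φ.2))

/-- A density of weight one as an element of the algebra of smooth functions on a chart. -/
def Density.lift (σ : Density c 1) (g : c.metrics) (φ : Chart n M) : smoothAlg φ.dom :=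
  smoothAlg.extend 1 _ (σ.contDiffOn_chart g φ)

lemma Density.val_eq (σ : Density c 1) (g : c.metrics) (φ : Chart n M) :
    ∀ y ∈ φ.dom, σ.val g (φ.1.symm y) = smoothAlg.ev y (σ.lift g φ) :=
  fun _ hy => (smoothAlg.ev_extend (σ.contDiffOn_chart g φ) hy).symm

lemma IsEinsteinScale.isAlmostEinstein (hn : 3 ≤ n) {σ : Density c 1} (hσ : IsEinsteinScale σ)
    (g : c.metrics) (φ : Chart n M) :
    (g.1.isMetricOn φ).alg.IsAlmostEinstein (σ.lift g φ) ∧ ∃ v, σ.lift g φ * v = 1 := by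
  obtain ⟨h0, g₀, -, hE, h⟩ := hσ
  exact (g.1.isMetricOn φ).isAlmostEinstein hn (g₀.isMetricOn φ) (σ.contDiffOn_chart g φ)
    (fun y _ => h0 g _) (fun y _ i j => h g _ _ _) (hE φ)

/-- The induction varies `w`, `V` and `m`, since the first factor replaces all three; agreement on
the chart domain is all that passes from one step to the next. -/
lemma modBoxPow_eq {r : ℕ} (hn : 3 ≤ n) (σ : Density c 1) (g : c.metrics) (φ : Chart n M) (p : ℕ) :
    ∀ (w : ℝ) (V : TractorFamily c r) (m : (Fin r → TIdx n) → smoothAlg φ.dom),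
      (∀ y ∈ φ.dom, ∀ I, V g φ y I = smoothAlg.ev y (m I)) → ∀ y ∈ φ.dom, ∀ I,
        modBoxPow σ p w V g φ y I = smoothAlg.ev y ((g.1.isMetricOn φ).alg.opPow
          ((g.1.isMetricOn φ).nabla r) (g.1.isMetricOn φ).alg.curvOp (σ.lift g φ) p
          (algebraMap ℝ _ w) m I) := by
  induction p with
  | zero => exact fun w V m hV => hV
  | succ p ih =>
    intro w V m hV y hy I
    rw [modBoxPow, AlgMetric.opPow, ← map_one (algebraMap ℝ (smoothAlg φ.dom)), ← map_sub]
    exact ih _ _ _ (fun z hz I => (g.1.isMetricOn φ).localModBox_eq hV (σ.val_eq g φ) hz hn w I)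
      y hy I

end Manifolds

end Tractor

theorem mainTheorem11 {n : ℕ} (hn : 3 ≤ n) {M : Type*} [TopologicalSpace M]
    [ChartedSpace (EuclideanSpace ℝ (Fin n)) M] [IsManifold (𝓡 n) ∞ M]
    (c : Tractor.ConformalStructure n M) (σ σ' : Tractor.Density c 1)
    (hσ : Tractor.IsEinsteinScale σ) (hσ' : Tractor.IsEinsteinScale σ')
    (p r : ℕ) (w : ℝ) (hw : w = p - n / 2)
    (V : Tractor.TractorFamily c r) (hV : Tractor.IsTractorField w V) :
    ∀ (g : c.metrics) (φ : Tractor.Chart n M), ∀ y ∈ φ.1.target, ∀ I : Fin r → Tractor.TIdx n,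
      Tractor.scaledPower σ p w V g φ y I = Tractor.scaledPower σ' p w V g φ y I := by
  intro g φ y hy I
  obtain ⟨m, hm⟩ := Tractor.exists_lift (U := φ.dom) (V := V g φ) (hV.smooth g φ)
  obtain ⟨hS, v, hv⟩ := hσ.isAlmostEinstein hn g φ
  obtain ⟨hT, -⟩ := hσ'.isAlmostEinstein hn g φ
  have key := congrArg (Tractor.smoothAlg.ev y)
    (congrFun ((g.1.isMetricOn φ).pow_smul_opPow hn hS hT hv p hw m) I)
  simp only [Pi.smul_apply, smul_eq_mul, map_mul, map_pow, ← σ.val_eq g φ y hy,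
    ← σ'.val_eq g φ y hy, ← Tractor.modBoxPow_eq hn σ g φ p w V m hm y hy I,
    ← Tractor.modBoxPow_eq hn σ' g φ p w V m hm y hy I] at key
  -- `key` is the identity cross-multiplied by `σ^p` and `σ'^p`; neither scale vanishes.
  have h1 := pow_ne_zero p (hσ.1 g (φ.1.symm y))
  have h2 := pow_ne_zero p (hσ'.1 g (φ.1.symm y))
  rw [Tractor.scaledPower, Tractor.scaledPower, inv_mul_eq_div, inv_mul_eq_div, div_eq_div_iff h1 h2]
  linear_combination key
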